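/- **Setting.** A normed continuous-time Markov game consists of a finite set $L$ of locations, partitioned into $L_r$ (reachability player) and $L_s$ (safety player), a finite set $\Sigma$ of actions, rates $\mathbf R(l,a,l')\in\mathbb Q_{\ge 0}$ and an initial distribution $\nu$ on $L$, such that $\sum_{l'}\mathbf R(l,a,l')\in\{0,1\}$ for all $l,a$, and for every $l$ the set $\Sigma(l)$ of enabled actions (those with sum $1$) is non-empty. Put $\mathbf Q(l,a,l')=\mathbf R(l,a,l')$ for $l'\ne l$ and $\mathbf Q(l,a,l)=-\sum_{l'\neq l}\mathbf R(l,a,l')$. A memoryless strategy is a measurable map $(l,t)\mapsto a\in\Sigma(l)$ (location and time to enabled action), given on the locations of the player. A pair of strategies and an initial distribution $\mu$ define a time-inhomogeneous Markov chain; its probability to be in the goal region $G\subseteq L$ at the time bound $T$ is the payoff. The value of the game is $\sup_{\mathcal S_r}\inf_{\mathcal S_s}$ of the payoff over memoryless strategies. The quality of a strategy is the payoff that it yields against an optimal counter strategy (the infimum, resp. supremum, over the memoryless strategies of the opponent). A strategy is $\pi$-optimal if its quality is at most $\pi$ worse than the value. For a vector $x\in\mathbb R^L$ let $F_l(x)=\mathrm{opt}_{a\in\Sigma(l)}\sum_{l'}\mathbf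 Q(l,a,l')x_{l'}$, where $\mathrm{opt}$ is $\max$ on $L_r$ and $\min$ on $L_s$. The $\varepsilon$-net of level $k$ is computed backwards from $T$ on intervals of length $\varepsilon=T/N$: it starts with the indicator of $G$ at time $T$; on an interval with right end $t$ and value $x$ there, put $p_0(l,\cdot)=x_l$ and, for $j\le k$, $-\dot p_j(l,\tau)=F_l(p_{j-1}(\cdot,\tau))$ with $p_j(l,t)=x_l$; the value of $p_k$ at the left end is the start value $x$ of the next interval. The strategies of the net play at every time an action that is optimal in the equation for $\dot p_k$. Triple nets have $k=3$, quadruple nets $k=4$. Running times are counted on a random access machine over the reals with unit cost for exact arithmetic operations, comparisons, memory accesses, and the extraction of a real root of a polynomial of degree at most $k-1$. **Theorem.** For $k=3$ and for $k=4$ there is one program which, for every normed Markov game, every $G\subseteq L$, every time bound $T\ge 0$ and every precision $0<\pi\le 1$, computes by an $\varepsilon$-net of level $k$ (with $\varepsilon=T/N$ for some integer $N\ge1$) * memoryless, piecewise constant strategies of the net for both players, as a table of switching points and actions; they are $\pi$-optimal for every initial distribution; * the values $p_k(l,0)$ for all $l\in L$ and $\sum_l\nu(l)p_k(l,0)$;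 for every initial distribution $\mu$, the number $\sum_l\mu(l)p_k(l,0)$ differs by at most $\pi$ from the quality of either strategy and from the value of the game. The running time is $$O\Bigl(|L|^2\cdot\max\bigl\{1,\sqrt[3]{T/\pi}\cdot T\bigr\}\cdot|\Sigma|^4\log(|\Sigma|+1)\Bigr)\quad\text{for triple nets }(k=3),$$ $$O\Bigl(|L|^3\cdot\max\bigl\{1,\sqrt[4]{T/\pi}\cdot T\bigr\}\cdot|\Sigma|^6\log(|\Sigma|+1)\Bigr)\quad\text{for quadruple nets }(k=4),$$ with absolute constants. -/

import Mathlib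

noncomputable section

namespace CTMG

/-! ### Continuous-time Markov games -/

/-- A continuous-time Markov game with locations `L` and actions `A`. The set of locations of the
reachability player is `reach`; the other locations belong to the safety player. -/
structure MarkovGame (L A : Type) [Fintype L] where
  reach : Finset L
  rate : L → A → L → ℚ≥0
  prob : L → A → L → ℚ≥0
  init : L → ℝ
  init_nonneg : ∀ l, 0 ≤ init l
  init_sum : ∑ l, init l = 1
  exists_enabled : ∀ l, ∃ a, 0 < ∑ l', rate l a l'
  prob_enabled : ∀ l a, 0 < ∑ l', rate l a l' → ∀ l', prob l a l' = rate l a l' / ∑ k, rate l a k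
  prob_disabled : ∀ l a, ¬ 0 < ∑ l', rate l a l' → ∀ l', prob l a l' = 0

/-- `IsDist μ`: the weights `μ` form a probability distribution on `L`. -/
def IsDist {L : Type} [Fintype L] (μ : L → ℝ) : Prop :=
  (∀ l, 0 ≤ μ l) ∧ ∑ l, μ l = 1

namespace MarkovGame

variable {L A : Type} [Fintype L] [Fintype A]

/-- The total rate of leaving `l` by action `a` (self-loops included). -/
def exitRate (M : MarkovGame L A) (l : L) (a : A) : ℚ≥0 := ∑ l', M.rate l a l'

/-- The finite set of actions enabled in `l`. -/
def enabled (M : MarkovGame L A) (l : L) : Finset A :=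
  Finset.univ.filter (fun a => 0 < M.exitRate l a)

theorem enabled_nonempty (M : MarkovGame L A) (l : L) : (M.enabled l).Nonempty := by
  obtain ⟨a, ha⟩ := M.exists_enabled l
  exact ⟨a, Finset.mem_filter.2 ⟨Finset.mem_univ a, ha⟩⟩

/-- A game is normed if it is uniform with transition rate `1`. -/
def IsNormed (M : MarkovGame L A) : Prop :=
  ∀ l, ∀ a ∈ M.enabled l, M.exitRate l a = 1

variable [DecidableEq L]

/-- The generator matrix. -/
def gen (M : MarkovGame L A) (l : L) (a : A) (l' : L) : ℝ :=
  if l' = l then -∑ k ∈ Finset.univ.erase l, (M.rate l a k : ℝ) else (M.rate l a l' : ℝ)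

/-- The quality `∑_{l'} Q(l,a,l') x(l')` of action `a` in `l` for the vector `x`. -/
def quality (M : MarkovGame L A) (x : L → ℝ) (l : L) (a : A) : ℝ :=
  ∑ l', M.gen l a l' * x l'

/-- The optimal quality over the enabled actions: a maximum in the locations of the reachability
player, a minimum in the locations of the safety player. -/
def optQuality (M : MarkovGame L A) (x : L → ℝ) (l : L) : ℝ :=
  if l ∈ M.reach then (M.enabled l).sup' (M.enabled_nonempty l) (M.quality x l)
  else (M.enabled l).inf' (M.enabled_nonempty l) (M.quality x l)

/-- `a` is an enabled action of `l` that attains the optimal quality. -/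
def IsOptAction (M : MarkovGame L A) (x : L → ℝ) (l : L) (a : A) : Prop :=
  a ∈ M.enabled l ∧ M.quality x l a = M.optQuality x l

/-! ### Memoryless strategies and the value of the game -/

/-- A measurable memoryless (timed positional) strategy, which assigns an enabled action to every
location and point of time. For each player only the values in the own locations matter. -/
structure Strategy (M : MarkovGame L A) where
  act : L → ℝ → A
  measurable : ∀ l a, MeasurableSet {t | act l t = a}
  enabled : ∀ l t, act l t ∈ M.enabled l

/-- The actions that are played when the reachability player uses `σ` and the safety player
uses `τ`. -/
def joint (M : MarkovGame L A) (σ τ : M.Strategy) (l : L) (t : ℝ) : A :=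
  if l ∈ M.reach then σ.act l t else τ.act l t

/-- In a normed game, where transitions (self-loops included) occur with rate `1` in every
location: the probability to have made exactly `n` transitions up to time `t` and to be in
location `l` at time `t`, if the chain starts at time `0` with distribution `μ` and the
actions `s` are played. In the second clause, `u` is the time of the last transition. -/
def jumpProb (M : MarkovGame L A) (s : L → ℝ → A) (μ : L → ℝ) : ℕ → ℝ → L → ℝ
  | 0, t, l => Real.exp (-t) * μ l
  | n + 1, t, l => ∫ u in (0 : ℝ)..t,
      Real.exp (-(t - u)) * ∑ l', M.jumpProb s μ n u l' * (M.rate l' (s l' u) l : ℝ)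

/-- The transient distribution at time `t` of the time-inhomogeneous Markov chain of a normed
game. -/
def transient (M : MarkovGame L A) (s : L → ℝ → A) (μ : L → ℝ) (t : ℝ) (l : L) : ℝ :=
  ∑' n, M.jumpProb s μ n t l

/-- The probability to be in the goal region `G` at time `T`, for initial distribution `μ`. -/
def goalProb (M : MarkovGame L A) (G : Finset L) (T : ℝ) (μ : L → ℝ) (σ τ : M.Strategy) : ℝ :=
  ∑ l ∈ G, M.transient (M.joint σ τ) μ T l

/-- The quality of a strategy of the reachability player: what it yields against an optimal
counter strategy. -/
def reachQuality (M : MarkovGame L A) (G : Finset L) (T : ℝ) (μ : L → ℝ) (σ : M.Strategy) : ℝ :=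
  ⨅ τ : M.Strategy, M.goalProb G T μ σ τ

/-- The quality of a strategy of the safety player: what it yields against an optimal
counter strategy. -/
def safeQuality (M : MarkovGame L A) (G : Finset L) (T : ℝ) (μ : L → ℝ) (τ : M.Strategy) : ℝ :=
  ⨆ σ : M.Strategy, M.goalProb G T μ σ τ

/-- The optimal probability to be in `G` at time `T`, for initial distribution `μ`. -/
def value (M : MarkovGame L A) (G : Finset L) (T : ℝ) (μ : L → ℝ) : ℝ :=
  ⨆ σ : M.Strategy, ⨅ τ : M.Strategy, M.goalProb G T μ σ τ

/-! ### `ε`-nets -/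

/-- The level-`k` approximation `p_k` inside one interval, as a function of the time `s` that is
left until the right end of the interval, where its value is the vector `x`. Level `0` is the
constant `x`; the derivative of level `k + 1` in `s` is the optimal quality for level `k`. -/
def netStep (M : MarkovGame L A) (x : L → ℝ) : ℕ → ℝ → L → ℝ
  | 0, _, l => x l
  | k + 1, s, l => x l + ∫ u in (0 : ℝ)..s, M.optQuality (M.netStep x k u) l

/-- The value `p_k(·, T - i * ε)` of the `ε`-net of level `k` at the `i`-th grid point, counted
backwards from the time bound `T`. -/
def netGrid (M : MarkovGame L A) (G : Finset L) (k : ℕ) (ε : ℝ) : ℕ → L → ℝ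
  | 0, l => if l ∈ G then 1 else 0
  | i + 1, l => M.netStep (M.netGrid G k ε i) k ε l

/-- In each of the `N` intervals of length `T / N`, the strategy `σ` plays in every location an
action that is optimal in the equation that defines the derivative of `p_k`. -/
def FollowsNet (M : MarkovGame L A) (G : Finset L) (T : ℝ) (k N : ℕ) (σ : M.Strategy) : Prop :=
  ∀ i < N, ∀ t ∈ Set.Ioc (T - (i + 1) * (T / N)) (T - i * (T / N)), ∀ l,
    M.IsOptAction (M.netStep (M.netGrid G k (T / N) i) (k - 1) (T - i * (T / N) - t)) l (σ.act l t)

end MarkovGame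

/-! ### Random access machine over the reals

Natural numbers serve for counting and addressing, reals for the data. There are arrays with three
indices of both sorts. There is no conversion between the two sorts and no rounding. Every
arithmetic operation, comparison, memory access and root extraction costs one step. -/

/-- The `i`-th smallest (counted from `0`) of the distinct real roots of the polynomial
`∑ j, c j * X ^ j`; `0` if the polynomial is zero or has at most `i` distinct real roots. -/
def polyRoot (d : ℕ) (c : Fin (d + 1) → ℝ) (i : ℕ) : ℝ :=
  ((∑ j, Polynomial.C (c j) * Polynomial.X ^ (j : ℕ) : Polynomial ℝ).roots.toFinset.sort
    (· ≤ ·)).getD i 0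

/-- The contents of the memory: scalar variables and arrays, all named by natural numbers. -/
structure Store where
  nat : ℕ → ℕ
  real : ℕ → ℝ
  natArr : ℕ → ℕ → ℕ → ℕ → ℕ
  realArr : ℕ → ℕ → ℕ → ℕ → ℝ

/-- Expressions for natural numbers; `sub` is truncated subtraction. -/
inductive NExpr where
  | lit (n : ℕ)
  | var (x : ℕ)
  | get (arr : ℕ) (i j k : NExpr)
  | add (a b : NExpr)
  | sub (a b : NExpr)

/-- Expressions for reals, with the extraction of the roots of polynomials of degree at
most `d`. -/
inductive RExpr (d : ℕ) where
  | lit (q : ℚ)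
  | var (x : ℕ)
  | get (arr : ℕ) (i j k : NExpr)
  | add (a b : RExpr d)
  | sub (a b : RExpr d)
  | mul (a b : RExpr d)
  | div (a b : RExpr d)
  | root (c : Fin (d + 1) → RExpr d) (i : ℕ)

/-- Tests. -/
inductive BExpr (d : ℕ) where
  | natLt (a b : NExpr)
  | realLt (a b : RExpr d)
  | not (a : BExpr d)
  | and (a b : BExpr d)

/-- Programs. -/
inductive Prog (d : ℕ) where
  | nop
  | setNat (x : ℕ) (e : NExpr)
  | setReal (x : ℕ) (e : RExpr d)
  | putNat (arr : ℕ) (i j k : NExpr) (e : NExpr)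
  | putReal (arr : ℕ) (i j k : NExpr) (e : RExpr d)
  | seq (p q : Prog d)
  | branch (b : BExpr d) (p q : Prog d)
  | loop (b : BExpr d) (p : Prog d)

def NExpr.eval (s : Store) : NExpr → ℕ
  | .lit n => n
  | .var x => s.nat x
  | .get arr i j k => s.natArr arr (i.eval s) (j.eval s) (k.eval s)
  | .add a b => a.eval s + b.eval s
  | .sub a b => a.eval s - b.eval s

def NExpr.cost : NExpr → ℕ
  | .lit _ => 1
  | .var _ => 1
  | .get _ i j k => i.cost + j.cost + k.cost + 1
  | .add a b => a.cost + b.cost + 1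
  | .sub a b => a.cost + b.cost + 1

def RExpr.eval {d : ℕ} (s : Store) : RExpr d → ℝ
  | .lit q => (q : ℝ)
  | .var x => s.real x
  | .get arr i j k => s.realArr arr (i.eval s) (j.eval s) (k.eval s)
  | .add a b => a.eval s + b.eval s
  | .sub a b => a.eval s - b.eval s
  | .mul a b => a.eval s * b.eval s
  | .div a b => a.eval s / b.eval s
  | .root c i => polyRoot d (fun j => (c j).eval s) i

def RExpr.cost {d : ℕ} : RExpr d → ℕ
  | .lit _ => 1
  | .var _ => 1
  | .get _ i j k => i.cost + j.cost + k.cost + 1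
  | .add a b => a.cost + b.cost + 1
  | .sub a b => a.cost + b.cost + 1
  | .mul a b => a.cost + b.cost + 1
  | .div a b => a.cost + b.cost + 1
  | .root c _ => (∑ j, (c j).cost) + 1

def BExpr.Holds {d : ℕ} (s : Store) : BExpr d → Prop
  | .natLt a b => a.eval s < b.eval s
  | .realLt a b => a.eval s < b.eval s
  | .not a => ¬ a.Holds s
  | .and a b => a.Holds s ∧ b.Holds s

def BExpr.cost {d : ℕ} : BExpr d → ℕ
  | .natLt a b => a.cost + b.cost + 1
  | .realLt a b => a.cost + b.cost + 1
  | .not a => a.cost + 1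
  | .and a b => a.cost + b.cost + 1

namespace Store

def setNat (s : Store) (x v : ℕ) : Store :=
  { s with nat := Function.update s.nat x v }

def setReal (s : Store) (x : ℕ) (v : ℝ) : Store :=
  { s with real := Function.update s.real x v }

def putNat (s : Store) (arr i j k v : ℕ) : Store :=
  { s with natArr := fun arr' i' j' k' =>
      if arr' = arr ∧ i' = i ∧ j' = j ∧ k' = k then v else s.natArr arr' i' j' k' }

def putReal (s : Store) (arr i j k : ℕ) (v : ℝ) : Store :=
  { s with realArr := fun arr' i' j' k' =>
      if arr' = arr ∧ i' = i ∧ j' = j ∧ k' = k then v else s.realArr arr' i' j' k' }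

end Store

/-- `Exec p s n s'`: started in `s`, the program `p` halts in `s'` after exactly `n` steps. -/
inductive Exec {d : ℕ} : Prog d → Store → ℕ → Store → Prop where
  | nop (s : Store) : Exec .nop s 1 s
  | setNat (x : ℕ) (e : NExpr) (s : Store) :
      Exec (.setNat x e) s (e.cost + 1) (s.setNat x (e.eval s))
  | setReal (x : ℕ) (e : RExpr d) (s : Store) :
      Exec (.setReal x e) s (e.cost + 1) (s.setReal x (e.eval s))
  | putNat (arr : ℕ) (i j k : NExpr) (e : NExpr) (s : Store) :
      Exec (.putNat arr i j k e) s (i.cost + j.cost + k.cost + e.cost + 1)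
        (s.putNat arr (i.eval s) (j.eval s) (k.eval s) (e.eval s))
  | putReal (arr : ℕ) (i j k : NExpr) (e : RExpr d) (s : Store) :
      Exec (.putReal arr i j k e) s (i.cost + j.cost + k.cost + e.cost + 1)
        (s.putReal arr (i.eval s) (j.eval s) (k.eval s) (e.eval s))
  | seq {p q : Prog d} {s s₁ s₂ : Store} {m n : ℕ} :
      Exec p s m s₁ → Exec q s₁ n s₂ → Exec (.seq p q) s (m + n) s₂
  | branch_true {b : BExpr d} {p q : Prog d} {s s₁ : Store} {m : ℕ} :
      b.Holds s → Exec p s m s₁ → Exec (.branch b p q) s (b.cost + m + 1) s₁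
  | branch_false {b : BExpr d} {p q : Prog d} {s s₁ : Store} {m : ℕ} :
      ¬ b.Holds s → Exec q s m s₁ → Exec (.branch b p q) s (b.cost + m + 1) s₁
  | loop_true {b : BExpr d} {p : Prog d} {s s₁ s₂ : Store} {m n : ℕ} :
      b.Holds s → Exec p s m s₁ → Exec (.loop b p) s₁ n s₂ →
        Exec (.loop b p) s (b.cost + m + n + 1) s₂
  | loop_false {b : BExpr d} {p : Prog d} {s : Store} :
      ¬ b.Holds s → Exec (.loop b p) s (b.cost + 1) s

/-! ### Input and output -/

/-- The store that holds the input and zeros elsewhere. Scalars: the numbers of locations and of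
actions, the time bound, the precision. Arrays of naturals: `0` marks the locations of the
reachability player, `1` marks the goal region. Arrays of reals: `0` is the rate matrix, `1` is
the initial distribution. (In a normed game the rates determine the transition matrix.) -/
def inputStore {m n : ℕ} (M : MarkovGame (Fin m) (Fin n)) (G : Finset (Fin m)) (T π : ℝ) :
    Store where
  nat := fun x => if x = 0 then m else if x = 1 then n else 0
  real := fun x => if x = 0 then T else if x = 1 then π else 0
  natArr := fun arr i j k =>
    if h : i < m ∧ j = 0 ∧ k = 0 then
      if arr = 0 then (if (⟨i, h.1⟩ : Fin m) ∈ M.reach then 1 else 0)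
      else if arr = 1 then (if (⟨i, h.1⟩ : Fin m) ∈ G then 1 else 0)
      else 0
    else 0
  realArr := fun arr i j k =>
    if h : arr = 0 ∧ i < m ∧ j < n ∧ k < m then
      (M.rate ⟨i, h.2.1⟩ ⟨j, h.2.2.1⟩ ⟨k, h.2.2.2⟩ : ℝ)
    else if h : arr = 1 ∧ i < m ∧ j = 0 ∧ k = 0 then M.init ⟨i, h.2.1⟩
    else 0

/-- The store `s` holds the strategy `σ` on `(0, T]` as a table of its pieces, listed for every
location `l` backwards in time. Array of naturals `2` holds the number of pieces for `l`, array of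
reals `2` the decreasing list of the times at which the pieces end, and array of naturals `3` the
actions. -/
def HoldsStrategy {m n : ℕ} {M : MarkovGame (Fin m) (Fin n)} (s : Store) (T : ℝ)
    (σ : M.Strategy) : Prop :=
  ∀ l : Fin m,
    s.realArr 2 l 0 0 = T ∧ s.realArr 2 l (s.natArr 2 l 0 0) 0 = 0 ∧
    ∀ j < s.natArr 2 l 0 0, s.realArr 2 l (j + 1) 0 ≤ s.realArr 2 l j 0 ∧
      ∀ t ∈ Set.Ioc (s.realArr 2 l (j + 1) 0) (s.realArr 2 l j 0),
        (σ.act l t : ℕ) = s.natArr 3 l j 0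

/-- The final store `s` holds `π`-optimal memoryless strategies for both players (one table, whose
row for a location is for the player who owns it) that come from an `ε`-net of level `k`, and the
quality of these strategies with precision `π`: array of reals `3` for the possible initial
locations, and real scalar `2` for the initial distribution of the game. -/
def Solves {m n : ℕ} (k : ℕ) (M : MarkovGame (Fin m) (Fin n)) (G : Finset (Fin m)) (T π : ℝ)
    (s : Store) : Prop :=
  ∃ σ : M.Strategy, HoldsStrategy s T σ ∧
    (∃ N : ℕ, 0 < N ∧ M.FollowsNet G T k N σ ∧
      ∀ l : Fin m, s.realArr 3 l 0 0 = M.netGrid G k (T / N) N l) ∧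
    s.real 2 = ∑ l : Fin m, M.init l * s.realArr 3 l 0 0 ∧
    ∀ μ : Fin m → ℝ, IsDist μ →
      M.value G T μ - π ≤ M.reachQuality G T μ σ ∧
      M.safeQuality G T μ σ ≤ M.value G T μ + π ∧
      |∑ l : Fin m, μ l * s.realArr 3 l 0 0 - M.reachQuality G T μ σ| ≤ π ∧
      |∑ l : Fin m, μ l * s.realArr 3 l 0 0 - M.safeQuality G T μ σ| ≤ π ∧
      |∑ l : Fin m, μ l * s.realArr 3 l 0 0 - M.value G T μ| ≤ π

end CTMG

end

noncomputable section

namespace CTMG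

/-! ### Total correctness with step counts -/

/-! Two independent arguments are combined: an error estimate for the net, and a step count for a
program that computes the net exactly. With `d = k - 1`, one program text `netProg d` serves both
cases.

Error. On one interval the functions `p_j` are Picard iterates of the optimality equation. The map
`F` is 2-Lipschitz in the sup norm because rates sum to one, so consecutive iterates differ by at
most `ε^(j+1)` times the range of the start vector (`abs_netStep_sub_le`). Hence `p_k` solves the
optimality equation up to a defect of order `ε^k`. A maximum principle (`le_of_deriv_le`) shows that
the range of the values hardly grows from one interval to the next, so it stays at most 2 over the
whole horizon (`netGrid_mem`). Along the Markov chain of any pair of strategies, the mean of the net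
values then drifts in one direction by at most the defect, provided that one player follows the net:
the own actions are optimal for `p_{k-1}`, and the actions of the opponent are at best optimal
(`net_drift`). Summing over the intervals gives an error of at most `4 T ε^k` between payoff and net
value (`net_error`). Applied once for each player this yields: net value minus error ≤ quality of
the reachability strategy ≤ value ≤ quality of the safety strategy ≤ net value plus error. No
minimax theorem is needed, since the middle inequalities hold for every sup-inf. As strategies are
only measurable, the transient distribution is only absolutely continuous in time; `totalFlow_drift`
therefore integrates by parts for absolutely continuous functions.

Number of intervals. The least `N` with `2^(k+2) T^(k+1) ≤ N^k π` makes the error small enough, and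
`N + 1` is at most `6 max(1, (T/π)^(1/k) T)`.

Steps in one interval. By induction every `p_j(l, ·)` is piecewise polynomial of degree at most `j`.
Call the ends of the pieces of level `j`, over all locations, events. Between two events the quality
of each action is a polynomial up to a summand common to all actions, so the optimal quality is an
upper or lower envelope of at most `n` polynomials, and its breakpoints are roots of pairwise
differences: at most `j n²` of them, and for `j ≤ 1` at most `n` pieces. This gives at most `1`,
`1`, `n`, `3 m n³`, `12 m² n⁵` pieces per location on levels 0 to 4 (`cntBound_succ`). A sweep over
the events (`level_runs`) processes each event in time `O(m n (j n² + 2))`. Here it matters that at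
an event only one location changes its polynomial, so all action polynomials are updated in `O(m n)`
steps rather than recomputed (`advance_runs`). The total per interval is `O(m^d n^(2d))`
(`level_cost`), where the last level needs roots of polynomials of degree `d = k - 1` only, because
of `p_k` just the actions and the end values are kept. The logarithm in the claimed bound is pure
slack.

Programs are verified with a small calculus of total correctness with step bounds: weakest
preconditions for loop-free code, fuel-indexed invariants for loops, and syntactic frame conditions
for everything a program does not write. -/

variable {d : ℕ}

/-- Started in `s`, the program `p` halts within `c` steps in a store with property `Q`. -/
def Runs (p : Prog d) (s : Store) (c : ℕ) (Q : Store → Prop) : Prop :=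
  ∃ t s', Exec p s t s' ∧ t ≤ c ∧ Q s'

theorem Runs.mono {p : Prog d} {s : Store} {c c' : ℕ} {Q Q' : Store → Prop}
    (h : Runs p s c Q) (hc : c ≤ c') (hQ : ∀ s', Q s' → Q' s') : Runs p s c' Q' := by
  obtain ⟨t, s', he, ht, hq⟩ := h
  exact ⟨t, s', he, ht.trans hc, hQ _ hq⟩

theorem Runs.weaken {p : Prog d} {s : Store} {c : ℕ} {Q Q' : Store → Prop}
    (h : Runs p s c Q) (hQ : ∀ s', Q s' → Q' s') : Runs p s c Q' := h.mono le_rfl hQ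

theorem Runs.seq {p q : Prog d} {s : Store} {c c' : ℕ} {Q R : Store → Prop}
    (hp : Runs p s c Q) (hq : ∀ s', Q s' → Runs q s' c' R) : Runs (.seq p q) s (c + c') R := by
  obtain ⟨t, s', he, ht, h⟩ := hp
  obtain ⟨t', s'', he', ht', h'⟩ := hq s' h
  exact ⟨t + t', s'', .seq he he', by omega, h'⟩

theorem Runs.seq_eq {p q : Prog d} {s s₁ : Store} {c c' : ℕ} {R : Store → Prop}
    (hp : Runs p s c (fun s' => s' = s₁)) (hq : Runs q s₁ c' R) : Runs (.seq p q) s (c + c') R :=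
  hp.seq fun _ h => h ▸ hq

/-- The index of the invariant is fuel: every iteration must consume one unit, so the initial index
bounds the number of iterations and gives termination. The extra one in `k + 1` pays for the last,
failing test. -/
theorem Runs.loop {b : BExpr d} {p : Prog d} {c : ℕ} (Inv : ℕ → Store → Prop)
    (hstep : ∀ k s, Inv k s → b.Holds s → ∃ k', k = k' + 1 ∧ Runs p s c (Inv k')) :
    ∀ (k : ℕ) (s : Store), Inv k s →
      Runs (.loop b p) s ((c + b.cost + 1) * (k + 1)) (fun s' => ¬ b.Holds s' ∧ ∃ k', Inv k' s') := by
  intro k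
  induction k with
  | zero =>
    intro s hs
    by_cases hb : b.Holds s
    · obtain ⟨k', hk, -⟩ := hstep 0 s hs hb
      omega
    · exact ⟨_, s, .loop_false hb, by nlinarith, hb, 0, hs⟩
  | succ k ih =>
    intro s hs
    by_cases hb : b.Holds s
    · obtain ⟨k', hk, t, s', he, ht, h⟩ := hstep _ s hs hb
      obtain rfl : k = k' := by omega
      obtain ⟨t', s'', he', ht', h'⟩ := ih s' h
      exact ⟨_, s'', .loop_true hb he he', by nlinarith, h'⟩
    · exact ⟨_, s, .loop_false hb, by nlinarith, hb, _, hs⟩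

/-! ### Straight-line programs -/

/-- Programs without loops. -/
def Prog.Straight : Prog d → Prop
  | .seq p q => p.Straight ∧ q.Straight
  | .branch _ p q => p.Straight ∧ q.Straight
  | .loop _ _ => False
  | _ => True

/-- An upper bound for the number of steps of a program without loops. -/
def Prog.bound : Prog d → ℕ
  | .nop => 1
  | .setNat _ e => e.cost + 1
  | .setReal _ e => e.cost + 1
  | .putNat _ i j k e => i.cost + j.cost + k.cost + e.cost + 1
  | .putReal _ i j k e => i.cost + j.cost + k.cost + e.cost + 1
  | .seq p q => p.bound + q.bound
  | .branch b p q => b.cost + (p.bound + q.bound) + 1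
  | .loop _ _ => 0

/-- The weakest precondition of a program without loops. -/
def Prog.wp : Prog d → (Store → Prop) → Store → Prop
  | .nop, Q, s => Q s
  | .setNat x e, Q, s => Q (s.setNat x (e.eval s))
  | .setReal x e, Q, s => Q (s.setReal x (e.eval s))
  | .putNat arr i j k e, Q, s => Q (s.putNat arr (i.eval s) (j.eval s) (k.eval s) (e.eval s))
  | .putReal arr i j k e, Q, s => Q (s.putReal arr (i.eval s) (j.eval s) (k.eval s) (e.eval s))
  | .seq p q, Q, s => p.wp (q.wp Q) s
  | .branch b p q, Q, s => (b.Holds s → p.wp Q s) ∧ (¬ b.Holds s → q.wp Q s)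
  | .loop _ _, _, _ => False

/-- For loop-free code the number of steps is bounded by the text alone, so correctness reduces to a
weakest precondition that `simp` can unfold. -/
theorem Runs.straight {p : Prog d} (hp : p.Straight) {s : Store} {Q : Store → Prop}
    (h : p.wp Q s) : Runs p s p.bound Q := by
  induction p generalizing s Q with
  | nop => exact ⟨_, _, .nop s, le_rfl, h⟩
  | setNat x e => exact ⟨_, _, .setNat x e s, le_rfl, h⟩
  | setReal x e => exact ⟨_, _, .setReal x e s, le_rfl, h⟩
  | putNat arr i j k e => exact ⟨_, _, .putNat arr i j k e s, le_rfl, h⟩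
  | putReal arr i j k e => exact ⟨_, _, .putReal arr i j k e s, le_rfl, h⟩
  | seq p q ihp ihq => exact (ihp hp.1 h).seq fun s' h' => ihq hp.2 h'
  | branch b p q ihp ihq =>
    by_cases hb : b.Holds s
    · obtain ⟨t, s', he, ht, hq⟩ := ihp hp.1 (h.1 hb)
      exact ⟨_, s', .branch_true hb he, by simp only [Prog.bound]; omega, hq⟩
    · obtain ⟨t, s', he, ht, hq⟩ := ihq hp.2 (h.2 hb)
      exact ⟨_, s', .branch_false hb he, by simp only [Prog.bound]; omega, hq⟩
  | loop b p => exact hp.elim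

theorem Runs.branch {b : BExpr d} {p q : Prog d} {s : Store} {c : ℕ} {Q : Store → Prop}
    (hp : b.Holds s → Runs p s c Q) (hq : ¬ b.Holds s → Runs q s c Q) :
    Runs (.branch b p q) s (c + b.cost + 1) Q := by
  by_cases hb : b.Holds s
  · obtain ⟨t, s', he, ht, h⟩ := hp hb
    exact ⟨_, s', .branch_true hb he, by omega, h⟩
  · obtain ⟨t, s', he, ht, h⟩ := hq hb
    exact ⟨_, s', .branch_false hb he, by omega, h⟩

/-! ### What a program leaves unchanged -/

/-- The four `keep` predicates are syntactic, hence checked by computation. `Exec.frame` shows that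
they are sound, so invariants need to mention only what a program really changes. -/
def Prog.keepN (x : ℕ) : Prog d → Prop
  | .setNat y _ => x ≠ y
  | .seq p q => p.keepN x ∧ q.keepN x
  | .branch _ p q => p.keepN x ∧ q.keepN x
  | .loop _ p => p.keepN x
  | _ => True

def Prog.keepR (x : ℕ) : Prog d → Prop
  | .setReal y _ => x ≠ y
  | .seq p q => p.keepR x ∧ q.keepR x
  | .branch _ p q => p.keepR x ∧ q.keepR x
  | .loop _ p => p.keepR x
  | _ => True

def Prog.keepNA (arr : ℕ) : Prog d → Prop
  | .putNat a _ _ _ _ => arr ≠ a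
  | .seq p q => p.keepNA arr ∧ q.keepNA arr
  | .branch _ p q => p.keepNA arr ∧ q.keepNA arr
  | .loop _ p => p.keepNA arr
  | _ => True

def Prog.keepRA (arr : ℕ) : Prog d → Prop
  | .putReal a _ _ _ _ => arr ≠ a
  | .seq p q => p.keepRA arr ∧ q.keepRA arr
  | .branch _ p q => p.keepRA arr ∧ q.keepRA arr
  | .loop _ p => p.keepRA arr
  | _ => True

/-- All writes have the scalar `x` as their first index. -/
def Prog.onRow (x : ℕ) : Prog d → Prop
  | .setNat y _ => x ≠ y
  | .putNat _ i _ _ _ => i = .var x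
  | .putReal _ i _ _ _ => i = .var x
  | .seq p q => p.onRow x ∧ q.onRow x
  | .branch _ p q => p.onRow x ∧ q.onRow x
  | .loop _ p => p.onRow x
  | _ => True

/-- The stores agree where `p` does not write. -/
structure Frame (p : Prog d) (s s' : Store) : Prop where
  nat : ∀ x, p.keepN x → s'.nat x = s.nat x
  real : ∀ x, p.keepR x → s'.real x = s.real x
  natArr : ∀ arr, p.keepNA arr → s'.natArr arr = s.natArr arr
  realArr : ∀ arr, p.keepRA arr → s'.realArr arr = s.realArr arr

/-- The stores agree on row `i` of all arrays. -/
def SameRow (i : ℕ) (s s' : Store) : Prop :=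
  (∀ arr, s'.natArr arr i = s.natArr arr i) ∧ ∀ arr, s'.realArr arr i = s.realArr arr i

theorem SameRow.refl (i : ℕ) (s : Store) : SameRow i s s := ⟨fun _ => rfl, fun _ => rfl⟩

theorem SameRow.trans {i : ℕ} {s s' s'' : Store} (h : SameRow i s s') (h' : SameRow i s' s'') :
    SameRow i s s'' :=
  ⟨fun a => (h'.1 a).trans (h.1 a), fun a => (h'.2 a).trans (h.2 a)⟩

theorem Frame.refl (p : Prog d) (s : Store) : Frame p s s :=
  ⟨fun _ _ => rfl, fun _ _ => rfl, fun _ _ => rfl, fun _ _ => rfl⟩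

theorem Frame.trans {p : Prog d} {s s' s'' : Store} (h : Frame p s s') (h' : Frame p s' s'') :
    Frame p s s'' :=
  ⟨fun x hx => (h'.nat x hx).trans (h.nat x hx), fun x hx => (h'.real x hx).trans (h.real x hx),
    fun x hx => (h'.natArr x hx).trans (h.natArr x hx),
    fun x hx => (h'.realArr x hx).trans (h.realArr x hx)⟩

theorem Frame.of_imp {p q : Prog d} {s s' : Store} (h : Frame p s s')
    (hn : ∀ x, q.keepN x → p.keepN x) (hr : ∀ x, q.keepR x → p.keepR x)
    (hna : ∀ x, q.keepNA x → p.keepNA x) (hra : ∀ x, q.keepRA x → p.keepRA x) : Frame q s s' :=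
  ⟨fun x hx => h.nat x (hn x hx), fun x hx => h.real x (hr x hx),
    fun x hx => h.natArr x (hna x hx), fun x hx => h.realArr x (hra x hx)⟩

theorem Exec.frame {p : Prog d} {s s' : Store} {t : ℕ} (h : Exec p s t s') : Frame p s s' := by
  induction h with
  | nop s => exact .refl _ _
  | setNat x e s =>
    exact ⟨fun y hy => Function.update_of_ne hy _ _, fun _ _ => rfl, fun _ _ => rfl, fun _ _ => rfl⟩
  | setReal x e s =>
    exact ⟨fun _ _ => rfl, fun y hy => Function.update_of_ne hy _ _, fun _ _ => rfl, fun _ _ => rfl⟩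
  | putNat a i j k e s =>
    refine ⟨fun _ _ => rfl, fun _ _ => rfl, fun y hy => ?_, fun _ _ => rfl⟩
    funext i' j' k'
    exact if_neg fun h => hy h.1
  | putReal a i j k e s =>
    refine ⟨fun _ _ => rfl, fun _ _ => rfl, fun _ _ => rfl, fun y hy => ?_⟩
    funext i' j' k'
    exact if_neg fun h => hy h.1
  | seq h1 h2 ih1 ih2 =>
    refine Frame.trans (Frame.of_imp ih1 ?_ ?_ ?_ ?_) (Frame.of_imp ih2 ?_ ?_ ?_ ?_)
    · exact fun _ h => h.1
    · exact fun _ h => h.1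
    · exact fun _ h => h.1
    · exact fun _ h => h.1
    · exact fun _ h => h.2
    · exact fun _ h => h.2
    · exact fun _ h => h.2
    · exact fun _ h => h.2
  | branch_true hb h1 ih1 =>
    exact ih1.of_imp (fun _ h => h.1) (fun _ h => h.1) (fun _ h => h.1) (fun _ h => h.1)
  | branch_false hb h1 ih1 =>
    exact ih1.of_imp (fun _ h => h.2) (fun _ h => h.2) (fun _ h => h.2) (fun _ h => h.2)
  | loop_true hb h1 h2 ih1 ih2 =>
    refine Frame.trans (Frame.of_imp ih1 ?_ ?_ ?_ ?_) ih2
    all_goals exact fun _ h => h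
  | loop_false hb => exact .refl _ _

/-- This is what makes the locations independent of each other: if each write addresses the row held
in the fixed scalar `x`, then a loop over `x` treats the rows one by one without interference
(`Runs.forRows`). -/
theorem Exec.onRow {p : Prog d} {s s' : Store} {t x : ℕ} (h : Exec p s t s') (hx : p.onRow x) :
    s'.nat x = s.nat x ∧ ∀ i ≠ s.nat x, SameRow i s s' := by
  induction h with
  | nop s => exact ⟨rfl, fun i _ => .refl _ _⟩
  | setNat y e s => exact ⟨Function.update_of_ne hx _ _, fun i _ => .refl _ _⟩
  | setReal y e s => exact ⟨rfl, fun i _ => .refl _ _⟩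
  | putNat a i j k e s =>
    refine ⟨rfl, fun i' hi => ⟨fun arr => ?_, fun _ => rfl⟩⟩
    funext j' k'
    refine if_neg fun h => hi ?_
    rw [h.2.1, show i = .var x from hx]
    rfl
  | putReal a i j k e s =>
    refine ⟨rfl, fun i' hi => ⟨fun _ => rfl, fun arr => ?_⟩⟩
    funext j' k'
    refine if_neg fun h => hi ?_
    rw [h.2.1, show i = .var x from hx]
    rfl
  | seq h1 h2 ih1 ih2 =>
    obtain ⟨a, b⟩ := ih1 hx.1
    obtain ⟨a', b'⟩ := ih2 hx.2
    exact ⟨a'.trans a, fun i hi => (b i hi).trans (b' i (by rwa [a]))⟩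
  | branch_true hb h1 ih1 => exact ih1 hx.1
  | branch_false hb h1 ih1 => exact ih1 hx.2
  | loop_true hb h1 h2 ih1 ih2 =>
    obtain ⟨a, b⟩ := ih1 hx
    obtain ⟨a', b'⟩ := ih2 hx
    exact ⟨a'.trans a, fun i hi => (b i hi).trans (b' i (by rwa [a]))⟩
  | loop_false hb => exact ⟨rfl, fun i _ => .refl _ _⟩

theorem Runs.frame {p : Prog d} {s : Store} {c : ℕ} {Q : Store → Prop} (h : Runs p s c Q) :
    Runs p s c (fun s' => Q s' ∧ Frame p s s') := by
  obtain ⟨t, s', he, ht, hq⟩ := h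
  exact ⟨t, s', he, ht, hq, he.frame⟩

theorem Runs.frameRow {p : Prog d} {s : Store} {c x : ℕ} {Q : Store → Prop} (h : Runs p s c Q)
    (hx : p.onRow x) :
    Runs p s c (fun s' => Q s' ∧ Frame p s s' ∧ ∀ i ≠ s.nat x, SameRow i s s') := by
  obtain ⟨t, s', he, ht, hq⟩ := h
  exact ⟨t, s', he, ht, hq, he.frame, (he.onRow hx).2⟩

/-! ### Counting loops -/

/-- `for x = 0, …, e - 1 do p`. -/
def Prog.forN (x : ℕ) (e : NExpr) (p : Prog d) : Prog d :=
  .seq (.setNat x (.lit 0))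
    (.loop (.natLt (.var x) e) (.seq p (.setNat x (.add (.var x) (.lit 1)))))

/-- The sequence of the programs `f 0, …, f (n - 1)`. -/
def Prog.unroll (f : ℕ → Prog d) : ℕ → Prog d
  | 0 => .nop
  | n + 1 => .seq (unroll f n) (f n)

@[simp] theorem Prog.keepN_forN {x y : ℕ} {e : NExpr} {p : Prog d} :
    (Prog.forN x e p).keepN y ↔ y ≠ x ∧ p.keepN y := by
  simp [Prog.forN, Prog.keepN]; tauto

@[simp] theorem Prog.keepR_forN {x y : ℕ} {e : NExpr} {p : Prog d} :
    (Prog.forN x e p).keepR y ↔ p.keepR y := by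
  simp [Prog.forN, Prog.keepR]

@[simp] theorem Prog.keepNA_forN {x y : ℕ} {e : NExpr} {p : Prog d} :
    (Prog.forN x e p).keepNA y ↔ p.keepNA y := by
  simp [Prog.forN, Prog.keepNA]

@[simp] theorem Prog.keepRA_forN {x y : ℕ} {e : NExpr} {p : Prog d} :
    (Prog.forN x e p).keepRA y ↔ p.keepRA y := by
  simp [Prog.forN, Prog.keepRA]

@[simp] theorem Prog.onRow_forN {x y : ℕ} {e : NExpr} {p : Prog d} :
    (Prog.forN x e p).onRow y ↔ y ≠ x ∧ p.onRow y := by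
  simp [Prog.forN, Prog.onRow]; tauto

theorem Prog.unroll_all (P : Prog d → Prop) (h0 : P .nop) (hs : ∀ p q, P p → P q → P (.seq p q))
    {f : ℕ → Prog d} {n : ℕ} (h : ∀ i < n, P (f i)) : P (Prog.unroll f n) := by
  induction n with
  | zero => exact h0
  | succ n ih => exact hs _ _ (ih fun i hi => h i (by omega)) (h n (by omega))

theorem Runs.unroll {f : ℕ → Prog d} {n c : ℕ} (Inv : ℕ → Store → Prop) {s : Store}
    (h0 : Inv 0 s) (hstep : ∀ i < n, ∀ s', Inv i s' → Runs (f i) s' c (Inv (i + 1))) :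
    Runs (Prog.unroll f n) s (c * n + 1) (Inv n) := by
  induction n with
  | zero => exact ⟨_, s, .nop s, by omega, h0⟩
  | succ n ih =>
    exact ((ih fun i hi => hstep i (by omega)).seq (hstep n (by omega))).mono (by nlinarith)
      fun _ h => h

theorem Prog.wp_mono {p : Prog d} {Q Q' : Store → Prop} {s : Store} (h : p.wp Q s)
    (hQ : ∀ s', Q s' → Q' s') : p.wp Q' s := by
  induction p generalizing s Q Q' with
  | seq p q ihp ihq => exact ihp h fun s' h' => ihq h' hQ
  | branch b p q ihp ihq => exact ⟨fun hb => ihp (h.1 hb) hQ, fun hb => ihq (h.2 hb) hQ⟩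
  | loop b p => exact h.elim
  | _ => exact hQ _ h

theorem Prog.wp_unroll {f : ℕ → Prog d} {n : ℕ} (Inv : ℕ → Store → Prop) {s : Store}
    (h0 : Inv 0 s) (hstep : ∀ i < n, ∀ s', Inv i s' → (f i).wp (Inv (i + 1)) s') :
    (Prog.unroll f n).wp (Inv n) s := by
  induction n with
  | zero => exact h0
  | succ n ih =>
    have h := ih fun i hi => hstep i (by omega)
    show (Prog.unroll f n).wp ((f n).wp (Inv (n + 1))) s
    exact Prog.wp_mono (Q := Inv n) h fun s' h => hstep n (by omega) s' h

/-- The bound `e` is evaluated anew at every test, so it must be constant on all stores reachable by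
the loop; the frame condition expresses this. Since the counter itself is written between
iterations, the invariant has to be insensitive to it. -/
theorem Runs.forN {x : ℕ} {e : NExpr} {p : Prog d} {c N : ℕ} {s : Store} (hx : p.keepN x)
    (he : ∀ s', Frame (Prog.forN x e p) s s' → e.eval s' = N)
    (Inv : ℕ → Store → Prop) (hInv : ∀ i s v, Inv i s → Inv i (s.setNat x v)) (h0 : Inv 0 s)
    (hstep : ∀ i < N, ∀ s', Frame (Prog.forN x e p) s s' → s'.nat x = i → Inv i s' →
      Runs p s' c (Inv (i + 1))) :
    Runs (Prog.forN x e p) s ((c + e.cost + 10) * (N + 1))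
      (fun s' => Inv N s' ∧ Frame (Prog.forN x e p) s s') := by
  have hset : ∀ (s' : Store) v, Frame (Prog.forN x e p) s s' →
      Frame (Prog.forN x e p) s (s'.setNat x v) := by
    intro s' v h
    refine h.trans ⟨fun y hy => ?_, fun _ _ => rfl, fun _ _ => rfl, fun _ _ => rfl⟩
    exact Function.update_of_ne (Prog.keepN_forN.1 hy).1 _ _
  have key := Runs.loop (b := .natLt (.var x) e)
    (p := .seq p (.setNat x (.add (.var x) (.lit 1)))) (c := c + 4)
    -- The fuel is the number of iterations still to come, `N` minus the counter.
    (fun k s' => Frame (Prog.forN x e p) s s' ∧ s'.nat x + k = N ∧ Inv (s'.nat x) s')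
    (by
      rintro k s' ⟨hF, hk, hI⟩ hb
      have hlt : s'.nat x < N := by
        have := hb
        simp only [BExpr.Holds, NExpr.eval, he s' hF] at this
        exact this
      refine ⟨k - 1, by omega, ((hstep _ hlt s' hF rfl hI).frame.seq (c' := 4) ?_)⟩
      rintro s'' ⟨hI', hF'⟩
      refine ⟨_, _, .setNat _ _ _, by simp [NExpr.cost], ?_⟩
      have hx' : s''.nat x = s'.nat x := hF'.nat x hx
      refine ⟨hset _ _ (hF.trans (hF'.of_imp ?_ ?_ ?_ ?_)), ?_, ?_⟩
      · exact fun y hy => (Prog.keepN_forN.1 hy).2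
      · exact fun y hy => Prog.keepR_forN.1 hy
      · exact fun y hy => Prog.keepNA_forN.1 hy
      · exact fun y hy => Prog.keepRA_forN.1 hy
      · simp [Store.setNat, NExpr.eval, hx']; omega
      · have : (s''.setNat x ((NExpr.var x).add (.lit 1) |>.eval s'')).nat x = s'.nat x + 1 := by
          simp [Store.setNat, NExpr.eval, hx']
        rw [this]
        exact hInv _ _ _ hI')
  have hs0 : Runs (d := d) (.setNat x (.lit 0)) s 2 (fun s' => s' = s.setNat x 0) :=
    ⟨_, _, .setNat _ _ _, by simp [NExpr.cost], rfl⟩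
  refine (hs0.seq (c' := (c + e.cost + 8) * (N + 1)) ?_).mono (by nlinarith) fun _ h => h
  rintro _ rfl
  refine (key N _ ⟨hset _ _ (.refl _ _), by simp [Store.setNat], ?_⟩).mono ?_ ?_
  · simpa [Store.setNat] using hInv 0 s 0 h0
  · simp only [BExpr.cost, NExpr.cost]
    exact Nat.mul_le_mul_right _ (by omega)
  · rintro s' ⟨hb, k, hF, hk, hI⟩
    simp only [BExpr.Holds, NExpr.eval, he s' hF] at hb
    have : s'.nat x = N := by omega
    exact ⟨this ▸ hI, hF⟩

/-- A loop over the rows of the arrays, where the body writes only the current row. -/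
theorem Runs.forRows {x : ℕ} {e : NExpr} {p : Prog d} {c N : ℕ} {s : Store} (hx : p.onRow x)
    (hx' : p.keepN x)
    (he : ∀ s', Frame (Prog.forN x e p) s s' → e.eval s' = N)
    (Post : ℕ → Store → Prop)
    (hPost : ∀ i s s', SameRow i s s' → Post i s → Post i s')
    (hstep : ∀ i < N, ∀ s', Frame (Prog.forN x e p) s s' → s'.nat x = i → SameRow i s s' →
      Runs p s' c (Post i)) :
    Runs (Prog.forN x e p) s ((c + e.cost + 10) * (N + 1))
      (fun s' => (∀ i < N, Post i s') ∧ Frame (Prog.forN x e p) s s') := by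
  refine (Runs.forN (c := c) hx' he (fun i s' => (∀ i' < i, Post i' s') ∧ ∀ i' ≥ i, SameRow i' s s')
    (fun i s₁ v h => ?_) ⟨by simp, fun i _ => .refl _ _⟩ ?_).weaken ?_
  · exact ⟨fun i' hi => hPost _ s₁ _ ⟨fun _ => rfl, fun _ => rfl⟩ (h.1 i' hi), h.2⟩
  · rintro i hi s' hF hxi ⟨h1, h2⟩
    refine ((hstep i hi s' hF hxi (h2 i le_rfl)).frameRow hx).weaken ?_
    rintro s'' ⟨hp, -, hrow⟩
    rw [hxi] at hrow
    refine ⟨fun i' hi' => ?_, fun i' hi' => ?_⟩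
    · rcases Nat.lt_succ_iff_lt_or_eq.1 hi' with h | rfl
      · exact hPost _ _ _ (hrow i' (by omega)) (h1 i' h)
      · exact hp
    · exact (h2 i' (by omega)).trans (hrow i' (by omega))
  · rintro s' ⟨⟨h1, -⟩, h2⟩
    exact ⟨h1, h2⟩

/-! ### Expressions -/

def RExpr.sumTo (f : ℕ → RExpr d) : ℕ → RExpr d
  | 0 => .lit 0
  | k + 1 => .add (sumTo f k) (f k)

def RExpr.npow (e : RExpr d) : ℕ → RExpr d
  | 0 => .lit 1
  | k + 1 => .mul (npow e k) e

@[simp] theorem RExpr.eval_sumTo (f : ℕ → RExpr d) (s : Store) (k : ℕ) :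
    (RExpr.sumTo f k).eval s = ∑ i ∈ Finset.range k, (f i).eval s := by
  induction k with
  | zero => simp [RExpr.sumTo, RExpr.eval]
  | succ k ih => rw [Finset.sum_range_succ, ← ih]; rfl

@[simp] theorem RExpr.eval_npow (e : RExpr d) (s : Store) (k : ℕ) :
    (RExpr.npow e k).eval s = e.eval s ^ k := by
  induction k with
  | zero => simp [RExpr.npow, RExpr.eval]
  | succ k ih => rw [pow_succ, ← ih]; rfl

end CTMG
end

noncomputable section

namespace CTMG

/-! ### Polynomials given by coefficients -/

/-- The value of the polynomial of degree at most `d` with coefficients `c` at `u`. -/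
def pv (d : ℕ) (c : ℕ → ℝ) (u : ℝ) : ℝ := ∑ i ∈ Finset.range (d + 1), c i * u ^ i

/-- The polynomial of degree at most `d` with coefficients `c`. -/
def toPoly (d : ℕ) (c : ℕ → ℝ) : Polynomial ℝ :=
  ∑ j : Fin (d + 1), Polynomial.C (c j) * Polynomial.X ^ (j : ℕ)

/-- The increment from `a` to `u` of a primitive of the polynomial with coefficients `c`. -/
def prim (d : ℕ) (c : ℕ → ℝ) (a u : ℝ) : ℝ :=
  ∑ i ∈ Finset.range (d + 1), c i * (u ^ (i + 1) - a ^ (i + 1)) * (1 / ((i : ℝ) + 1))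

theorem toPoly_eval (d : ℕ) (c : ℕ → ℝ) (u : ℝ) : (toPoly d c).eval u = pv d c u := by
  simp only [toPoly, pv, Polynomial.eval_finsetSum, Polynomial.eval_mul, Polynomial.eval_C,
    Polynomial.eval_pow, Polynomial.eval_X]
  exact Fin.sum_univ_eq_sum_range (fun i => c i * u ^ i) (d + 1)

theorem toPoly_natDegree_le {d r : ℕ} {c : ℕ → ℝ} (h : ∀ i, r < i → i ≤ d → c i = 0) :
    (toPoly d c).natDegree ≤ r := by
  refine Polynomial.natDegree_sum_le_of_forall_le _ _ fun j _ => ?_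
  by_cases hj : (j : ℕ) ≤ r
  · exact (Polynomial.natDegree_C_mul_X_pow_le _ _).trans hj
  · rw [h j (by omega) (by omega)]
    simp

theorem pv_sub (d : ℕ) (c c' : ℕ → ℝ) (u : ℝ) :
    pv d (fun i => c i - c' i) u = pv d c u - pv d c' u := by
  simp [pv, sub_mul, Finset.sum_sub_distrib]

theorem pv_continuous (d : ℕ) (c : ℕ → ℝ) : Continuous (pv d c) := by
  unfold pv
  fun_prop

theorem pv_congr {d : ℕ} {c c' : ℕ → ℝ} (h : ∀ i ≤ d, c i = c' i) (u : ℝ) :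
    pv d c u = pv d c' u :=
  Finset.sum_congr rfl fun i hi => by rw [h i (by simpa [Nat.lt_succ_iff] using hi)]

theorem prim_congr {d : ℕ} {c c' : ℕ → ℝ} (h : ∀ i ≤ d, c i = c' i) (a u : ℝ) :
    prim d c a u = prim d c' a u :=
  Finset.sum_congr rfl fun i hi => by rw [h i (by simpa [Nat.lt_succ_iff] using hi)]

theorem prim_add (d : ℕ) (c : ℕ → ℝ) (a b u : ℝ) :
    prim d c a b + prim d c b u = prim d c a u := by
  simp only [prim, ← Finset.sum_add_distrib]
  exact Finset.sum_congr rfl fun i _ => by ring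

theorem prim_hasDerivAt (d : ℕ) (c : ℕ → ℝ) (a u : ℝ) :
    HasDerivAt (prim d c a) (pv d c u) u := by
  unfold prim pv
  have : ∀ i ∈ Finset.range (d + 1), HasDerivAt
      (fun u : ℝ => c i * (u ^ (i + 1) - a ^ (i + 1)) * (1 / ((i : ℝ) + 1))) (c i * u ^ i) u := by
    intro i _
    have h := (((hasDerivAt_pow (i + 1) u).sub_const (a ^ (i + 1))).const_mul (c i)).mul_const
      (1 / ((i : ℝ) + 1))
    refine h.congr_deriv ?_
    have : (i : ℝ) + 1 ≠ 0 := by positivity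
    push_cast
    field_simp
  exact HasDerivAt.fun_sum this

/-- The coefficients of the polynomial with value `V` at `a` and derivative `c`. -/
def primCoef (d : ℕ) (V : ℝ) (c : ℕ → ℝ) (a : ℝ) : ℕ → ℝ
  | 0 => V - ∑ i ∈ Finset.range (d + 1), c i * a ^ (i + 1) * (1 / ((i : ℝ) + 1))
  | i + 1 => c i * (1 / ((i : ℝ) + 1))

/-- Only coefficients up to `d` are kept, so the primitive fits into the same format exactly when
the top coefficient of the derivative vanishes. -/
theorem pv_primCoef {d : ℕ} {V : ℝ} {c : ℕ → ℝ} {a : ℝ} (hc : c d = 0) (u : ℝ) :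
    pv d (primCoef d V c a) u = V + prim d c a u := by
  rw [pv, Finset.sum_range_succ', prim]
  simp only [primCoef, mul_sub, sub_mul, Finset.sum_sub_distrib]
  rw [Finset.sum_range_succ (fun i => c i * u ^ (i + 1) * (1 / ((i : ℝ) + 1)))]
  simp only [hc, zero_mul, add_zero, pow_zero, mul_one]
  have : ∑ i ∈ Finset.range d, c i * (1 / ((i : ℝ) + 1)) * u ^ (i + 1)
      = ∑ i ∈ Finset.range d, c i * u ^ (i + 1) * (1 / ((i : ℝ) + 1)) :=
    Finset.sum_congr rfl fun i _ => by ring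
  rw [this]
  ring

/-- The difference of both sides has derivative zero on the interval and vanishes at its left end.
-/
theorem eq_add_prim {d : ℕ} {g h : ℝ → ℝ} {c : ℕ → ℝ} {a b : ℝ}
    (hg : ∀ u, HasDerivAt g (h u) u) (hh : ∀ u ∈ Set.Icc a b, h u = pv d c u)
    {u : ℝ} (hu : u ∈ Set.Icc a b) : g u = g a + prim d c a u := by
  have key : ∀ x ∈ Set.Icc a b, (fun x => g x - prim d c a x) x = g a - prim d c a a := by
    refine constant_of_has_deriv_right_zero ?_ ?_
    · exact fun x _ => ((hg x).sub (prim_hasDerivAt d c a x)).continuousAt.continuousWithinAt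
    · intro x hx
      have := ((hg x).sub (prim_hasDerivAt d c a x)).hasDerivWithinAt (s := Set.Ici x)
      rwa [hh x ⟨hx.1, hx.2.le⟩, sub_self] at this
  have h1 := key u hu
  have h2 : prim d c a a = 0 := by simp [prim]
  simp only [h2] at h1
  linarith

theorem polyRoot_eq_zero_or_isRoot (d : ℕ) (c : ℕ → ℝ) (i : ℕ) :
    polyRoot d (fun j => c j) i = 0 ∨ polyRoot d (fun j => c j) i ∈ (toPoly d c).roots := by
  unfold polyRoot
  rw [List.getD_eq_getElem?_getD]
  by_cases h : i < ((toPoly d c).roots.toFinset.sort (· ≤ ·)).length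
  · right
    rw [show (∑ j : Fin (d + 1), Polynomial.C (c j) * Polynomial.X ^ (j : ℕ) : Polynomial ℝ)
      = toPoly d c from rfl, List.getElem?_eq_getElem h, Option.getD_some]
    have := List.getElem_mem h
    rwa [Finset.mem_sort, Multiset.mem_toFinset] at this
  · left
    rw [show (∑ j : Fin (d + 1), Polynomial.C (c j) * Polynomial.X ^ (j : ℕ) : Polynomial ℝ)
      = toPoly d c from rfl, List.getElem?_eq_none (by omega), Option.getD_none]

/-- A nonzero polynomial of degree at most `d` has at most `d` distinct roots, so calls with the
indices below `d` find all of them. For the zero polynomial the root multiset is empty. -/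
theorem exists_polyRoot_eq {d : ℕ} {c : ℕ → ℝ} {u : ℝ} (h : u ∈ (toPoly d c).roots) :
    ∃ i < d, polyRoot d (fun j => c j) i = u := by
  have hm : u ∈ (toPoly d c).roots.toFinset.sort (· ≤ ·) := by
    rwa [Finset.mem_sort, Multiset.mem_toFinset]
  obtain ⟨i, hi, rfl⟩ := List.getElem_of_mem hm
  refine ⟨i, ?_, ?_⟩
  · refine hi.trans_le ?_
    rw [Finset.length_sort]
    exact (Multiset.toFinset_card_le _).trans ((Polynomial.card_roots' _).trans
      (toPoly_natDegree_le fun i h1 h2 => by omega))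
  · unfold polyRoot
    rw [List.getD_eq_getElem?_getD,
      show (∑ j : Fin (d + 1), Polynomial.C (c j) * Polynomial.X ^ (j : ℕ) : Polynomial ℝ)
      = toPoly d c from rfl, List.getElem?_eq_getElem hi, Option.getD_some]

theorem pv_eq_zero_of_toPoly_eq_zero {d : ℕ} {c : ℕ → ℝ} (h : toPoly d c = 0) (u : ℝ) :
    pv d c u = 0 := by
  rw [← toPoly_eval, h, Polynomial.eval_zero]

/-- By the intermediate value theorem one sample point decides the sign on the whole interval. The
second alternative is needed for actions with the same polynomial, whose difference has roots
everywhere but none in the root multiset. -/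
theorem sign_of_no_zero {D : ℝ → ℝ} (hD : Continuous D) {a b z : ℝ} (hz : z ∈ Set.Ioo a b)
    (h : (∀ u ∈ Set.Ioo a b, D u ≠ 0) ∨ ∀ u, D u = 0) :
    (D z < 0 → ∀ u ∈ Set.Ioo a b, D u ≤ 0) ∧ (¬ D z < 0 → ∀ u ∈ Set.Ioo a b, 0 ≤ D u) := by
  rcases h with h | h
  · refine ⟨fun h0 u hu => ?_, fun h0 u hu => ?_⟩ <;> by_contra! hc
    · obtain ⟨x, hx, hx0⟩ := isPreconnected_Ioo.intermediate_value hz hu hD.continuousOn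
        (show (0 : ℝ) ∈ Set.Icc (D z) (D u) from ⟨h0.le, hc.le⟩)
      exact h x hx hx0
    · obtain ⟨x, hx, hx0⟩ := isPreconnected_Ioo.intermediate_value hu hz hD.continuousOn
        (show (0 : ℝ) ∈ Set.Icc (D u) (D z) from ⟨hc.le, not_lt.1 h0⟩)
      exact h x hx hx0
  · simp [h]

theorem le_on_Icc_of_Ioo {F G : ℝ → ℝ} (hF : Continuous F) (hG : Continuous G) {a b : ℝ}
    (hab : a < b) (h : ∀ u ∈ Set.Ioo a b, F u ≤ G u) : ∀ u ∈ Set.Icc a b, F u ≤ G u := by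
  intro u hu
  rw [← closure_Ioo hab.ne] at hu
  exact closure_minimal h (isClosed_le hF hG) hu

/-! ### Choosing an action -/

/-- Coefficient `i` of the polynomial of action `a` in the current location. -/
def wE (d : ℕ) (a : NExpr) (i : ℕ) : RExpr d := .get 5 (.var 2) a (.lit i)

def polyE {d : ℕ} (c : ℕ → RExpr d) (u : RExpr d) : RExpr d :=
  .sumTo (fun i => .mul (c i) (.npow u i)) (d + 1)

def midE (d : ℕ) : RExpr d := .mul (.lit (1 / 2)) (.add (.var 7) (.var 8))

/-- Shortens the current interval, from scalar `7` to scalar `8`, to the given root if this root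
lies strictly inside. -/
def tryRoot (d i : ℕ) : Prog d :=
  .seq (.setReal 11 (.root (fun k => .sub (wE d (.var 6) k) (wE d (.var 5) k)) i))
    (.branch (.and (.realLt (.var 7) (.var 11)) (.realLt (.var 11) (.var 8)))
      (.setReal 8 (.var 11)) .nop)

def compareMid (d : ℕ) : Prog d :=
  .branch (.realLt (.mul (.var 9) (.sub (polyE (wE d (.var 5)) (midE d))
    (polyE (wE d (.var 6)) (midE d)))) (.lit 0)) (.setNat 5 (.var 6)) .nop

def compareStep (d : ℕ) : Prog d :=
  .seq (.setNat 6 (.get 4 (.var 2) (.var 3) (.lit 0)))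
    (.seq (.unroll (tryRoot d) d) (compareMid d))

/-- Chooses the best action `5` and the end `8` of the interval on which it is used, which starts
at `7` and is contained in the interval that ends at `6`. -/
def choose (d : ℕ) : Prog d :=
  .seq (.setReal 8 (.var 6)) (.seq (.setNat 5 (.get 4 (.var 2) (.lit 0) (.lit 0)))
    (.forN 3 (.var 1) (compareStep d)))

/-- The roots of the differences of the polynomials of two actions. -/
def crossings (d n : ℕ) (W : ℕ → ℕ → ℝ) : Finset ℝ :=
  (Finset.range n ×ˢ Finset.range n).biUnion
    fun b => (toPoly d fun i => W b.1 i - W b.2 i).roots.toFinset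

theorem card_crossings_le {d n r : ℕ} {W : ℕ → ℕ → ℝ}
    (hW : ∀ b < n, ∀ i, r < i → i ≤ d → W b i = 0) : (crossings d n W).card ≤ r * n ^ 2 := by
  refine (Finset.card_biUnion_le_card_mul _ _ r fun b hb => ?_).trans ?_
  · refine (Multiset.toFinset_card_le _).trans ((Polynomial.card_roots' _).trans
      (toPoly_natDegree_le fun i h1 h2 => ?_))
    simp only [Finset.mem_product, Finset.mem_range] at hb
    rw [hW _ hb.1 i h1 h2, hW _ hb.2 i h1 h2, sub_zero]
  · rw [Finset.card_product, Finset.card_range]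
    exact le_of_eq (by ring)

theorem Prog.Straight_unroll {d n : ℕ} {f : ℕ → Prog d} (h : ∀ i < n, (f i).Straight) :
    (Prog.unroll f n).Straight :=
  Prog.unroll_all _ trivial (fun _ _ a b => ⟨a, b⟩) h

theorem keepN_unroll {d n x : ℕ} {f : ℕ → Prog d} (h : ∀ i, (f i).keepN x) :
    (Prog.unroll f n).keepN x :=
  Prog.unroll_all _ trivial (fun _ _ a b => ⟨a, b⟩) fun i _ => h i

theorem keepR_unroll {d n x : ℕ} {f : ℕ → Prog d} (h : ∀ i, (f i).keepR x) :
    (Prog.unroll f n).keepR x :=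
  Prog.unroll_all _ trivial (fun _ _ a b => ⟨a, b⟩) fun i _ => h i

theorem keepNA_unroll {d n x : ℕ} {f : ℕ → Prog d} (h : ∀ i, (f i).keepNA x) :
    (Prog.unroll f n).keepNA x :=
  Prog.unroll_all _ trivial (fun _ _ a b => ⟨a, b⟩) fun i _ => h i

theorem keepRA_unroll {d n x : ℕ} {f : ℕ → Prog d} (h : ∀ i, (f i).keepRA x) :
    (Prog.unroll f n).keepRA x :=
  Prog.unroll_all _ trivial (fun _ _ a b => ⟨a, b⟩) fun i _ => h i

theorem onRow_unroll {d n x : ℕ} {f : ℕ → Prog d} (h : ∀ i, (f i).onRow x) :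
    (Prog.unroll f n).onRow x :=
  Prog.unroll_all _ trivial (fun _ _ a b => ⟨a, b⟩) fun i _ => h i

/-- Trying all roots in turn leaves the smallest root to the right of the start as the new end, so
the difference of the two polynomials has no root in the remaining open interval. -/
theorem tryRoots_wp {d : ℕ} {s : Store} (h0 : 0 ≤ s.real 7) (h : s.real 7 < s.real 8) :
    (Prog.unroll (tryRoot d) d).wp (fun s' =>
      s'.nat = s.nat ∧ s'.natArr = s.natArr ∧ s'.realArr = s.realArr ∧ s'.real 7 = s.real 7 ∧
      s'.real 9 = s.real 9 ∧
      s.real 7 < s'.real 8 ∧ s'.real 8 ≤ s.real 8 ∧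
      (s'.real 8 = s.real 8 ∨ s'.real 8 ∈ (toPoly d fun i =>
        s.realArr 5 (s.nat 2) (s.nat 6) i - s.realArr 5 (s.nat 2) (s.nat 5) i).roots) ∧
      ∀ u ∈ Set.Ioo (s.real 7) (s'.real 8), u ∉ (toPoly d fun i =>
        s.realArr 5 (s.nat 2) (s.nat 6) i - s.realArr 5 (s.nat 2) (s.nat 5) i).roots) s := by
  set c : ℕ → ℝ := fun i =>
    s.realArr 5 (s.nat 2) (s.nat 6) i - s.realArr 5 (s.nat 2) (s.nat 5) i with hc
  refine Prog.wp_mono (Prog.wp_unroll (fun k s' =>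
      s'.nat = s.nat ∧ s'.natArr = s.natArr ∧ s'.realArr = s.realArr ∧ s'.real 7 = s.real 7 ∧
      s'.real 9 = s.real 9 ∧
      s.real 7 < s'.real 8 ∧ s'.real 8 ≤ s.real 8 ∧
      (s'.real 8 = s.real 8 ∨ s'.real 8 ∈ (toPoly d c).roots) ∧
      ∀ i < k, ¬ (s.real 7 < polyRoot d (fun j => c j) i ∧ polyRoot d (fun j => c j) i < s'.real 8))
    ?_ ?_) ?_
  · simpa using h
  · rintro i hi s' ⟨a1, a2, a3, a4, a5, a6, a7, a8, a9⟩
    have hev : (RExpr.root (fun k : Fin (d + 1) =>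
        .sub (wE d (.var 6) k) (wE d (.var 5) k)) i).eval s' = polyRoot d (fun j => c j) i := by
      simp only [RExpr.eval, wE, NExpr.eval, a1, a3, hc]
    simp only [tryRoot, Prog.wp, BExpr.Holds]
    rw [hev]
    simp only [Store.setReal, RExpr.eval]
    simp only [ne_eq, Nat.reduceEqDiff, not_false_eq_true, Function.update_of_ne,
      Function.update_self, a4, true_and]
    refine ⟨fun ⟨b1, b2⟩ => ⟨a1, a2, a3, a5, b1, b2.le.trans a7, Or.inr ?_, fun i' hi' => ?_⟩,
      fun hb => ⟨a1, a2, a3, a5, a6, a7, a8, fun i' hi' => ?_⟩⟩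
    -- The default value `0` of a missing root is never mistaken for a root, because the interval
    -- starts at a time `≥ 0`.
    · rcases polyRoot_eq_zero_or_isRoot d c i with h' | h'
      · rw [h'] at b1
        linarith
      · exact h'
    · rintro ⟨c1, c2⟩
      rcases Nat.lt_succ_iff_lt_or_eq.1 hi' with h' | rfl
      · exact a9 i' h' ⟨c1, c2.trans b2⟩
      · exact lt_irrefl _ c2
    · rcases Nat.lt_succ_iff_lt_or_eq.1 hi' with h' | rfl
      · exact a9 i' h'
      · exact hb
  · rintro s' ⟨a1, a2, a3, a4, a5, a6, a7, a8, a9⟩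
    refine ⟨a1, a2, a3, a4, a5, a6, a7, a8, fun u hu hr => ?_⟩
    obtain ⟨i, hi, rfl⟩ := exists_polyRoot_eq hr
    exact a9 i hi hu

theorem eval_polyE {d : ℕ} (c : ℕ → RExpr d) (u : RExpr d) (s : Store) :
    (polyE c u).eval s = pv d (fun i => (c i).eval s) (u.eval s) := by
  simp [polyE, pv, RExpr.eval]

/-- The state of the search for the best action `a` on an interval from `s1` to `e1`, when the
first `k` actions have been tried. -/
structure Chosen (d n : ℕ) (W : ℕ → ℕ → ℝ) (eff : ℕ → ℕ) (sg s1 e : ℝ) (k : ℕ) (a : ℕ) (e1 : ℝ) :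
    Prop where
  lt : s1 < e1
  le : e1 ≤ e
  crossing : e1 = e ∨ e1 ∈ crossings d n (fun b => W (eff b))
  mem : ∃ b < n, a = eff b
  best : ∀ b < k, ∀ u ∈ Set.Icc s1 e1, sg * pv d (W (eff b)) u ≤ sg * pv d (W a) u

/-- The interval is cut at the first crossing of the new action with the best one so far; up to
there one of the two dominates. Shrinking the interval preserves all earlier comparisons, and
domination is transitive. -/
theorem compareStep_wp {d : ℕ} {s : Store} {e : ℝ} {k : ℕ} (h0 : 0 ≤ s.real 7)
    (hk : s.nat 3 = k) (hkn : k < s.nat 1)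
    (h : Chosen d (s.nat 1) (s.realArr 5 (s.nat 2)) (fun b => s.natArr 4 (s.nat 2) b 0) (s.real 9)
      (s.real 7) e k (s.nat 5) (s.real 8)) :
    (compareStep d).wp (fun s' =>
      Chosen d (s.nat 1) (s.realArr 5 (s.nat 2)) (fun b => s.natArr 4 (s.nat 2) b 0) (s.real 9)
        (s.real 7) e (k + 1) (s'.nat 5) (s'.real 8)) s := by
  set eff : ℕ → ℕ := fun b => s.natArr 4 (s.nat 2) b 0 with heff
  set W := s.realArr 5 (s.nat 2) with hW
  refine Prog.wp_mono (tryRoots_wp (s := s.setNat 6 (eff k)) h0 h.lt) ?_ |> fun h => by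
    simpa only [compareStep, Prog.wp, NExpr.eval, hk] using h
  rintro s' ⟨a1, a2, a3, a4, a5, a6, a7, a8, a9⟩
  simp only [Store.setNat, Function.update_self, ne_eq, not_false_eq_true,
    Nat.reduceEqDiff, Function.update_of_ne, ← hW] at a1 a2 a3 a4 a5 a6 a7 a8 a9
  have e2 : s'.nat 2 = s.nat 2 := by simp [a1]
  have e5 : s'.nat 5 = s.nat 5 := by simp [a1]
  have e6 : s'.nat 6 = eff k := by simp [a1]
  obtain ⟨b₀, hb₀, hab⟩ := h.mem
  have hcr : s'.real 8 = e ∨ s'.real 8 ∈ crossings d (s.nat 1) (fun b => W (eff b)) := by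
    rcases a8 with h' | h'
    · rw [h']
      exact h.crossing
    · right
      refine Finset.mem_biUnion.2 ⟨(k, b₀), by simp [hkn, hb₀], ?_⟩
      rw [hab] at h'
      exact Multiset.mem_toFinset.2 h'
  -- Any interior point would do; at the end points the two polynomials may agree without being
  -- equal.
  set mid := 1 / 2 * (s.real 7 + s'.real 8) with hmid
  have hmem : mid ∈ Set.Ioo (s.real 7) (s'.real 8) := by
    constructor <;> rw [hmid] <;> linarith
  have hcond : (BExpr.realLt (.mul (.var 9) (.sub (polyE (wE d (.var 5)) (midE d))
      (polyE (wE d (.var 6)) (midE d)))) (.lit 0)).Holds s' ↔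
      s.real 9 * (pv d (W (s.nat 5)) mid - pv d (W (eff k)) mid) < 0 := by
    simp only [BExpr.Holds, RExpr.eval, eval_polyE, midE, wE, NExpr.eval, a3, a4, a5, e2, e5, e6]
    norm_num [hmid]
    rfl
  have hsign := sign_of_no_zero
    (D := fun u => s.real 9 * (pv d (W (s.nat 5)) u - pv d (W (eff k)) u))
    (continuous_const.mul ((pv_continuous _ _).sub (pv_continuous _ _))) hmem (by
      by_cases hp : toPoly d (fun i => W (eff k) i - W (s.nat 5) i) = 0
      · right
        intro u
        have := pv_eq_zero_of_toPoly_eq_zero hp u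
        rw [pv_sub] at this
        rw [show pv d (W (s.nat 5)) u - pv d (W (eff k)) u = 0 by linarith, mul_zero]
      · by_cases hs : s.real 9 = 0
        · right
          simp [hs]
        left
        intro u hu hz
        refine a9 u hu ((Polynomial.mem_roots hp).2 ?_)
        rw [Polynomial.IsRoot, toPoly_eval, pv_sub]
        rcases mul_eq_zero.1 hz with h' | h'
        · exact (hs h').elim
        · linarith)
  have hcont : ∀ a, Continuous fun u => s.real 9 * pv d (W a) u := fun a =>
    continuous_const.mul (pv_continuous _ _)
  simp only [compareMid, Prog.wp]
  rw [hcond]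
  constructor
  · intro hb
    -- Closing the interval by continuity makes adjacent pieces share their end points, where both
    -- actions are then optimal.
    have hle := le_on_Icc_of_Ioo (hcont (s.nat 5)) (hcont (eff k)) a6 fun u hu => by
      have := hsign.1 hb u hu
      linarith
    simp only [Store.setNat, NExpr.eval, e6, Function.update_self]
    refine ⟨a6, a7.trans h.le, hcr, ⟨k, hkn, rfl⟩, fun b hbk u hu => ?_⟩
    rcases Nat.lt_succ_iff_lt_or_eq.1 hbk with h' | rfl
    · exact (h.best b h' u ⟨hu.1, hu.2.trans a7⟩).trans (hle u hu)
    · exact le_rfl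
  · intro hb
    have hle := le_on_Icc_of_Ioo (hcont (eff k)) (hcont (s.nat 5)) a6 fun u hu => by
      have := hsign.2 hb u hu
      linarith
    rw [e5]
    refine ⟨a6, a7.trans h.le, hcr, h.mem, fun b hbk u hu => ?_⟩
    rcases Nat.lt_succ_iff_lt_or_eq.1 hbk with h' | rfl
    · exact h.best b h' u ⟨hu.1, hu.2.trans a7⟩
    · exact hle u hu

theorem compareStep_straight (d : ℕ) : (compareStep d).Straight :=
  ⟨trivial, Prog.Straight_unroll fun _ _ => ⟨trivial, trivial, trivial⟩, trivial, trivial⟩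

theorem compareStep_keep (d : ℕ) :
    (∀ x, x ≠ 5 ∧ x ≠ 6 → (compareStep d).keepN x) ∧ (∀ x, x ≠ 8 ∧ x ≠ 11 → (compareStep d).keepR x) ∧
    (∀ x, (compareStep d).keepNA x) ∧ ∀ x, (compareStep d).keepRA x := by
  refine ⟨fun x hx => ⟨hx.2, keepN_unroll fun i => ?_, hx.1, trivial⟩,
    fun x hx => ⟨trivial, keepR_unroll fun i => ?_, trivial, trivial⟩,
    fun x => ⟨trivial, keepNA_unroll fun i => ?_, trivial, trivial⟩,
    fun x => ⟨trivial, keepRA_unroll fun i => ?_, trivial, trivial⟩⟩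
  · exact ⟨trivial, trivial, trivial⟩
  · exact ⟨hx.2, hx.1, trivial⟩
  · exact ⟨trivial, trivial, trivial⟩
  · exact ⟨trivial, trivial, trivial⟩

theorem choose_keep (d : ℕ) :
    (∀ x, x ≠ 3 ∧ x ≠ 5 ∧ x ≠ 6 → (choose d).keepN x) ∧
    (∀ x, x ≠ 8 ∧ x ≠ 11 → (choose d).keepR x) ∧
    (∀ x, (choose d).keepNA x) ∧ ∀ x, (choose d).keepRA x := by
  obtain ⟨h1, h2, h3, h4⟩ := compareStep_keep d
  refine ⟨fun x hx => ?_, fun x hx => ?_, fun x => ?_, fun x => ?_⟩ <;>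
    simp only [choose, Prog.keepN, Prog.keepR, Prog.keepNA, Prog.keepRA, Prog.keepN_forN,
      Prog.keepR_forN, Prog.keepNA_forN, Prog.keepRA_forN, true_and]
  · exact ⟨hx.2.1, hx.1, h1 x hx.2⟩
  · exact ⟨hx.1, h2 x hx⟩
  · exact h3 x
  · exact h4 x

theorem choose_onRow (d : ℕ) : (choose d).onRow 2 := by
  simp only [choose, Prog.onRow, Prog.onRow_forN, compareStep, compareMid]
  refine ⟨trivial, by decide, by decide, by decide, onRow_unroll fun i => ?_, by decide, trivial⟩
  exact ⟨trivial, trivial, trivial⟩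

theorem choose_runs (d : ℕ) : ∃ K, ∀ s : Store, 0 < s.nat 1 → 0 ≤ s.real 7 →
    s.real 7 < s.real 6 → Runs (choose d) s (K * (s.nat 1 + 1)) (fun s' =>
      Chosen d (s.nat 1) (s.realArr 5 (s.nat 2)) (fun b => s.natArr 4 (s.nat 2) b 0) (s.real 9)
        (s.real 7) (s.real 6) (s.nat 1) (s'.nat 5) (s'.real 8)) := by
  refine ⟨(compareStep d).bound + 50, fun s hn h0 hlt => ?_⟩
  set eff : ℕ → ℕ := fun b => s.natArr 4 (s.nat 2) b 0 with heff
  obtain ⟨k1, k2, k3, k4⟩ := compareStep_keep d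
  have hinit : Runs (d := d) (.setReal 8 (.var 6)) s 2 (fun s' => s' = s.setReal 8 (s.real 6)) :=
    ⟨_, _, .setReal _ _ _, by simp [RExpr.cost], rfl⟩
  have hinit2 : Runs (d := d) (.setNat 5 (.get 4 (.var 2) (.lit 0) (.lit 0)))
      (s.setReal 8 (s.real 6)) 5
      (fun s' => s' = (s.setReal 8 (s.real 6)).setNat 5 (eff 0)) :=
    ⟨_, _, .setNat _ _ _, by simp [NExpr.cost], rfl⟩
  refine (hinit.seq_eq (hinit2.seq_eq (c' := ((compareStep d).bound + 11) * (s.nat 1 + 1))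
    ?_)).mono (by nlinarith) fun _ h => h
  set s2 := (s.setReal 8 (s.real 6)).setNat 5 (eff 0) with hs2
  have hfix : ∀ s', Frame (Prog.forN 3 (.var 1) (compareStep d)) s2 s' →
      s'.nat 1 = s.nat 1 ∧ s'.nat 2 = s.nat 2 ∧ s'.real 7 = s.real 7 ∧ s'.real 9 = s.real 9 ∧
      s'.natArr = s.natArr ∧ s'.realArr = s.realArr := by
    intro s' hF
    refine ⟨?_, ?_, ?_, ?_, ?_, ?_⟩
    · rw [hF.nat 1 (by simpa using k1 1 (by simp))]; simp [hs2, Store.setNat, Store.setReal]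
    · rw [hF.nat 2 (by simpa using k1 2 (by simp))]; simp [hs2, Store.setNat, Store.setReal]
    · rw [hF.real 7 (by simpa using k2 7 (by simp))]; simp [hs2, Store.setNat, Store.setReal]
    · rw [hF.real 9 (by simpa using k2 9 (by simp))]; simp [hs2, Store.setNat, Store.setReal]
    · funext x; rw [hF.natArr x (by simpa using k3 x)]; rfl
    · funext x; rw [hF.realArr x (by simpa using k4 x)]; rfl
  refine (Runs.forN (c := (compareStep d).bound) (N := s.nat 1) (k1 3 (by simp))
    (fun s' hF => (hfix s' hF).1)
    (fun k s' => Chosen d (s.nat 1) (s.realArr 5 (s.nat 2)) eff (s.real 9)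
        (s.real 7) (s.real 6) k (s'.nat 5) (s'.real 8)) ?_ ?_ ?_).mono ?_ fun _ h => h.1
  · exact fun i s' v h => by simpa [Store.setNat] using h
  · simp only [hs2, Store.setNat, Store.setReal, Function.update_self]
    exact ⟨hlt, le_rfl, Or.inl rfl, ⟨0, hn, rfl⟩, by simp⟩
  · intro i hi s' hF hx hC
    obtain ⟨f1, f2, f3, f4, f5, f6⟩ := hfix s' hF
    have := compareStep_wp (d := d) (s := s') (e := s.real 6) (k := i) (by rwa [f3]) hx (by omega)
      (by simpa only [f1, f2, f3, f4, f5, f6] using hC)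
    simp only [f1, f2, f3, f4, f5, f6] at this
    exact Runs.straight (compareStep_straight d) this
  · simp [NExpr.cost]

end CTMG
end

noncomputable section

namespace CTMG

/-! ### Piecewise polynomial functions in tables -/

/-- A table of the pieces `1, …, cnt` of a piecewise polynomial function: piece `q` ends at `fin q`,
has the coefficients `coef q` and comes from action `act q`. -/
@[ext] structure Tab where
  cnt : ℕ
  fin : ℕ → ℝ
  coef : ℕ → ℕ → ℝ
  act : ℕ → ℕ

/-- The table for location `l` of level `j`. -/
def tab (j : ℕ) (s : Store) (l : ℕ) : Tab where
  cnt := s.natArr (10 + 2 * j) l 0 0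
  fin := fun q => s.realArr (10 + 2 * j) l q 0
  coef := fun q i => s.realArr (11 + 2 * j) l q i
  act := fun q => s.natArr (11 + 2 * j) l q 0

/-- The table `t` represents `g` on the interval from `0` to `z`, with polynomials of degree at
most `r` (if this does not exceed `d`) and actions that are `Good`. -/
structure TabOK (d r : ℕ) (g : ℝ → ℝ) (Good : ℝ → ℕ → Prop) (z : ℝ) (t : Tab) : Prop where
  zero : t.fin 0 = 0
  coef_zero : ∀ i ≤ d, t.coef 0 i = 0
  last : t.fin t.cnt = z
  mono : ∀ q < t.cnt, t.fin q ≤ t.fin (q + 1)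
  good : ∀ q < t.cnt, ∀ u ∈ Set.Icc (t.fin q) (t.fin (q + 1)), Good u (t.act (q + 1))
  rep : r ≤ d → ∀ q < t.cnt, ∀ u ∈ Set.Icc (t.fin q) (t.fin (q + 1)), g u = pv d (t.coef (q + 1)) u
  deg : ∀ q < t.cnt, ∀ i, r < i → i ≤ d → t.coef (q + 1) i = 0

theorem TabOK.append {d r : ℕ} {g : ℝ → ℝ} {Good : ℝ → ℕ → Prop} {z z' : ℝ} {t t' : Tab}
    (h : TabOK d r g Good z t) (hz : z ≤ z') (hcnt : t'.cnt = t.cnt + 1)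
    (hfin : ∀ q ≠ t.cnt + 1, t'.fin q = t.fin q) (hfin' : t'.fin (t.cnt + 1) = z')
    (hcoef : ∀ q ≠ t.cnt + 1, t'.coef q = t.coef q) (hact : ∀ q ≠ t.cnt + 1, t'.act q = t.act q)
    (hgood : ∀ u ∈ Set.Icc z z', Good u (t'.act (t.cnt + 1)))
    (hrep : r ≤ d → ∀ u ∈ Set.Icc z z', g u = pv d (t'.coef (t.cnt + 1)) u)
    (hdeg : ∀ i, r < i → i ≤ d → t'.coef (t.cnt + 1) i = 0) : TabOK d r g Good z' t' := by
  have hcases : ∀ q < t'.cnt, q < t.cnt ∨ q = t.cnt := fun q hq => by omega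
  have hl : t'.fin t.cnt = z := by rw [hfin _ (by omega), h.last]
  refine ⟨by rw [hfin 0 (by omega), h.zero], ?_, by rw [hcnt, hfin'], ?_, ?_, ?_, ?_⟩
  · rw [hcoef 0 (by omega)]; exact h.coef_zero
  · intro q hq
    rcases hcases q hq with hq' | rfl
    · rw [hfin q (by omega), hfin (q + 1) (by omega)]; exact h.mono q hq'
    · rw [hl, hfin']; exact hz
  · intro q hq
    rcases hcases q hq with hq' | rfl
    · rw [hfin q (by omega), hfin (q + 1) (by omega), hact (q + 1) (by omega)]; exact h.good q hq'
    · rw [hl, hfin']; exact hgood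
  · intro hr q hq
    rcases hcases q hq with hq' | rfl
    · rw [hfin q (by omega), hfin (q + 1) (by omega), hcoef (q + 1) (by omega)]
      exact h.rep hr q hq'
    · rw [hl, hfin']; exact hrep hr
  · intro q hq
    rcases hcases q hq with hq' | rfl
    · rw [hcoef (q + 1) (by omega)]; exact h.deg q hq'
    · exact hdeg

theorem TabOK.extend {d r : ℕ} {g : ℝ → ℝ} {Good : ℝ → ℕ → Prop} {z z' : ℝ} {t t' : Tab}
    (h : TabOK d r g Good z t) (hz : z ≤ z') (h0 : 0 < t.cnt) (hcnt : t'.cnt = t.cnt)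
    (hfin : ∀ q ≠ t.cnt, t'.fin q = t.fin q) (hfin' : t'.fin t.cnt = z')
    (hcoef : t'.coef = t.coef) (hact : t'.act = t.act)
    (hgood : ∀ u ∈ Set.Icc z z', Good u (t.act t.cnt))
    (hrep : r ≤ d → ∀ u ∈ Set.Icc z z', g u = pv d (t.coef t.cnt) u) :
    TabOK d r g Good z' t' := by
  have hcases : ∀ q < t'.cnt, q + 1 < t.cnt ∨ q + 1 = t.cnt := fun q hq => by omega
  -- The last piece now covers its old domain and the new interval, and the two cases are treated
  -- separately.
  have hu : ∀ q, q + 1 = t.cnt → ∀ u ∈ Set.Icc (t'.fin q) (t'.fin (q + 1)),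
      u ∈ Set.Icc (t.fin q) (t.fin (q + 1)) ∨ u ∈ Set.Icc z z' := by
    intro q hq u hu
    rw [hfin q (by omega), hq, hfin'] at hu
    rcases le_total u z with h' | h'
    · left; rw [hq, h.last]; exact ⟨hu.1, h'⟩
    · right; exact ⟨h', hu.2⟩
  refine ⟨by rw [hfin 0 (by omega), h.zero], by rw [hcoef]; exact h.coef_zero,
    by rw [hcnt, hfin'], ?_, ?_, ?_, ?_⟩
  · intro q hq
    rcases hcases q hq with hq' | hq'
    · rw [hfin q (by omega), hfin (q + 1) (by omega)]; exact h.mono q (by omega)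
    · rw [hfin q (by omega), hq', hfin']
      refine le_trans ?_ hz
      rw [← h.last, ← hq']
      exact h.mono q (by omega)
  · intro q hq u hu'
    rw [hact]
    rcases hcases q hq with hq' | hq'
    · rw [hfin q (by omega), hfin (q + 1) (by omega)] at hu'; exact h.good q (by omega) u hu'
    · rcases hu q hq' u hu' with h' | h'
      · exact h.good q (by omega) u h'
      · rw [hq']; exact hgood u h'
  · intro hr q hq u hu'
    rw [hcoef]
    rcases hcases q hq with hq' | hq'
    · rw [hfin q (by omega), hfin (q + 1) (by omega)] at hu'; exact h.rep hr q (by omega) u hu'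
    · rcases hu q hq' u hu' with h' | h'
      · exact h.rep hr q (by omega) u h'
      · rw [hq']; exact hrep hr u h'
  · intro q hq
    rw [hcoef]
    exact h.deg q (by omega)

/-! ### The pieces of one location between two events -/

/-- The data of one location between two events, at `s0` and `e`: `W a` and `cl` are polynomials
such that `W a - cl` is the derivative of `g` whenever `a` is the best action. -/
structure Local (d n r : ℕ) (W : ℕ → ℕ → ℝ) (cl : ℕ → ℝ) (eff : ℕ → ℕ) (sg : ℝ) (g : ℝ → ℝ)
    (Good : ℝ → ℕ → Prop) (s0 e : ℝ) : Prop where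
  deriv : ∃ h : ℝ → ℝ, (∀ u, HasDerivAt g (h u) u) ∧
    ∀ u ∈ Set.Icc s0 e, ∀ a, (∃ b < n, a = eff b) →
      (∀ b < n, sg * pv d (W (eff b)) u ≤ sg * pv d (W a) u) →
      Good u a ∧ h u = pv d (W a) u - pv d cl u
  degW : ∀ a, (∃ b < n, a = eff b) → ∀ i, r < i → i ≤ d → W a i = 0
  degC : ∀ i, r < i → i ≤ d → cl i = 0
  sign : sg ≠ 0

/-- The state when the pieces up to `s1` have been found, of which there were `c0` before the last
event; `fl` tells whether there is a piece that begins after this event, and `la` is the action of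
the last such piece. -/
structure Progress (d n r : ℕ) (W : ℕ → ℕ → ℝ) (cl : ℕ → ℝ) (eff : ℕ → ℕ) (sg : ℝ) (g : ℝ → ℝ)
    (Good : ℝ → ℕ → Prop) (s0 : ℝ) (c0 : ℕ) (s1 V : ℝ) (fl la : ℕ) (t : Tab) : Prop where
  ok : TabOK d (r + 1) g Good s1 t
  val : V = g s1
  first : fl = 0 → s1 = s0 ∧ t.cnt = c0
  mem : fl ≠ 0 → ∃ b < n, la = eff b
  pos : fl ≠ 0 → 0 < t.cnt
  act : fl ≠ 0 → t.act t.cnt = la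
  rep : fl ≠ 0 → r + 1 ≤ d →
    ∀ u, pv d (t.coef t.cnt) u = g s1 + prim d (fun i => W la i - cl i) s1 u
  affine : fl ≠ 0 → r ≤ 1 → t.cnt ≤ c0 +
      ((Finset.range n).filter fun b => sg * W (eff b) 1 ≤ sg * W la 1).card ∧
    ∃ z < s1, ∀ u ∈ Set.Icc z s1, ∀ b < n, sg * pv d (W (eff b)) u ≤ sg * pv d (W la) u

section Step

variable {d n r : ℕ} {W : ℕ → ℕ → ℝ} {cl : ℕ → ℝ} {eff : ℕ → ℕ} {sg : ℝ} {g : ℝ → ℝ}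
  {Good : ℝ → ℕ → Prop} {s0 e : ℝ} {c0 : ℕ} {s1 V : ℝ} {fl la a : ℕ} {e1 : ℝ} {t t' : Tab}

theorem Local.good (hL : Local d n r W cl eff sg g Good s0 e) (hs : s0 ≤ s1)
    (hC : Chosen d n W eff sg s1 e n a e1) : ∀ u ∈ Set.Icc s1 e1, Good u a := by
  obtain ⟨h, hg, hb⟩ := hL.deriv
  exact fun u hu => (hb u ⟨hs.trans hu.1, hu.2.trans hC.le⟩ a hC.mem
    fun b hb => hC.best b hb u hu).1

theorem Local.value (hL : Local d n r W cl eff sg g Good s0 e) (hs : s0 ≤ s1)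
    (hC : Chosen d n W eff sg s1 e n a e1) :
    ∀ u ∈ Set.Icc s1 e1, g u = g s1 + prim d (fun i => W a i - cl i) s1 u := by
  obtain ⟨h, hg, hb⟩ := hL.deriv
  intro u hu
  refine eq_add_prim hg (fun v hv => ?_) hu
  rw [pv_sub]
  exact (hb v ⟨hs.trans hv.1, hv.2.trans hC.le⟩ a hC.mem fun b hb => hC.best b hb v hv).2

/-- If the new best action has the same polynomial as the previous one, the last piece is prolonged
and the previous action is kept. Without this merging, ties would spoil the bound of `n` pieces in
the affine case. -/
theorem Progress.extend (hL : Local d n r W cl eff sg g Good s0 e)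
    (hP : Progress d n r W cl eff sg g Good s0 c0 s1 V fl la t) (hs : s0 ≤ s1)
    (hC : Chosen d n W eff sg s1 e n a e1) (hfl : fl ≠ 0) (hsame : ∀ i ≤ d, W a i = W la i)
    (hcnt : t'.cnt = t.cnt) (hfin : ∀ q ≠ t.cnt, t'.fin q = t.fin q) (hfin' : t'.fin t.cnt = e1)
    (hcoef : t'.coef = t.coef) (hact : t'.act = t.act) :
    Progress d n r W cl eff sg g Good s0 c0 e1 (V + prim d (fun i => W a i - cl i) s1 e1) fl la
      t' := by
  have hC' : Chosen d n W eff sg s1 e n la e1 :=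
    ⟨hC.lt, hC.le, hC.crossing, hP.mem hfl, fun b hb u hu =>
      (hC.best b hb u hu).trans_eq (by rw [pv_congr hsame])⟩
  have hval := hL.value hs hC'
  have hprim : ∀ u v, prim d (fun i => W a i - cl i) u v = prim d (fun i => W la i - cl i) u v :=
    fun u v => prim_congr (fun i hi => by rw [hsame i hi]) _ _
  have he1 := hval e1 ⟨hC.lt.le, le_rfl⟩
  refine ⟨hP.ok.extend hC.lt.le (hP.pos hfl) hcnt hfin hfin' hcoef hact ?_ ?_, ?_, fun h => (hfl h).elim,
    hP.mem, fun h => hcnt ▸ hP.pos h, fun h => by rw [hact, hcnt, hP.act h], ?_, ?_⟩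
  · rw [hP.act hfl]
    exact hL.good hs hC'
  · intro hr u hu
    rw [hP.rep hfl hr u, hval u hu]
  · rw [hP.val, hprim, ← he1]
  · intro h hr u
    rw [hcoef, hcnt, hP.rep h hr u, he1, add_assoc, prim_add]
  · intro h hr
    obtain ⟨h1, z, hz, h2⟩ := hP.affine h hr
    exact ⟨hcnt ▸ h1, s1, hC.lt, fun u hu b hb => hC'.best b hb u hu⟩

theorem pv_affine {c : ℕ → ℝ} (h : ∀ i, 1 < i → i ≤ d → c i = 0) (hd : 1 ≤ d) (u : ℝ) :
    pv d c u = c 0 + c 1 * u := by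
  rw [pv, ← Finset.sum_subset (s₁ := Finset.range 2)]
  · simp [Finset.sum_range_succ]
  · exact Finset.range_mono (by omega)
  · intro i hi hi'
    simp only [Finset.mem_range] at hi hi'
    rw [h i (by omega) (by omega), zero_mul]

/-- For `r ≤ 1` the pieces of an upper envelope of affine functions have strictly increasing slopes.
Counting the actions whose slope does not exceed the current one therefore bounds the number of
pieces since the last event, hence by `n`. -/
theorem Progress.append (hd : 1 ≤ d) (hL : Local d n r W cl eff sg g Good s0 e)
    (hP : Progress d n r W cl eff sg g Good s0 c0 s1 V fl la t) (hs : s0 ≤ s1)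
    (hC : Chosen d n W eff sg s1 e n a e1)
    (hnew : fl = 0 ∨ ∃ i ≤ d, W a i ≠ W la i)
    (hcnt : t'.cnt = t.cnt + 1)
    (hfin : ∀ q ≠ t.cnt + 1, t'.fin q = t.fin q) (hfin' : t'.fin (t.cnt + 1) = e1)
    (hcoef : ∀ q ≠ t.cnt + 1, t'.coef q = t.coef q) (hact : ∀ q ≠ t.cnt + 1, t'.act q = t.act q)
    (hcoef' : ∀ i ≤ d, t'.coef (t.cnt + 1) i = primCoef d V (fun i => W a i - cl i) s1 i)
    (hact' : t'.act (t.cnt + 1) = a) :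
    Progress d n r W cl eff sg g Good s0 c0 e1 (V + prim d (fun i => W a i - cl i) s1 e1) 1 a t' := by
  have hval := hL.value hs hC
  have he1 := hval e1 ⟨hC.lt.le, le_rfl⟩
  have hrep : r + 1 ≤ d → ∀ u, pv d (t'.coef (t.cnt + 1)) u =
      g s1 + prim d (fun i => W a i - cl i) s1 u := by
    intro hr u
    rw [pv_congr hcoef', pv_primCoef, hP.val]
    -- Here `r < d`, so the top coefficient of the derivative is zero and no coefficient of its
    -- primitive is lost.
    rw [hL.degW a hC.mem d (by omega) le_rfl, hL.degC d (by omega) le_rfl, sub_zero]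
  refine ⟨hP.ok.append hC.lt.le hcnt hfin hfin' hcoef hact ?_ ?_ ?_, ?_, fun h => by omega,
    fun _ => hC.mem, fun _ => by omega, fun _ => by rw [hcnt, hact'], ?_, ?_⟩
  · rw [hact']
    exact hL.good hs hC
  · intro hr u hu
    rw [hrep hr u, hval u hu]
  · intro i hi hid
    obtain ⟨i, rfl⟩ : ∃ i', i = i' + 1 := ⟨i - 1, by omega⟩
    rw [hcoef' _ hid, primCoef, hL.degW a hC.mem i (by omega) (by omega),
      hL.degC i (by omega) (by omega), sub_zero, zero_mul]
  · rw [hP.val, ← he1]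
  · intro _ hr u
    rw [hcnt, hrep hr u, he1, add_assoc, prim_add]
  · intro _ hr
    refine ⟨?_, s1, hC.lt, fun u hu b hb => hC.best b hb u hu⟩
    obtain ⟨ba, hba, hba'⟩ := hC.mem
    have haff : ∀ a, (∃ b < n, a = eff b) → ∀ u, pv d (W a) u = W a 0 + W a 1 * u := fun a ha u =>
      pv_affine (fun i h1 h2 => hL.degW a ha i (by omega) h2) hd u
    by_cases hfl : fl = 0
    · rw [hcnt, (hP.first hfl).2]
      -- The first piece after an event is paid for by the chosen action itself.
      have : 0 < ((Finset.range n).filter fun b => sg * W (eff b) 1 ≤ sg * W a 1).card :=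
        Finset.card_pos.2 ⟨ba, by simp [hba, hba']⟩
      omega
    · obtain ⟨h1, z, hz, h2⟩ := hP.affine hfl hr
      obtain ⟨bl, hbl, hbl'⟩ := hP.mem hfl
      -- The old action is best on an interval to the left of `s1` and both are best at `s1`: the
      -- lines meet there, and the new one lies weakly below on the left. With equal slopes the
      -- lines would coincide, which is the case of `Progress.extend`.
      have hlt : sg * W la 1 < sg * W a 1 := by
        have k1 := h2 z ⟨le_rfl, hz.le⟩ ba hba
        have k2 := h2 s1 ⟨hz.le, le_rfl⟩ ba hba
        have k3 := hC.best bl hbl s1 ⟨le_rfl, hC.lt.le⟩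
        rw [← hba', haff a hC.mem, haff la (hP.mem hfl)] at k1 k2
        rw [← hbl', haff a hC.mem, haff la (hP.mem hfl)] at k3
        have hle : sg * W la 1 ≤ sg * W a 1 := by
          by_contra! hcon
          nlinarith
        refine lt_of_le_of_ne hle fun heq => ?_
        have e1 : W la 1 = W a 1 := mul_left_cancel₀ hL.sign heq
        have e0 : W la 0 = W a 0 := by
          have : sg * (W la 0 + W la 1 * s1) = sg * (W a 0 + W a 1 * s1) := le_antisymm k3 k2
          have := mul_left_cancel₀ hL.sign this
          rw [e1] at this
          linarith
        rcases hnew with h | ⟨i, hi, hne⟩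
        · exact hfl h
        · apply hne
          rcases Nat.lt_or_ge 1 i with h | h
          · rw [hL.degW a hC.mem i (by omega) hi, hL.degW la (hP.mem hfl) i (by omega) hi]
          · interval_cases i
            · exact e0.symm
            · exact e1.symm
      have : ((Finset.range n).filter fun b => sg * W (eff b) 1 ≤ sg * W la 1).card <
          ((Finset.range n).filter fun b => sg * W (eff b) 1 ≤ sg * W a 1).card := by
        refine Finset.card_lt_card (Finset.ssubset_iff_of_subset ?_ |>.2 ⟨ba, ?_, ?_⟩)
        · intro b hb
          simp only [Finset.mem_filter] at hb ⊢
          exact ⟨hb.1, hb.2.trans hlt.le⟩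
        · simp [hba, hba']
        · simp only [Finset.mem_filter, not_and, not_le, ← hba']
          exact fun _ => hlt
      omega

end Step

/-! ### The program for one location between two events -/

def cntE (j : ℕ) : NExpr := .get (12 + 2 * j) (.var 2) (.lit 0) (.lit 0)

/-- Coefficient `i` of the derivative if the action in variable `5` is used. -/
def derivE (d j i : ℕ) : RExpr d :=
  .sub (wE d (.var 5) i)
    (.get (11 + 2 * j) (.var 2) (.get 5 (.var 2) (.lit 0) (.lit 0)) (.lit i))

def valE (d : ℕ) : RExpr d := .get 4 (.var 2) (.lit 0) (.lit 0)

/-- A sum of squares turns equality of two coefficient vectors into one strict comparison, the only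
test for reals that the machine has. -/
def differE (d : ℕ) : RExpr d :=
  .sumTo (fun i => .mul (.sub (wE d (.var 5) i) (wE d (.var 9) i))
    (.sub (wE d (.var 5) i) (wE d (.var 9) i))) (d + 1)

def putCoef (d j i : ℕ) : Prog d :=
  .putReal (13 + 2 * j) (.var 2) (cntE j) (.lit (i + 1))
    (.mul (derivE d j i) (.lit (1 / ((i : ℚ) + 1))))

def appendPiece (d j : ℕ) : Prog d :=
  .seq (.putNat (12 + 2 * j) (.var 2) (.lit 0) (.lit 0) (.add (cntE j) (.lit 1)))
  (.seq (.putReal (13 + 2 * j) (.var 2) (cntE j) (.lit 0)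
    (.sub (valE d) (.sumTo (fun i => .mul (.mul (derivE d j i) (.npow (.var 7) (i + 1)))
      (.lit (1 / ((i : ℚ) + 1)))) (d + 1))))
  (.seq (.unroll (putCoef d j) d)
  (.seq (.putNat (13 + 2 * j) (.var 2) (cntE j) (.lit 0) (.var 5))
  (.seq (.setNat 9 (.var 5)) (.setNat 8 (.lit 1))))))

/-- The running value is updated by the primitive directly, not by way of the stored coefficients.
So it is exact even on the last level, where the primitive has degree `d + 1` and does not fit into
the table. -/
def finishPiece (d j : ℕ) : Prog d :=
  .seq (.putReal (12 + 2 * j) (.var 2) (cntE j) (.lit 0) (.var 8))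
  (.seq (.putReal 4 (.var 2) (.lit 0) (.lit 0) (.add (valE d)
    (.sumTo (fun i => .mul (.mul (derivE d j i)
      (.sub (.npow (.var 8) (i + 1)) (.npow (.var 7) (i + 1))))
      (.lit (1 / ((i : ℚ) + 1)))) (d + 1))))
  (.setReal 7 (.var 8)))

def emit (d j : ℕ) : Prog d :=
  .seq (.branch (.and (.natLt (.lit 0) (.var 8)) (.not (.realLt (.lit 0) (differE d)))) .nop
    (appendPiece d j)) (finishPiece d j)

/-- Scalar `9` of the reals is the sign of the owner, which lets one envelope routine serve
maximization and minimization. The flag in natural scalar `8` is reset at each event, so that pieces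
are not merged across events. -/
def inner (d j : ℕ) : Prog d :=
  .seq (.branch (.natLt (.lit 0) (.get 0 (.var 2) (.lit 0) (.lit 0))) (.setReal 9 (.lit 1))
    (.setReal 9 (.lit (-1))))
  (.seq (.setReal 7 (.var 5)) (.seq (.setNat 8 (.lit 0))
    (.loop (.realLt (.var 7) (.var 6)) (.seq (choose d) (emit d j)))))

theorem appendPiece_wp {d j : ℕ} {s : Store} :
    (appendPiece d j).wp (fun s' =>
      s'.nat 2 = s.nat 2 ∧ s'.nat 5 = s.nat 5 ∧ s'.real = s.real ∧ s'.nat 8 = 1 ∧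
      s'.nat 9 = s.nat 5 ∧
      s'.natArr 5 = s.natArr 5 ∧ s'.realArr 4 = s.realArr 4 ∧ s'.realArr 5 = s.realArr 5 ∧
      s'.realArr (11 + 2 * j) = s.realArr (11 + 2 * j) ∧
      (tab (j + 1) s' (s.nat 2)).cnt = (tab (j + 1) s (s.nat 2)).cnt + 1 ∧
      (tab (j + 1) s' (s.nat 2)).fin = (tab (j + 1) s (s.nat 2)).fin ∧
      (∀ q ≠ (tab (j + 1) s (s.nat 2)).cnt + 1,
        (tab (j + 1) s' (s.nat 2)).coef q = (tab (j + 1) s (s.nat 2)).coef q) ∧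
      (∀ q ≠ (tab (j + 1) s (s.nat 2)).cnt + 1,
        (tab (j + 1) s' (s.nat 2)).act q = (tab (j + 1) s (s.nat 2)).act q) ∧
      (∀ i ≤ d, (tab (j + 1) s' (s.nat 2)).coef ((tab (j + 1) s (s.nat 2)).cnt + 1) i =
        primCoef d (s.realArr 4 (s.nat 2) 0 0)
          (fun i => s.realArr 5 (s.nat 2) (s.nat 5) i -
            s.realArr (11 + 2 * j) (s.nat 2) (s.natArr 5 (s.nat 2) 0 0) i) (s.real 7) i) ∧
      (tab (j + 1) s' (s.nat 2)).act ((tab (j + 1) s (s.nat 2)).cnt + 1) = s.nat 5) s := by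
  set D : ℕ → ℝ := fun i => s.realArr 5 (s.nat 2) (s.nat 5) i -
            s.realArr (11 + 2 * j) (s.nat 2) (s.natArr 5 (s.nat 2) 0 0) i with hD
  set c := s.natArr (12 + 2 * j) (s.nat 2) 0 0 with hc
  set s1 := s.putNat (12 + 2 * j) (s.nat 2) 0 0 (c + 1) with hs1
  set s2 := s1.putReal (13 + 2 * j) (s.nat 2) (c + 1) 0
    (primCoef d (s.realArr 4 (s.nat 2) 0 0) D (s.real 7) 0) with hs2
  have hcnt1 : (cntE j).eval s1 = c + 1 := by simp [cntE, NExpr.eval, hs1, Store.putNat]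
  have n1 : s1.natArr 5 = s.natArr 5 := by
    funext i q k
    simp only [hs1, Store.putNat]
    rw [if_neg (by omega)]
  have hder : ∀ (s' : Store) i, s'.nat = s.nat → s'.natArr 5 = s.natArr 5 →
      s'.realArr 5 = s.realArr 5 → s'.realArr (11 + 2 * j) = s.realArr (11 + 2 * j) →
      (derivE d j i).eval s' = D i := by
    intro s' i h1 h2 h3 h4
    simp [derivE, wE, RExpr.eval, NExpr.eval, h1, h2, h3, h4, hD]
  have hv : (RExpr.sub (valE d) (.sumTo (fun i => .mul (.mul (derivE d j i)
      (.npow (.var 7) (i + 1))) (.lit (1 / ((i : ℚ) + 1)))) (d + 1))).eval s1 =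
      primCoef d (s.realArr 4 (s.nat 2) 0 0) D (s.real 7) 0 := by
    simp only [RExpr.eval, valE, RExpr.eval_sumTo, RExpr.eval_npow, NExpr.eval, primCoef]
    refine congrArg₂ _ rfl (Finset.sum_congr rfl fun i _ => ?_)
    rw [hder s1 i rfl n1 rfl rfl]
    push_cast
    rfl
  have r24 : s2.realArr 4 = s.realArr 4 := by
    funext i q k
    simp only [hs2, Store.putReal]
    rw [if_neg (by omega)]
    rfl
  have r25 : s2.realArr 5 = s.realArr 5 := by
    funext i q k
    simp only [hs2, Store.putReal]
    rw [if_neg (by omega)]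
    rfl
  have r2c : s2.realArr (11 + 2 * j) = s.realArr (11 + 2 * j) := by
    funext i q k
    simp only [hs2, Store.putReal]
    rw [if_neg (by omega)]
    rfl
  have key := Prog.wp_unroll (f := putCoef d j) (n := d) (s := s2)
    (fun it s' => s'.nat = s.nat ∧ s'.real = s.real ∧ s'.natArr = s1.natArr ∧
      (∀ arr, arr ≠ 13 + 2 * j → s'.realArr arr = s.realArr arr) ∧
      (∀ i q, (i ≠ s.nat 2 ∨ q ≠ c + 1) →
        s'.realArr (13 + 2 * j) i q = s.realArr (13 + 2 * j) i q) ∧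
      ∀ i ≤ it, s'.realArr (13 + 2 * j) (s.nat 2) (c + 1) i =
        primCoef d (s.realArr 4 (s.nat 2) 0 0) D (s.real 7) i)
    (by
      refine ⟨rfl, rfl, rfl, fun arr h => ?_, fun i q h => ?_, fun i hi => ?_⟩
      · funext i q k
        simp only [hs2, Store.putReal]
        rw [if_neg (by omega)]
        rfl
      · funext k
        simp only [hs2, Store.putReal]
        rw [if_neg (by omega)]
        rfl
      · obtain rfl : i = 0 := by omega
        simp [hs2, Store.putReal])
    (by
      rintro it hit s' ⟨a1, a2, a3, a4, a5, a6⟩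
      have ec : (cntE j).eval s' = c + 1 := by
        rw [← hcnt1]
        simp [cntE, NExpr.eval, a1, a3, hs1, Store.putNat]
      have ed : (derivE d j it).eval s' = D it :=
        hder s' it a1 (by rw [a3, n1]) (a4 5 (by omega)) (a4 _ (by omega))
      have e2 : s'.nat 2 = s.nat 2 := by rw [a1]
      simp only [putCoef, Prog.wp, NExpr.eval, RExpr.eval, ec, ed, e2]
      refine ⟨a1, a2, a3, fun arr h => ?_, fun i q h => ?_, fun i hi => ?_⟩
      · rw [← a4 arr h]
        funext i q k
        simp only [Store.putReal]
        rw [if_neg (by omega)]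
      · rw [← a5 i q h]
        funext k
        simp only [Store.putReal]
        rw [if_neg (by omega)]
      · simp only [Store.putReal, true_and]
        rcases Nat.lt_succ_iff_lt_or_eq.1 (Nat.lt_succ_of_le hi) with h | rfl
        · rw [if_neg (by omega)]
          exact a6 i (by omega)
        · rw [if_pos rfl, primCoef]
          push_cast
          rfl)
  simp only [appendPiece, Prog.wp]
  have w1 : (NExpr.add (cntE j) (.lit 1)).eval s = c + 1 := rfl
  have e0 : (NExpr.lit 0).eval s = 0 := rfl
  have e2 : (NExpr.var 2).eval s = s.nat 2 := rfl
  rw [w1, e0, e2, ← hs1, hcnt1, hv]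
  have e0 : (NExpr.lit 0).eval s1 = 0 := rfl
  have e2 : (NExpr.var 2).eval s1 = s.nat 2 := rfl
  rw [e0, e2, ← hs2]
  refine Prog.wp_mono key ?_
  rintro s' ⟨a1, a2, a3, a4, a5, a6⟩
  have ec : (cntE j).eval s' = c + 1 := by
    rw [← hcnt1]
    simp [cntE, NExpr.eval, a1, a3, hs1, Store.putNat]
  rw [ec]
  have nn : ∀ arr i q k, s1.natArr arr i q k =
    if arr = 12 + 2 * j ∧ i = s.nat 2 ∧ q = 0 ∧ k = 0 then c + 1 else s.natArr arr i q k :=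
    fun _ _ _ _ => rfl
  simp only [NExpr.eval, Store.setNat, Store.putNat, tab, a1, a2, a3, nn, Function.update_self, ne_eq,
    Nat.reduceEqDiff, not_false_eq_true, Function.update_of_ne, true_and,
    show 10 + 2 * (j + 1) = 12 + 2 * j by ring, show 11 + 2 * (j + 1) = 13 + 2 * j by ring]
  refine ⟨?_, a4 4 (by omega), a4 5 (by omega), a4 _ (by omega), ?_, ?_, ?_, ?_, ?_, ?_⟩
  · funext i q k
    rw [if_neg (by omega), if_neg (by omega)]
  · rw [if_neg (by omega)]
    simp [hc]
  · rw [a4 _ (by omega)]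
  · intro q hq
    rw [a5 _ _ (Or.inr (by omega))]
  · intro q hq
    rw [if_neg (by omega), if_neg (by omega)]
  · exact a6
  · rw [if_pos (by simp [hc])]

theorem finishPiece_wp {d j : ℕ} {s : Store} :
    (finishPiece d j).wp (fun s' => s'.nat = s.nat ∧ s'.real 7 = s.real 8 ∧
      s'.realArr 4 (s.nat 2) 0 0 = s.realArr 4 (s.nat 2) 0 0 + prim d
        (fun i => s.realArr 5 (s.nat 2) (s.nat 5) i -
            s.realArr (11 + 2 * j) (s.nat 2) (s.natArr 5 (s.nat 2) 0 0) i) (s.real 7) (s.real 8) ∧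
      (tab (j + 1) s' (s.nat 2)).cnt = (tab (j + 1) s (s.nat 2)).cnt ∧
      (∀ q ≠ (tab (j + 1) s (s.nat 2)).cnt,
        (tab (j + 1) s' (s.nat 2)).fin q = (tab (j + 1) s (s.nat 2)).fin q) ∧
      (tab (j + 1) s' (s.nat 2)).fin (tab (j + 1) s (s.nat 2)).cnt = s.real 8 ∧
      (tab (j + 1) s' (s.nat 2)).coef = (tab (j + 1) s (s.nat 2)).coef ∧
      (tab (j + 1) s' (s.nat 2)).act = (tab (j + 1) s (s.nat 2)).act) s := by
  set D : ℕ → ℝ := fun i => s.realArr 5 (s.nat 2) (s.nat 5) i -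
            s.realArr (11 + 2 * j) (s.nat 2) (s.natArr 5 (s.nat 2) 0 0) i with hD
  set c := s.natArr (12 + 2 * j) (s.nat 2) 0 0 with hc
  set s1 := s.putReal (12 + 2 * j) (s.nat 2) c 0 (s.real 8) with hs1
  have rr : ∀ arr i q k, s1.realArr arr i q k =
    if arr = 12 + 2 * j ∧ i = s.nat 2 ∧ q = c ∧ k = 0 then s.real 8 else s.realArr arr i q k :=
    fun _ _ _ _ => rfl
  have hder : ∀ i, (derivE d j i).eval s1 = D i := by
    intro i
    simp only [derivE, wE, RExpr.eval, NExpr.eval, rr]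
    rw [if_neg (by omega), if_neg (by omega)]
    rfl
  have hv : (RExpr.add (valE d) (.sumTo (fun i => .mul (.mul (derivE d j i)
      (.sub (.npow (.var 8) (i + 1)) (.npow (.var 7) (i + 1))))
      (.lit (1 / ((i : ℚ) + 1)))) (d + 1))).eval s1 =
      s.realArr 4 (s.nat 2) 0 0 + prim d D (s.real 7) (s.real 8) := by
    simp only [RExpr.eval, valE, RExpr.eval_sumTo, RExpr.eval_npow, NExpr.eval, prim, hder, rr]
    rw [if_neg (by omega)]
    refine congrArg₂ _ rfl (Finset.sum_congr rfl fun i _ => ?_)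
    push_cast
    rfl
  simp only [finishPiece, Prog.wp]
  rw [show (cntE j).eval s = c from rfl, show (RExpr.var 8 : RExpr d).eval s = s.real 8 from rfl,
    show (NExpr.lit 0).eval s = 0 from rfl, show (NExpr.var 2).eval s = s.nat 2 from rfl, ← hs1, hv]
  simp only [NExpr.eval, RExpr.eval, Store.setReal, Store.putReal, tab, rr, Function.update_self,
    show 10 + 2 * (j + 1) = 12 + 2 * j by ring, show 11 + 2 * (j + 1) = 13 + 2 * j by ring]
  refine ⟨rfl, rfl, ?_, rfl, ?_, ?_, ?_, rfl⟩
  · simp [hs1, Store.putReal]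
  · intro q hq
    rw [if_neg (by omega), if_neg (by omega)]
  · rw [if_neg (by omega), if_pos (by simp [hc])]
  · funext q i
    rw [if_neg (by omega), if_neg (by omega)]

theorem emit_straight (d j : ℕ) : (emit d j).Straight :=
  ⟨⟨trivial, trivial, trivial, Prog.Straight_unroll fun _ _ => trivial, trivial, trivial, trivial⟩,
    trivial, trivial, trivial⟩

theorem emit_keep (d j : ℕ) :
    (∀ x, x ≠ 8 ∧ x ≠ 9 → (emit d j).keepN x) ∧
    (∀ x, x ≠ 7 → (emit d j).keepR x) ∧
    (∀ x, x ≠ 12 + 2 * j ∧ x ≠ 13 + 2 * j → (emit d j).keepNA x) ∧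
    ∀ x, x ≠ 4 ∧ x ≠ 12 + 2 * j ∧ x ≠ 13 + 2 * j → (emit d j).keepRA x := by
  refine ⟨fun x hx => ?_, fun x hx => ?_, fun x hx => ?_, fun x hx => ?_⟩ <;>
    simp only [emit, appendPiece, finishPiece, Prog.keepN, Prog.keepR, Prog.keepNA, Prog.keepRA,
      true_and, and_true]
  · exact ⟨keepN_unroll fun _ => trivial, hx.2, hx.1⟩
  · exact ⟨keepR_unroll fun _ => trivial, hx⟩
  · exact ⟨hx.1, keepNA_unroll fun _ => trivial, hx.2⟩
  · exact ⟨⟨hx.2.2, keepRA_unroll fun _ => hx.2.2⟩, hx.2.1, hx.1⟩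

theorem emit_onRow (d j : ℕ) : (emit d j).onRow 2 := by
  simp only [emit, appendPiece, finishPiece, Prog.onRow, true_and]
  exact ⟨⟨onRow_unroll fun _ => rfl, by decide, by decide⟩, trivial⟩

theorem inner_keep (d j : ℕ) :
    (∀ x, x ≠ 3 ∧ x ≠ 5 ∧ x ≠ 6 ∧ x ≠ 8 ∧ x ≠ 9 → (inner d j).keepN x) ∧
    (∀ x, x ≠ 7 ∧ x ≠ 8 ∧ x ≠ 9 ∧ x ≠ 11 → (inner d j).keepR x) ∧
    (∀ x, x ≠ 12 + 2 * j ∧ x ≠ 13 + 2 * j → (inner d j).keepNA x) ∧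
    ∀ x, x ≠ 4 ∧ x ≠ 12 + 2 * j ∧ x ≠ 13 + 2 * j → (inner d j).keepRA x := by
  obtain ⟨c1, c2, c3, c4⟩ := choose_keep d
  obtain ⟨e1, e2, e3, e4⟩ := emit_keep d j
  refine ⟨fun x hx => ?_, fun x hx => ?_, fun x hx => ?_, fun x hx => ?_⟩ <;>
    simp only [inner, Prog.keepN, Prog.keepR, Prog.keepNA, Prog.keepRA,
      true_and, and_true]
  · exact ⟨hx.2.2.2.1, c1 x ⟨hx.1, hx.2.1, hx.2.2.1⟩, e1 x hx.2.2.2⟩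
  · exact ⟨⟨hx.2.2.1, hx.2.2.1⟩, hx.1, c2 x ⟨hx.2.1, hx.2.2.2⟩, e2 x hx.1⟩
  · exact ⟨c3 x, e3 x hx⟩
  · exact ⟨c4 x, e4 x hx⟩

theorem inner_onRow (d j : ℕ) : (inner d j).onRow 2 := by
  simp only [inner, Prog.onRow, true_and]
  exact ⟨by decide, choose_onRow d, emit_onRow d j⟩

end CTMG
end

/-! ### The envelope of one location between two events: correctness, termination and number of
pieces -/

noncomputable section

namespace CTMG

theorem emit_wp {d n r j : ℕ} (hd : 1 ≤ d) {s : Store} {sg e s0 : ℝ} {g : ℝ → ℝ}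
    {Good : ℝ → ℕ → Prop} {c0 : ℕ} {W : ℕ → ℕ → ℝ} {cl : ℕ → ℝ} {eff : ℕ → ℕ}
    (hW : s.realArr 5 (s.nat 2) = W)
    (hcl : s.realArr (11 + 2 * j) (s.nat 2) (s.natArr 5 (s.nat 2) 0 0) = cl)
    (hL : Local d n r W cl eff sg g Good s0 e) (hs : s0 ≤ s.real 7)
    (hP : Progress d n r W cl eff sg g Good s0 c0 (s.real 7) (s.realArr 4 (s.nat 2) 0 0)
      (s.nat 8) (s.nat 9) (tab (j + 1) s (s.nat 2)))
    (hC : Chosen d n W eff sg (s.real 7) e n (s.nat 5) (s.real 8)) :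
    (emit d j).wp (fun s' => s'.real 7 = s.real 8 ∧
      Progress d n r W cl eff sg g Good s0 c0 (s.real 8) (s'.realArr 4 (s.nat 2) 0 0)
        (s'.nat 8) (s'.nat 9) (tab (j + 1) s' (s.nat 2)) ∧
      (tab (j + 1) s' (s.nat 2)).cnt ≤ (tab (j + 1) s (s.nat 2)).cnt + 1) s := by
  have hdiff : (differE d).eval s = ∑ i ∈ Finset.range (d + 1),
      (W (s.nat 5) i - W (s.nat 9) i) * (W (s.nat 5) i - W (s.nat 9) i) := by
    simp only [differE, RExpr.eval_sumTo, RExpr.eval, wE, NExpr.eval, ← hW]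
  have hcond : (BExpr.and (.natLt (.lit 0) (.var 8)) (.not (.realLt (.lit 0) (differE d)))).Holds s ↔
      0 < s.nat 8 ∧ ¬ 0 < ∑ i ∈ Finset.range (d + 1),
        (W (s.nat 5) i - W (s.nat 9) i) * (W (s.nat 5) i - W (s.nat 9) i) := by
    simp only [BExpr.Holds, NExpr.eval, RExpr.eval, hdiff, Rat.cast_zero]
  simp only [emit, Prog.wp]
  rw [hcond]
  constructor
  · rintro ⟨hfl, hle⟩
    have hsame : ∀ i ≤ d, W (s.nat 5) i = W (s.nat 9) i := by
      intro i hi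
      have h0 := (Finset.sum_eq_zero_iff_of_nonneg (fun i _ => mul_self_nonneg _)).1
        (le_antisymm (not_lt.1 hle) (Finset.sum_nonneg fun i _ => mul_self_nonneg _)) i
        (Finset.mem_range.2 (by omega))
      exact sub_eq_zero.1 (mul_self_eq_zero.1 h0)
    refine Prog.wp_mono (finishPiece_wp (d := d) (j := j) (s := s)) ?_
    rintro s' ⟨h8, h1, h2, h3, h4, h5, h6, h7⟩
    rw [hW, hcl] at h2
    refine ⟨h1, ?_, h3.le.trans (by omega)⟩
    rw [h2, h8]
    exact hP.extend hL hs hC hfl.ne' hsame h3 h4 h5 h6 h7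
  · intro hcon
    have hnew : s.nat 8 = 0 ∨ ∃ i ≤ d, W (s.nat 5) i ≠ W (s.nat 9) i := by
      by_contra! hc
      refine hcon ⟨by omega, ?_⟩
      rw [Finset.sum_eq_zero]
      · exact lt_irrefl _
      · intro i hi
        rw [hc.2 i (by simpa [Nat.lt_succ_iff] using hi), sub_self, zero_mul]
    refine Prog.wp_mono (appendPiece_wp (d := d) (j := j) (s := s)) ?_
    rintro s' ⟨a1, a2, a3, a4, a5, a6, a7, a8, a9, b1, b2, b3, b4, b5, b6⟩
    refine Prog.wp_mono (finishPiece_wp (d := d) (j := j) (s := s')) ?_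
    rintro s'' ⟨h8, h1, h2, h3, h4, h5, h6, h7⟩
    rw [a1] at h2 h3 h4 h5 h6 h7
    rw [a2, a3, a7, a8, a9, a6, hW, hcl] at h2
    rw [a3] at h1 h5
    rw [hW, hcl] at b5
    refine ⟨h1, ?_, (h3.trans b1).le⟩
    rw [h2, h8, a4, a5]
    refine hP.append hd hL hs hC hnew (h3.trans b1) ?_ ?_ ?_ ?_ ?_ ?_
    · intro q hq
      rw [h4 q (by omega), b2]
    · rw [← b1, h5]
    · intro q hq
      rw [h6, b3 q hq]
    · intro q hq
      rw [h7, b4 q hq]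
    · intro i hi
      rw [h6, b5 i hi]
    · rw [h7, b6]

/-- The sign that turns the optimization in the current location into a maximization. -/
def signAt (s : Store) (l : ℕ) : ℝ := if 0 < s.natArr 0 l 0 0 then 1 else -1

/-- Each iteration ends at the next event or at a crossing of two actions, and the crossings to the
right of the current time become fewer. So there are at most `1 + r n²` iterations of cost `O(n)`,
each of which adds at most one piece. -/
theorem inner_runs {d : ℕ} (hd : 1 ≤ d) (j : ℕ) : ∃ K, ∀ (s : Store) (r : ℕ) (g : ℝ → ℝ)
    (Good : ℝ → ℕ → Prop), 0 < s.nat 1 → 0 ≤ s.real 5 → s.real 5 ≤ s.real 6 →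
    Local d (s.nat 1) r (s.realArr 5 (s.nat 2))
      (s.realArr (11 + 2 * j) (s.nat 2) (s.natArr 5 (s.nat 2) 0 0))
      (fun b => s.natArr 4 (s.nat 2) b 0) (signAt s (s.nat 2)) g Good (s.real 5) (s.real 6) →
    TabOK d (r + 1) g Good (s.real 5) (tab (j + 1) s (s.nat 2)) →
    s.realArr 4 (s.nat 2) 0 0 = g (s.real 5) →
    Runs (inner d j) s (K * (s.nat 1 + 1) * (r * s.nat 1 ^ 2 + 2)) (fun s' =>
      TabOK d (r + 1) g Good (s.real 6) (tab (j + 1) s' (s.nat 2)) ∧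
      s'.realArr 4 (s.nat 2) 0 0 = g (s.real 6) ∧
      (tab (j + 1) s' (s.nat 2)).cnt ≤ (tab (j + 1) s (s.nat 2)).cnt + (1 + r * s.nat 1 ^ 2) ∧
      (r ≤ 1 → (tab (j + 1) s' (s.nat 2)).cnt ≤ (tab (j + 1) s (s.nat 2)).cnt + s.nat 1)) := by
  obtain ⟨K, hK⟩ := choose_runs d
  refine ⟨K + (emit d j).bound + 20, fun s r g Good hn h0 hse hL hT hV => ?_⟩
  set l := s.nat 2 with hl
  set n := s.nat 1 with hn'
  set W := s.realArr 5 l with hW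
  set cl := s.realArr (11 + 2 * j) l (s.natArr 5 l 0 0) with hcl
  set eff : ℕ → ℕ := fun b => s.natArr 4 l b 0 with heff
  set sg := signAt s l with hsg
  set c0 := (tab (j + 1) s l).cnt with hc0
  obtain ⟨kn, kr, kna, kra⟩ := inner_keep d j
  obtain ⟨ckn, ckr, ckna, ckra⟩ := choose_keep d
  obtain ⟨ekn, ekr, ekna, ekra⟩ := emit_keep d j
  set S := crossings d n (fun b => W (eff b)) with hS
  have hScard : S.card ≤ r * n ^ 2 :=
    card_crossings_le fun b hb i h1 h2 => hL.degW _ ⟨b, hb, rfl⟩ i h1 h2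
  -- One iteration for each possible crossing and one for the final stretch up to the event.
  set K0 := 1 + r * n ^ 2 with hK0
  have hfix : ∀ s', Frame (inner d j) s s' → s'.nat 1 = n ∧ s'.nat 2 = l ∧ s'.real 5 = s.real 5 ∧
      s'.real 6 = s.real 6 ∧ s'.realArr 5 = s.realArr 5 ∧ s'.natArr 5 = s.natArr 5 ∧
      s'.natArr 4 = s.natArr 4 ∧ s'.realArr (11 + 2 * j) = s.realArr (11 + 2 * j) := fun s' hF =>
    ⟨hF.nat 1 (kn 1 (by omega)), hF.nat 2 (kn 2 (by omega)), hF.real 5 (kr 5 (by omega)),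
      hF.real 6 (kr 6 (by omega)), hF.realArr 5 (kra 5 (by omega)),
      hF.natArr 5 (kna 5 (by omega)), hF.natArr 4 (kna 4 (by omega)),
      hF.realArr _ (kra _ (by omega))⟩
  set Inv : ℕ → Store → Prop := fun k s' => Frame (inner d j) s s' ∧ s'.real 9 = sg ∧
    s.real 5 ≤ s'.real 7 ∧ s'.real 7 ≤ s.real 6 ∧
    Progress d n r W cl eff sg g Good (s.real 5) c0 (s'.real 7) (s'.realArr 4 l 0 0) (s'.nat 8)
      (s'.nat 9) (tab (j + 1) s' l) ∧ (tab (j + 1) s' l).cnt + k ≤ c0 + K0 ∧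
    (s'.real 7 < s.real 6 → (S.filter fun ρ => s'.real 7 < ρ).card + 1 ≤ k) with hInv
  have hloop := Runs.loop (b := .realLt (.var 7) (.var 6)) (p := .seq (choose d) (emit d j))
    (c := K * (n + 1) + (emit d j).bound) Inv (by
      rintro k s' ⟨hF, h9, h57, h76, hP, hcnt, hk⟩ hb
      obtain ⟨f1, f2, f3, f4, f5, f6, f7, f8⟩ := hfix s' hF
      have hlt : s'.real 7 < s.real 6 := by
        have := hb
        simp only [BExpr.Holds, RExpr.eval, f4] at this
        exact this
      have hk1 := hk hlt
      refine ⟨k - 1, by omega, ?_⟩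
      have hch := hK s' (by omega) (by linarith) (by rw [f4]; exact hlt)
      rw [f1] at hch
      refine hch.frame.seq ?_
      rintro s'' ⟨hC, hF'⟩
      rw [f2, f4, f5, f7, h9] at hC
      have g2 : s''.nat 2 = l := by rw [hF'.nat 2 (ckn 2 (by omega)), f2]
      have g8 : s''.nat 8 = s'.nat 8 := hF'.nat 8 (ckn 8 (by omega))
      have g9 : s''.nat 9 = s'.nat 9 := hF'.nat 9 (ckn 9 (by omega))
      have r7 : s''.real 7 = s'.real 7 := hF'.real 7 (ckr 7 (by omega))
      have r9 : s''.real 9 = s'.real 9 := hF'.real 9 (ckr 9 (by omega))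
      have gna : s''.natArr = s'.natArr := funext fun x => hF'.natArr x (ckna x)
      have gra : s''.realArr = s'.realArr := funext fun x => hF'.realArr x (ckra x)
      have htab : tab (j + 1) s'' l = tab (j + 1) s' l := by simp only [tab, gna, gra]
      have hem := emit_wp (d := d) (n := n) (r := r) (j := j) hd (s := s'') (sg := sg)
        (e := s.real 6) (s0 := s.real 5) (g := g) (Good := Good) (c0 := c0) (W := W) (cl := cl)
        (eff := eff) (by rw [gra, g2, f5]) (by rw [gra, gna, g2, f6, f8]) hL (by rwa [r7])
        (by rw [r7, gra, g2, g8, g9, htab]; exact hP) (by rw [r7]; exact hC)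
      refine (Runs.straight (emit_straight d j) hem).frame.weaken ?_
      rintro s3 ⟨⟨m1, m2, m3⟩, hF''⟩
      rw [g2, htab] at m3
      rw [g2] at m2
      refine ⟨hF.trans ((hF'.of_imp ?_ ?_ ?_ ?_).trans (hF''.of_imp ?_ ?_ ?_ ?_)), ?_, ?_, ?_, ?_, ?_,
        ?_⟩
      · exact fun x hx => hx.2.2.2.1
      · exact fun x hx => hx.2.2.2.1
      · exact fun x hx => hx.2.2.2.1
      · exact fun x hx => hx.2.2.2.1
      · exact fun x hx => hx.2.2.2.2
      · exact fun x hx => hx.2.2.2.2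
      · exact fun x hx => hx.2.2.2.2
      · exact fun x hx => hx.2.2.2.2
      · rw [hF''.real 9 (ekr 9 (by omega)), r9, h9]
      · rw [m1]
        exact h57.trans hC.lt.le
      · rw [m1]
        exact hC.le
      · rw [m1]
        exact m2
      · omega
      · rw [m1]
        intro hlt'
        have hmem : s''.real 8 ∈ S := hC.crossing.resolve_left hlt'.ne
        -- The crossing that was just reached no longer lies to the right of the current time, so
        -- one unit of fuel is consumed.
        have : (S.filter fun ρ => s''.real 8 < ρ).card < (S.filter fun ρ => s'.real 7 < ρ).card := by
          refine Finset.card_lt_card (Finset.ssubset_iff_of_subset ?_ |>.2 ⟨s''.real 8, ?_, ?_⟩)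
          · intro ρ hρ
            simp only [Finset.mem_filter] at hρ ⊢
            exact ⟨hρ.1, hC.lt.trans hρ.2⟩
          · exact Finset.mem_filter.2 ⟨hmem, hC.lt⟩
          · simp
        omega)
  set pre : Prog d := .branch (.natLt (.lit 0) (.get 0 (.var 2) (.lit 0) (.lit 0)))
    (.setReal 9 (.lit 1)) (.setReal 9 (.lit (-1))) with hpre
  have hp1 : Runs pre s pre.bound (fun s' => s' = s.setReal 9 sg) := by
    refine Runs.straight (by rw [hpre]; exact ⟨trivial, trivial⟩) ?_
    simp only [hpre, Prog.wp, BExpr.Holds, NExpr.eval, RExpr.eval, hsg, signAt, ← hl]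
    constructor
    · intro h
      rw [if_pos h]
      norm_num
    · intro h
      rw [if_neg h]
      norm_num
  have hb : pre.bound = 11 := rfl
  rw [hb] at hp1
  set s1 := s.setReal 9 sg with hs1
  set s2 := s1.setReal 7 (s.real 5) with hs2
  set s3 := s2.setNat 8 0 with hs3
  have hp2 : Runs (d := d) (.setReal 7 (.var 5)) s1 2 (fun s' => s' = s2) :=
    ⟨_, _, .setReal _ _ _, by simp [RExpr.cost], by simp [RExpr.eval, hs1, hs2, Store.setReal]⟩
  have hp3 : Runs (d := d) (.setNat 8 (.lit 0)) s2 2 (fun s' => s' = s3) :=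
    ⟨_, _, .setNat _ _ _, by simp [NExpr.cost], rfl⟩
  have hF3 : Frame (inner d j) s s3 := by
    refine ⟨fun x hx => ?_, fun x hx => ?_, fun _ _ => rfl, fun _ _ => rfl⟩
    · have : x ≠ 8 := hx.2.2.1
      simp [hs3, hs2, hs1, Store.setNat, Store.setReal, this]
    · have h1 : x ≠ 9 := hx.1.1
      have h2 : x ≠ 7 := hx.2.1
      simp [hs3, hs2, hs1, Store.setNat, Store.setReal, h1, h2]
  have htab3 : tab (j + 1) s3 l = tab (j + 1) s l := rfl
  have hI : Inv K0 s3 := by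
    have e7 : s3.real 7 = s.real 5 := by simp [hs3, hs2, hs1, Store.setNat, Store.setReal]
    have e8 : s3.nat 8 = 0 := by simp [hs3, hs2, hs1, Store.setNat, Store.setReal]
    have e9 : s3.real 9 = sg := by simp [hs3, hs2, hs1, Store.setNat, Store.setReal]
    refine ⟨hF3, e9, e7.ge, by rw [e7]; exact hse, ?_, ?_, ?_⟩
    · rw [e7, e8, htab3]
      exact ⟨hT, hV, fun _ => ⟨rfl, rfl⟩, fun h => (h rfl).elim, fun h => (h rfl).elim,
        fun h => (h rfl).elim, fun h => (h rfl).elim, fun h => (h rfl).elim⟩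
    · rw [htab3]
    · intro _
      have := Finset.card_filter_le S fun ρ => s3.real 7 < ρ
      omega
  refine (hp1.seq_eq (hp2.seq_eq (hp3.seq_eq (hloop K0 s3 hI)))).mono ?_ ?_
  · rw [hK0]
    simp only [BExpr.cost, RExpr.cost]
    nlinarith [Nat.zero_le ((emit d j).bound * n), Nat.zero_le ((emit d j).bound * n * (r * n ^ 2)),
      Nat.zero_le (r * n ^ 2 * n), Nat.zero_le (r * n ^ 2)]
  · rintro s' ⟨hnb, k, hF, h9, h57, h76, hP, hcnt, hk⟩
    obtain ⟨f1, f2, f3, f4, f5, f6, f7, f8⟩ := hfix s' hF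
    have he : s'.real 7 = s.real 6 := by
      refine le_antisymm h76 ?_
      simpa only [BExpr.Holds, RExpr.eval, f4, not_lt] using hnb
    rw [he] at hP
    refine ⟨hP.ok, hP.val, by omega, fun hr => ?_⟩
    by_cases hfl : s'.nat 8 = 0
    · rw [(hP.first hfl).2]
      omega
    · have h1 := (hP.affine hfl hr).1
      have h2 := Finset.card_filter_le (Finset.range n)
        fun b => sg * W (eff b) 1 ≤ sg * W (s'.nat 9) 1
      rw [Finset.card_range] at h2
      omega

end CTMG
end

noncomputable section

namespace CTMG

/-! ### The sweep over one interval that computes the next level -/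

/-- Coefficient `i` of the current piece (plus `o`) of location `7`. -/
def pieceE (d j i : ℕ) (o : ℕ) : RExpr d :=
  .get (11 + 2 * j) (.var 7) (.add (.get 5 (.var 7) (.lit 0) (.lit 0)) (.lit o)) (.lit i)

/-- Replaces the contribution of location `7` to one coefficient of the polynomial of an action by
adding the difference of the next and the current piece. -/
def updateW (d j i : ℕ) : Prog d :=
  .putReal 5 (.var 2) (.var 3) (.lit i) (.add (wE d (.var 3) i)
    (.mul (.get 0 (.var 2) (.var 3) (.var 7)) (.sub (pieceE d j i 1) (pieceE d j i 0))))

/-- Passes to the next piece of location `7`. -/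
def advance (d j : ℕ) : Prog d :=
  .seq (.forN 2 (.var 0) (.forN 3 (.var 1) (.unroll (updateW d j) (d + 1))))
    (.putNat 5 (.var 7) (.lit 0) (.lit 0) (.add (.get 5 (.var 7) (.lit 0) (.lit 0)) (.lit 1)))

def endE (d j : ℕ) : RExpr d :=
  .get (10 + 2 * j) (.var 4) (.get 5 (.var 4) (.lit 0) (.lit 0)) (.lit 0)

/-- Finds the time `6` of the next event and its location `7`. -/
def findNext (d j : ℕ) : Prog d :=
  .seq (.setReal 6 (.var 4)) (.seq (.setNat 7 (.var 0))
    (.forN 4 (.var 0) (.branch (.realLt (endE d j) (.var 6))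
      (.seq (.setReal 6 (endE d j)) (.setNat 7 (.var 4))) .nop)))

/-- Events at the same time are handled one after the other; the intervals between them have length
zero and produce no pieces. -/
def sweepStep (d j : ℕ) : Prog d :=
  .seq (findNext d j) (.seq (.forN 2 (.var 0) (inner d j)) (.seq (.setReal 5 (.var 6))
    (.branch (.natLt (.var 7) (.var 0)) (advance d j) .nop)))

/-- Besides an empty table this creates a fictitious piece `0` with zero coefficients. With all
pointers at piece `0` the zero polynomials are correct, so the first real pieces can be loaded by
`advance` itself. -/
def clearRow (d j : ℕ) : Prog d :=
  .seq (.seq (.putReal 4 (.var 2) (.lit 0) (.lit 0) (.get 3 (.var 2) (.lit 0) (.lit 0)))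
    (.seq (.putNat 5 (.var 2) (.lit 0) (.lit 0) (.lit 0))
    (.seq (.putNat (12 + 2 * j) (.var 2) (.lit 0) (.lit 0) (.lit 0))
    (.seq (.putReal (12 + 2 * j) (.var 2) (.lit 0) (.lit 0) (.lit 0))
    (.unroll (fun i => .putReal (13 + 2 * j) (.var 2) (.lit 0) (.lit i) (.lit 0)) (d + 1))))))
    (.forN 3 (.var 1) (.unroll (fun i => .putReal 5 (.var 2) (.var 3) (.lit i) (.lit 0)) (d + 1)))

/-- Computes the table of level `j + 1` from the table of level `j`. -/
def level (d j : ℕ) : Prog d :=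
  .seq (.forN 2 (.var 0) (clearRow d j)) (.seq (.forN 7 (.var 0) (advance d j))
    (.seq (.setReal 5 (.lit 0)) (.loop (.realLt (.var 5) (.var 4)) (sweepStep d j))))

/-- The data that is not changed while level `j + 1` is computed. -/
structure Fixed (j : ℕ) (s s' : Store) : Prop where
  n0 : s'.nat 0 = s.nat 0
  n1 : s'.nat 1 = s.nat 1
  r4 : s'.real 4 = s.real 4
  a0 : s'.realArr 0 = s.realArr 0
  a3 : s'.realArr 3 = s.realArr 3
  ae : s'.realArr (10 + 2 * j) = s.realArr (10 + 2 * j)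
  ac : s'.realArr (11 + 2 * j) = s.realArr (11 + 2 * j)
  b0 : s'.natArr 0 = s.natArr 0
  b4 : s'.natArr 4 = s.natArr 4
  bn : s'.natArr (10 + 2 * j) = s.natArr (10 + 2 * j)
  ba : s'.natArr (11 + 2 * j) = s.natArr (11 + 2 * j)

theorem Fixed.trans {j : ℕ} {s s' s'' : Store} (h : Fixed j s s') (h' : Fixed j s' s'') :
    Fixed j s s'' :=
  ⟨h'.n0.trans h.n0, h'.n1.trans h.n1, h'.r4.trans h.r4, h'.a0.trans h.a0, h'.a3.trans h.a3,
    h'.ae.trans h.ae, h'.ac.trans h.ac, h'.b0.trans h.b0, h'.b4.trans h.b4, h'.bn.trans h.bn,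
    h'.ba.trans h.ba⟩

variable {d : ℕ}

/-- Sufficient conditions for `p` to leave the data of level `j` unchanged. -/
structure Prog.Fixes (j : ℕ) (p : Prog d) : Prop where
  n0 : p.keepN 0
  n1 : p.keepN 1
  r4 : p.keepR 4
  a0 : p.keepRA 0
  a3 : p.keepRA 3
  ae : p.keepRA (10 + 2 * j)
  ac : p.keepRA (11 + 2 * j)
  b0 : p.keepNA 0
  b4 : p.keepNA 4
  bn : p.keepNA (10 + 2 * j)
  ba : p.keepNA (11 + 2 * j)

theorem Prog.Fixes.fixed {j : ℕ} {p : Prog d} (h : p.Fixes j) {s s' : Store} (hF : Frame p s s') :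
    Fixed j s s' :=
  ⟨hF.nat _ h.n0, hF.nat _ h.n1, hF.real _ h.r4, hF.realArr _ h.a0, hF.realArr _ h.a3,
    hF.realArr _ h.ae, hF.realArr _ h.ac, hF.natArr _ h.b0, hF.natArr _ h.b4, hF.natArr _ h.bn,
    hF.natArr _ h.ba⟩

/-- The polynomials of the actions belong to the current pieces. -/
def WOK (d j : ℕ) (s : Store) : Prop :=
  ∀ l < s.nat 0, ∀ a < s.nat 1, ∀ i ≤ d, s.realArr 5 l a i =
    ∑ l' ∈ Finset.range (s.nat 0),
      s.realArr 0 l a l' * s.realArr (11 + 2 * j) l' (s.natArr 5 l' 0 0) i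

theorem advance_keep (d j : ℕ) :
    (∀ x, x ≠ 2 ∧ x ≠ 3 → (advance d j).keepN x) ∧ (∀ x, (advance d j).keepR x) ∧
    (∀ x, x ≠ 5 → (advance d j).keepNA x) ∧ ∀ x, x ≠ 5 → (advance d j).keepRA x := by
  refine ⟨fun x hx => ?_, fun x => ?_, fun x hx => ?_, fun x hx => ?_⟩ <;>
    simp only [advance, Prog.keepN, Prog.keepR, Prog.keepNA, Prog.keepRA, Prog.keepN_forN,
      Prog.keepR_forN, Prog.keepNA_forN, Prog.keepRA_forN, and_true]
  · exact ⟨hx.1, hx.2, keepN_unroll fun _ => trivial⟩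
  · exact keepR_unroll fun _ => trivial
  · exact ⟨keepNA_unroll fun _ => trivial, hx⟩
  · exact keepRA_unroll fun _ => hx

/-- The polynomial of an action is a weighted sum over the successor locations. Moving the pointer
of one location changes one summand, so updating all actions of all locations costs `O(m n)` instead
of `O(m² n)`. -/
theorem advance_runs (d j : ℕ) : ∃ K, ∀ s : Store, s.nat 7 < s.nat 0 → WOK d j s →
    Runs (advance d j) s (K * (s.nat 0 + 1) * (s.nat 1 + 1)) (fun s' => WOK d j s' ∧
      s'.natArr 5 (s.nat 7) 0 0 = s.natArr 5 (s.nat 7) 0 0 + 1 ∧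
      ∀ l ≠ s.nat 7, s'.natArr 5 l 0 0 = s.natArr 5 l 0 0) := by
  set ul : Prog d := .unroll (updateW d j) (d + 1) with hul
  have kul : (∀ x, ul.keepN x) ∧ (∀ x, ul.keepR x) ∧ (∀ x, ul.keepNA x) ∧
      (∀ x, x ≠ 5 → ul.keepRA x) ∧ ul.onRow 2 :=
    ⟨fun x => keepN_unroll fun _ => trivial, fun x => keepR_unroll fun _ => trivial,
      fun x => keepNA_unroll fun _ => trivial, fun x hx => keepRA_unroll fun _ => hx,
      onRow_unroll fun _ => rfl⟩
  obtain ⟨k1, k2, k3, k4, k5⟩ := kul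
  refine ⟨ul.bound + 100, fun s hlt hW => ?_⟩
  set m := s.nat 0 with hm
  set n := s.nat 1 with hn
  set le := s.nat 7 with hle
  set p := s.natArr 5 le 0 0 with hp
  set F : ℕ → ℕ → ℕ → ℝ := fun l a i => s.realArr 5 l a i + s.realArr 0 l a le *
    (s.realArr (11 + 2 * j) le (p + 1) i - s.realArr (11 + 2 * j) le p i) with hF
  have hrows := Runs.forRows (d := d) (x := 2) (e := .var 0) (p := .forN 3 (.var 1) ul)
    (c := (ul.bound + 11) * (n + 1)) (N := m) (s := s)
    (by simp [k5]) (by simp [k1]) (fun s' h => h.nat 0 (by simp [k1]))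
    (fun l s' => ∀ a < n, ∀ i ≤ d, s'.realArr 5 l a i = F l a i)
    (fun i s₁ s₂ h h' => by rw [h.2 5]; exact h') (by
      intro l hl s1 hF1 hx1 hr1
      have e1 : s1.nat 1 = n := hF1.nat 1 (by simp [k1])
      have e7 : s1.nat 7 = le := hF1.nat 7 (by simp [k1])
      have e5 : s1.natArr 5 = s.natArr 5 := hF1.natArr 5 (by simp [k3])
      have e0 : s1.realArr 0 = s.realArr 0 := hF1.realArr 0 (by simp [k4])
      have ec : s1.realArr (11 + 2 * j) = s.realArr (11 + 2 * j) :=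
        hF1.realArr _ (by simpa using k4 _ (by omega))
      refine (Runs.forN (x := 3) (e := .var 1) (p := ul) (c := ul.bound) (N := n) (k1 3)
        (fun s' h => (h.nat 1 (by simp [k1])).trans e1)
        (fun a s' => (∀ a' < a, ∀ i ≤ d, s'.realArr 5 l a' i = F l a' i) ∧
          ∀ a' ≥ a, s'.realArr 5 l a' = s.realArr 5 l a') (fun _ _ _ h => h)
        ⟨by simp, fun a' _ => by rw [hr1.2 5]⟩ ?_).mono (by simp [NExpr.cost]) fun s' h => h.1.1
      rintro a ha s2 hF2 hx2 ⟨hI1, hI2⟩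
      have g2 : s2.nat 2 = l := (hF2.nat 2 (by simp [k1])).trans hx1
      have g7 : s2.nat 7 = le := (hF2.nat 7 (by simp [k1])).trans e7
      have g5 : s2.natArr 5 = s.natArr 5 := (hF2.natArr 5 (by simp [k3])).trans e5
      have g0 : s2.realArr 0 = s.realArr 0 := (hF2.realArr 0 (by simp [k4])).trans e0
      have gc : s2.realArr (11 + 2 * j) = s.realArr (11 + 2 * j) :=
        (hF2.realArr _ (by simpa using k4 _ (by omega))).trans ec
      refine Runs.straight (by rw [hul]; exact Prog.Straight_unroll fun _ _ => trivial) (Prog.wp_mono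
        (Prog.wp_unroll (f := updateW d j) (n := d + 1) (fun it s' => s'.nat = s2.nat ∧ s'.natArr = s2.natArr ∧
          (∀ arr ≠ 5, s'.realArr arr = s2.realArr arr) ∧
          (∀ a' ≠ a, s'.realArr 5 l a' = s2.realArr 5 l a') ∧
          (∀ i < it, s'.realArr 5 l a i = F l a i) ∧
          ∀ i ≥ it, s'.realArr 5 l a i = s.realArr 5 l a i) ?_ ?_) ?_)
      · exact ⟨rfl, rfl, fun _ _ => rfl, fun _ _ => rfl, by simp, fun i _ => by
          rw [hI2 a le_rfl]⟩
      · rintro it hit s3 ⟨a1, a2, a3, a4, a5, a6⟩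
        have hval : (RExpr.add (wE d (.var 3) it) (.mul (.get 0 (.var 2) (.var 3) (.var 7))
            (.sub (pieceE d j it 1) (pieceE d j it 0)))).eval s3 = F l a it := by
          simp only [RExpr.eval, wE, pieceE, NExpr.eval, a1, a2, a3 0 (by omega),
            a3 (11 + 2 * j) (by omega), g2, hx2, g7, g5, g0, gc, a6 it le_rfl, hF, add_zero]
          rw [← hp]
        simp only [updateW, Prog.wp]
        rw [hval]
        simp only [NExpr.eval, a1, g2, hx2]
        refine ⟨a1, a2, fun arr h => ?_, fun a' h => ?_, fun i h => ?_, fun i h => ?_⟩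
        · rw [← a3 arr h]
          funext x y z
          exact if_neg fun h' => h h'.1
        · rw [← a4 a' h]
          funext z
          exact if_neg fun h' => h h'.2.2.1
        · rcases Nat.lt_succ_iff_lt_or_eq.1 h with h' | rfl
          · rw [← a5 i h']
            exact if_neg fun h'' => by omega
          · exact if_pos ⟨rfl, rfl, rfl, rfl⟩
        · rw [← a6 i (by omega)]
          exact if_neg fun h'' => by omega
      · rintro s3 ⟨a1, a2, a3, a4, a5, a6⟩
        refine ⟨fun a' ha' i hi => ?_, fun a' ha' => ?_⟩
        · rcases Nat.lt_succ_iff_lt_or_eq.1 ha' with h' | rfl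
          · rw [a4 a' (by omega)]
            exact hI1 a' h' i hi
          · exact a5 i (by omega)
        · rw [a4 a' (by omega)]
          exact hI2 a' (by omega))
  have hput : ∀ (s' : Store) (Q : Store → Prop),
      Q (s'.putNat 5 (s'.nat 7) 0 0 (s'.natArr 5 (s'.nat 7) 0 0 + 1)) →
      Runs (d := d) (.putNat 5 (.var 7) (.lit 0) (.lit 0)
        (.add (.get 5 (.var 7) (.lit 0) (.lit 0)) (.lit 1))) s' 11 Q := fun s' Q h =>
    ⟨_, _, .putNat _ _ _ _ _ _, by simp [NExpr.cost], h⟩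
  refine (hrows.seq fun s1 h1 => hput s1 (fun s' => WOK d j s' ∧
      s'.natArr 5 le 0 0 = p + 1 ∧ ∀ l ≠ le, s'.natArr 5 l 0 0 = s.natArr 5 l 0 0) ?_).mono ?_
      fun _ h => h
  · obtain ⟨hrow, hF1⟩ := h1
    have e0 : s1.nat 0 = m := hF1.nat 0 (by simp [k1])
    have e1 : s1.nat 1 = n := hF1.nat 1 (by simp [k1])
    have e7 : s1.nat 7 = le := hF1.nat 7 (by simp [k1])
    have e5 : s1.natArr 5 = s.natArr 5 := hF1.natArr 5 (by simp [k3])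
    have er : s1.realArr 0 = s.realArr 0 := hF1.realArr 0 (by simp [k4])
    have ec : s1.realArr (11 + 2 * j) = s.realArr (11 + 2 * j) :=
      hF1.realArr _ (by simpa using k4 _ (by omega))
    have hptr : ∀ l, (s1.putNat 5 (s1.nat 7) 0 0 (s1.natArr 5 (s1.nat 7) 0 0 + 1)).natArr 5 l 0 0 =
        if l = le then p + 1 else s.natArr 5 l 0 0 := by
      intro l
      simp only [Store.putNat, e7, e5, true_and, and_true]
      rfl
    refine ⟨fun l hl a ha i hi => ?_, by rw [hptr, if_pos rfl], fun l hl => by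
      rw [hptr, if_neg hl]⟩
    simp only [hptr]
    simp only [Store.putNat, e0, e1] at hl ha ⊢
    rw [hrow l hl a ha i hi, er, ec]
    simp only [hF]
    symm
    -- The old and the new sum differ only in the summand of the location whose pointer moves.
    rw [hW l hl a ha i hi, ← sub_eq_iff_eq_add', ← Finset.sum_sub_distrib,
      Finset.sum_eq_single_of_mem le (Finset.mem_range.2 hlt)]
    · rw [if_pos rfl, ← mul_sub]
    · intro l' _ hl'
      rw [if_neg hl', sub_self]
  · have h1 := Nat.le_mul_of_pos_right (m + 1) (Nat.succ_pos n)
    simp only [NExpr.cost]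
    generalize ul.bound = c
    linarith

theorem findNext_keep (d j : ℕ) :
    (∀ x, x ≠ 4 ∧ x ≠ 7 → (findNext d j).keepN x) ∧ (∀ x, x ≠ 6 → (findNext d j).keepR x) ∧
    (∀ x, (findNext d j).keepNA x) ∧ ∀ x, (findNext d j).keepRA x := by
  refine ⟨fun x hx => ?_, fun x hx => ?_, fun x => ?_, fun x => ?_⟩ <;>
    simp only [findNext, Prog.keepN, Prog.keepR, Prog.keepNA, Prog.keepRA, Prog.keepN_forN,
      Prog.keepR_forN, Prog.keepNA_forN, Prog.keepRA_forN, true_and, and_true]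
  · exact ⟨hx.2, hx.1, hx.2⟩
  · exact ⟨hx, hx⟩

/-- The location number `m`, which does not exist, encodes that the next event is the end of the
interval. The search keeps a minimum, with the interval end as its start value. -/
theorem findNext_runs (d j : ℕ) (s : Store) :
    Runs (findNext d j) s (60 * (s.nat 0 + 1)) (fun s' =>
      s'.real 6 ≤ s.real 4 ∧
      (∀ l < s.nat 0, s'.real 6 ≤ s.realArr (10 + 2 * j) l (s.natArr 5 l 0 0) 0) ∧
      ((s'.real 6 = s.real 4 ∧ s'.nat 7 = s.nat 0) ∨ (s'.nat 7 < s.nat 0 ∧ s'.real 6 < s.real 4 ∧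
        s'.real 6 = s.realArr (10 + 2 * j) (s'.nat 7) (s.natArr 5 (s'.nat 7) 0 0) 0))) := by
  set E : ℕ → ℝ := fun l => s.realArr (10 + 2 * j) l (s.natArr 5 l 0 0) 0 with hE
  set m := s.nat 0 with hm
  set body : Prog d := .branch (.realLt (endE d j) (.var 6))
      (.seq (.setReal 6 (endE d j)) (.setNat 7 (.var 4))) .nop with hbody
  have hp1 : Runs (d := d) (.setReal 6 (.var 4)) s 2 (fun s' => s' = s.setReal 6 (s.real 4)) :=
    ⟨_, _, .setReal _ _ _, by simp [RExpr.cost], rfl⟩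
  set s1 := s.setReal 6 (s.real 4) with hs1
  have hp2 : Runs (d := d) (.setNat 7 (.var 0)) s1 2 (fun s' => s' = s1.setNat 7 m) :=
    ⟨_, _, .setNat _ _ _, by simp [NExpr.cost], rfl⟩
  set s2 := s1.setNat 7 m with hs2
  have kk : (∀ x, x ≠ 7 → body.keepN x) ∧ (∀ x, x ≠ 6 → body.keepR x) := by
    refine ⟨fun x hx => ?_, fun x hx => ?_⟩
    · exact ⟨⟨trivial, hx⟩, trivial⟩
    · exact ⟨⟨hx, trivial⟩, trivial⟩
  obtain ⟨k1, k2⟩ := kk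
  refine (hp1.seq_eq (hp2.seq_eq (Runs.forN (x := 4) (e := .var 0) (p := body) (c := body.bound)
    (N := m) (k1 4 (by omega)) (fun s' h => (h.nat 0 (by simpa using k1 0 (by omega))).trans ?_)
    (fun k s' => s'.real 6 ≤ s.real 4 ∧ (∀ l < k, s'.real 6 ≤ E l) ∧
      ((s'.real 6 = s.real 4 ∧ s'.nat 7 = m) ∨ (s'.nat 7 < m ∧ s'.real 6 < s.real 4 ∧
        s'.real 6 = E (s'.nat 7)))) ?_ ?_ ?_))).mono ?_ fun s' h => h.1
  · simp [hs2, hs1, Store.setNat, Store.setReal, hm]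
  · intro i s' v h
    simpa [Store.setNat] using h
  · simp [hs2, hs1, Store.setNat, Store.setReal]
  · rintro i hi s' hF hx ⟨h1, h2, h3⟩
    have e5 : s'.natArr 5 = s.natArr 5 := hF.natArr 5 (by simp [hbody, Prog.keepNA])
    have ee : s'.realArr (10 + 2 * j) = s.realArr (10 + 2 * j) :=
      hF.realArr _ (by simp [hbody, Prog.keepRA])
    refine Runs.straight (by rw [hbody]; exact ⟨⟨trivial, trivial⟩, trivial⟩) ?_
    have hv : (endE d j).eval s' = E i := by
      simp only [endE, RExpr.eval, NExpr.eval, e5, ee, hx, hE]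
    simp only [hbody, Prog.wp, BExpr.Holds, hv]
    simp only [RExpr.eval, NExpr.eval, Store.setReal, Store.setNat, hx, Function.update_self]
    refine ⟨fun hlt => ⟨hlt.le.trans h1, fun l hl => ?_, Or.inr ⟨hi, hlt.trans_le h1, trivial⟩⟩,
      fun hnlt => ⟨h1, fun l hl => ?_, h3⟩⟩
    · rcases Nat.lt_succ_iff_lt_or_eq.1 hl with h | rfl
      · exact hlt.le.trans (h2 l h)
      · exact le_rfl
    · rcases Nat.lt_succ_iff_lt_or_eq.1 hl with h | rfl
      · exact h2 l h
      · exact not_lt.1 hnlt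
  · have : body.bound = 21 := rfl
    rw [this]
    simp only [NExpr.cost]
    omega

theorem clearRow_keep (d j : ℕ) :
    (∀ x, x ≠ 3 → (clearRow d j).keepN x) ∧ (∀ x, (clearRow d j).keepR x) ∧
    (∀ x, x ≠ 5 ∧ x ≠ 12 + 2 * j → (clearRow d j).keepNA x) ∧
    (∀ x, x ≠ 4 ∧ x ≠ 5 ∧ x ≠ 12 + 2 * j ∧ x ≠ 13 + 2 * j → (clearRow d j).keepRA x) ∧
    (clearRow d j).onRow 2 := by
  refine ⟨fun x hx => ?_, fun x => ?_, fun x hx => ?_, fun x hx => ?_, ?_⟩ <;>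
    simp only [clearRow, Prog.keepN, Prog.keepR, Prog.keepNA, Prog.keepRA, Prog.onRow,
      Prog.keepN_forN, Prog.keepR_forN, Prog.keepNA_forN, Prog.keepRA_forN, Prog.onRow_forN,
      true_and]
  · exact ⟨keepN_unroll fun _ => trivial, hx, keepN_unroll fun _ => trivial⟩
  · exact ⟨keepR_unroll fun _ => trivial, keepR_unroll fun _ => trivial⟩
  · exact ⟨⟨hx.1, hx.2, keepNA_unroll fun _ => trivial⟩, keepNA_unroll fun _ => trivial⟩
  · exact ⟨⟨hx.1, hx.2.2.1, keepRA_unroll fun _ => hx.2.2.2⟩, keepRA_unroll fun _ => hx.2.1⟩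
  · exact ⟨onRow_unroll fun _ => rfl, by decide, onRow_unroll fun _ => rfl⟩

/-- The state of row `l` before the sweep. -/
structure Cleared (d j n : ℕ) (x : ℝ) (l : ℕ) (s : Store) : Prop where
  val : s.realArr 4 l 0 0 = x
  ptr : s.natArr 5 l 0 0 = 0
  cnt : (tab (j + 1) s l).cnt = 0
  fin : (tab (j + 1) s l).fin 0 = 0
  coef : ∀ i ≤ d, (tab (j + 1) s l).coef 0 i = 0
  poly : ∀ a < n, ∀ i ≤ d, s.realArr 5 l a i = 0

theorem clearRow_runs (d j : ℕ) : ∃ K, ∀ s : Store, Runs (clearRow d j) s (K * (s.nat 1 + 1))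
    (Cleared d j (s.nat 1) (s.realArr 3 (s.nat 2) 0 0) (s.nat 2)) := by
  set u1 : Prog d := .unroll (fun i => .putReal (13 + 2 * j) (.var 2) (.lit 0) (.lit i) (.lit 0))
    (d + 1) with hu1
  set u2 : Prog d := .unroll (fun i => .putReal 5 (.var 2) (.var 3) (.lit i) (.lit 0)) (d + 1)
    with hu2
  set pre : Prog d := (.seq (.putReal 4 (.var 2) (.lit 0) (.lit 0) (.get 3 (.var 2) (.lit 0) (.lit 0)))
    (.seq (.putNat 5 (.var 2) (.lit 0) (.lit 0) (.lit 0))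
    (.seq (.putNat (12 + 2 * j) (.var 2) (.lit 0) (.lit 0) (.lit 0))
    (.seq (.putReal (12 + 2 * j) (.var 2) (.lit 0) (.lit 0) (.lit 0)) u1)))) with hpre
  refine ⟨pre.bound + u2.bound + 20, fun s => ?_⟩
  set l := s.nat 2 with hl
  set n := s.nat 1 with hn
  have hs : pre.Straight :=
    ⟨trivial, trivial, trivial, trivial, Prog.Straight_unroll fun _ _ => trivial⟩
  have h1 : pre.wp (fun s' => s'.nat = s.nat ∧ Cleared d j 0 (s.realArr 3 l 0 0) l s') s := by
    simp only [hpre, Prog.wp, NExpr.eval, RExpr.eval, ← hl]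
    set s1 := (((s.putReal 4 l 0 0 (s.realArr 3 l 0 0)).putNat 5 l 0 0 0).putNat (12 + 2 * j) l 0 0
      0).putReal (12 + 2 * j) l 0 0 ((0 : ℚ) : ℝ) with hs1
    have r1 : ∀ arr i q k, s1.realArr arr i q k =
      if arr = 12 + 2 * j ∧ i = l ∧ q = 0 ∧ k = 0 then ((0 : ℚ) : ℝ) else
      if arr = 4 ∧ i = l ∧ q = 0 ∧ k = 0 then s.realArr 3 l 0 0 else s.realArr arr i q k :=
      fun _ _ _ _ => rfl
    have r2 : ∀ arr i q k, s1.natArr arr i q k =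
      if arr = 12 + 2 * j ∧ i = l ∧ q = 0 ∧ k = 0 then 0 else
      if arr = 5 ∧ i = l ∧ q = 0 ∧ k = 0 then 0 else s.natArr arr i q k :=
      fun _ _ _ _ => rfl
    refine Prog.wp_mono (Prog.wp_unroll (fun it s' => s'.nat = s.nat ∧ s'.natArr = s1.natArr ∧
      (∀ arr ≠ 13 + 2 * j, s'.realArr arr = s1.realArr arr) ∧
      ∀ i < it, s'.realArr (13 + 2 * j) l 0 i = 0) ⟨rfl, rfl, fun _ _ => rfl, by simp⟩ ?_) ?_
    · rintro it hit s' ⟨a1, a2, a3, a4⟩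
      simp only [Prog.wp, NExpr.eval, RExpr.eval, a1, ← hl]
      refine ⟨a1, a2, fun arr h => ?_, fun i h => ?_⟩
      · rw [← a3 arr h]
        funext x y z
        exact if_neg fun h' => h h'.1
      · rcases Nat.lt_succ_iff_lt_or_eq.1 h with h' | rfl
        · rw [← a4 i h']
          exact if_neg fun h'' => by omega
        · refine (if_pos ⟨rfl, rfl, rfl, rfl⟩).trans (by simp)
    · rintro s' ⟨a1, a2, a3, a4⟩
      refine ⟨a1, ?_, ?_, ?_, ?_, fun i hi => ?_, by simp⟩
      · rw [a3 4 (by omega), r1, if_neg (by omega), if_pos ⟨rfl, rfl, rfl, rfl⟩]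
      · rw [a2, r2, if_neg (by omega), if_pos ⟨rfl, rfl, rfl, rfl⟩]
      · simp only [tab, a2, r2, show 10 + 2 * (j + 1) = 12 + 2 * j by ring]
        simp
      · simp only [tab, show 10 + 2 * (j + 1) = 12 + 2 * j by ring]
        rw [a3 _ (by omega), r1, if_pos ⟨rfl, rfl, rfl, rfl⟩]
        simp
      · simp only [tab, show 11 + 2 * (j + 1) = 13 + 2 * j by ring]
        exact a4 i (by omega)
  have k2 : (∀ x, u2.keepN x) ∧ (∀ x, u2.keepNA x) ∧ ∀ x, x ≠ 5 → u2.keepRA x :=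
    ⟨fun _ => keepN_unroll fun _ => trivial, fun _ => keepNA_unroll fun _ => trivial,
      fun x hx => keepRA_unroll fun _ => hx⟩
  refine ((Runs.straight hs h1).seq (c' := (u2.bound + 11) * (n + 1))
    (R := Cleared d j n (s.realArr 3 l 0 0) l) ?_).mono ?_ fun _ h => h
  swap
  · generalize pre.bound = c
    generalize u2.bound = c'
    nlinarith
  rintro s1 ⟨h1n, hC⟩
  refine (Runs.forN (x := 3) (e := .var 1) (p := u2)
    (c := u2.bound) (N := n) (k2.1 3) (fun s' hF => ?_)
    (fun a s' => ∀ a' < a, ∀ i ≤ d, s'.realArr 5 l a' i = 0) ?_ ?_ ?_).mono (by simp [NExpr.cost]) ?_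
  · exact (hF.nat 1 (by simp [k2.1])).trans (by rw [h1n])
  · exact fun _ _ _ h => h
  · simp
  · intro a ha s' hF hx hI
    have e2 : s'.nat 2 = l := (hF.nat 2 (by simp [k2.1])).trans (by rw [h1n])
    refine Runs.straight (by rw [hu2]; exact Prog.Straight_unroll fun _ _ => trivial)
      (Prog.wp_mono (Prog.wp_unroll (fun it s'' => s''.nat = s'.nat ∧
        (∀ a' ≠ a, s''.realArr 5 l a' = s'.realArr 5 l a') ∧
        ∀ i < it, s''.realArr 5 l a i = 0) ⟨rfl, fun _ _ => rfl, by simp⟩ ?_) ?_)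
    · rintro it hit s'' ⟨a1, a2, a3⟩
      simp only [Prog.wp, NExpr.eval, RExpr.eval, a1, e2, hx]
      refine ⟨a1, fun a' h => ?_, fun i h => ?_⟩
      · rw [← a2 a' h]
        funext z
        exact if_neg fun h' => h h'.2.2.1
      · rcases Nat.lt_succ_iff_lt_or_eq.1 h with h' | rfl
        · rw [← a3 i h']
          exact if_neg fun h'' => by omega
        · refine (if_pos ⟨rfl, rfl, rfl, rfl⟩).trans (by simp)
    · rintro s'' ⟨a1, a2, a3⟩ a' ha' i hi
      rcases Nat.lt_succ_iff_lt_or_eq.1 ha' with h' | rfl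
      · rw [a2 a' (by omega)]
        exact hI a' h' i hi
      · exact a3 i (by omega)
  · rintro s' ⟨hI, hF⟩
    have e5 : s'.natArr = s1.natArr := funext fun x => hF.natArr x (by simp [k2.2.1])
    have e4 : s'.realArr 4 = s1.realArr 4 := hF.realArr 4 (by simp [k2.2.2])
    have hr : ∀ x, x ≠ 5 → s'.realArr x = s1.realArr x := fun x hx =>
      hF.realArr x (by simpa using k2.2.2 x hx)
    have ht : tab (j + 1) s' l = tab (j + 1) s1 l := by
      simp only [tab, e5, hr (10 + 2 * (j + 1)) (by omega), hr (11 + 2 * (j + 1)) (by omega)]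
    exact ⟨by rw [e4]; exact hC.val, by rw [e5]; exact hC.ptr, by rw [ht]; exact hC.cnt,
      by rw [ht]; exact hC.fin, by rw [ht]; exact hC.coef, hI⟩

end CTMG
end

/-! ### The sweep over all events of a level: invariant, fuel and running time -/

noncomputable section

namespace CTMG

variable {d : ℕ}

/-- The number of intervals between the events of level `j`. -/
def pieces (j : ℕ) (s : Store) : ℕ := 1 + ∑ l ∈ Finset.range (s.nat 0), ((tab j s l).cnt - 1)

/-- The input of level `j + 1`: the tables represent `f`, and `g` is to be computed. -/
structure LevelPre (d r j : ℕ) (s : Store) (f g : ℕ → ℝ → ℝ) (GoodA Good : ℕ → ℝ → ℕ → Prop) :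
    Prop where
  pos : 0 < s.nat 1
  len : 0 < s.real 4
  deg : r ≤ d
  input : ∀ l < s.nat 0, TabOK d r (f l) (GoodA l) (s.real 4) (tab j s l)
  eff : ∀ l < s.nat 0, ∀ b < s.nat 1, s.natArr 4 l b 0 < s.nat 1
  deriv : ∀ l < s.nat 0, ∃ h : ℝ → ℝ, (∀ u, HasDerivAt (g l) (h u) u) ∧
    ∀ u ∈ Set.Icc 0 (s.real 4), ∀ a, (∃ b < s.nat 1, a = s.natArr 4 l b 0) →
      (∀ b < s.nat 1,
        signAt s l * ∑ l' ∈ Finset.range (s.nat 0), s.realArr 0 l (s.natArr 4 l b 0) l' * f l' u ≤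
        signAt s l * ∑ l' ∈ Finset.range (s.nat 0), s.realArr 0 l a l' * f l' u) →
      Good l u a ∧
        h u = ∑ l' ∈ Finset.range (s.nat 0), s.realArr 0 l a l' * f l' u - f l u

/-- The state of the sweep with at most `k` events to come. -/
structure SweepInv (d r j : ℕ) (s : Store) (g : ℕ → ℝ → ℝ) (Good : ℕ → ℝ → ℕ → Prop) (k : ℕ)
    (s' : Store) : Prop where
  fixed : Fixed j s s'
  lo : 0 ≤ s'.real 5
  hi : s'.real 5 ≤ s.real 4
  ptr : ∀ l < s.nat 0, 1 ≤ s'.natArr 5 l 0 0 ∧ s'.natArr 5 l 0 0 ≤ (tab j s l).cnt ∧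
    (tab j s l).fin (s'.natArr 5 l 0 0 - 1) ≤ s'.real 5 ∧
    s'.real 5 ≤ (tab j s l).fin (s'.natArr 5 l 0 0)
  wok : WOK d j s'
  out : ∀ l < s.nat 0, TabOK d (r + 1) (g l) (Good l) (s'.real 5) (tab (j + 1) s' l) ∧
    s'.realArr 4 l 0 0 = g l (s'.real 5) ∧
    (tab (j + 1) s' l).cnt + k * (1 + r * s.nat 1 ^ 2) ≤ pieces j s * (1 + r * s.nat 1 ^ 2) ∧
    (r ≤ 1 → (tab (j + 1) s' l).cnt + k * s.nat 1 ≤ pieces j s * s.nat 1)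
  fuel : s'.real 5 < s.real 4 →
    ∑ l ∈ Finset.range (s.nat 0), ((tab j s l).cnt - s'.natArr 5 l 0 0) + 1 ≤ k

/-- Coefficientwise linear combination commutes with evaluation. -/
theorem WOK.value {j : ℕ} {s : Store} (h : WOK d j s) {l a : ℕ} (hl : l < s.nat 0)
    (ha : a < s.nat 1) {f : ℕ → ℝ → ℝ} {u : ℝ}
    (hf : ∀ l' < s.nat 0, f l' u = pv d (s.realArr (11 + 2 * j) l' (s.natArr 5 l' 0 0)) u) :
    pv d (s.realArr 5 l a) u = ∑ l' ∈ Finset.range (s.nat 0), s.realArr 0 l a l' * f l' u := by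
  rw [pv_congr (h l hl a ha), pv]
  simp only [Finset.sum_mul]
  rw [Finset.sum_comm]
  refine Finset.sum_congr rfl fun l' hl' => ?_
  rw [hf l' (Finset.mem_range.1 hl'), pv, Finset.mul_sum]
  exact Finset.sum_congr rfl fun i _ => by ring

/-- Up to the next event no pointer moves, so every level-`j` function equals the polynomial of its
current piece there. This turns the global description of the derivative into the polynomial one
that the envelope routine needs. -/
theorem LevelPre.local {r j : ℕ} {s s' : Store} {f g : ℕ → ℝ → ℝ} {GoodA Good : ℕ → ℝ → ℕ → Prop}
    (hp : LevelPre d r j s f g GoodA Good) {k : ℕ} (hI : SweepInv d r j s g Good k s') {e : ℝ}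
    (he : e ≤ s.real 4)
    (hE : ∀ l < s.nat 0, e ≤ (tab j s l).fin (s'.natArr 5 l 0 0)) {l : ℕ} (hl : l < s.nat 0) :
    Local d (s.nat 1) r (s'.realArr 5 l) (s'.realArr (11 + 2 * j) l (s'.natArr 5 l 0 0))
      (fun b => s.natArr 4 l b 0) (signAt s l) (g l) (Good l) (s'.real 5) e := by
  have hfx := hI.fixed
  have hcoef : ∀ l q, s'.realArr (11 + 2 * j) l q = (tab j s l).coef q := fun l q => by
    rw [hfx.ac]
    rfl
  have hf : ∀ u ∈ Set.Icc (s'.real 5) e, ∀ l' < s'.nat 0,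
      f l' u = pv d (s'.realArr (11 + 2 * j) l' (s'.natArr 5 l' 0 0)) u := by
    intro u hu l' hl'
    rw [hfx.n0] at hl'
    obtain ⟨p1, p2, p3, p4⟩ := hI.ptr l' hl'
    have := (hp.input l' hl').rep hp.deg (s'.natArr 5 l' 0 0 - 1) (by omega) u
    rw [Nat.sub_add_cancel p1] at this
    rw [this ⟨p3.trans hu.1, hu.2.trans (hE l' hl')⟩, hcoef]
  have hval : ∀ u ∈ Set.Icc (s'.real 5) e, ∀ b < s.nat 1,
      pv d (s'.realArr 5 l (s.natArr 4 l b 0)) u =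
      ∑ l' ∈ Finset.range (s.nat 0), s.realArr 0 l (s.natArr 4 l b 0) l' * f l' u := by
    intro u hu b hb
    rw [hI.wok.value (by rwa [hfx.n0]) (by rw [hfx.n1]; exact hp.eff l hl b hb) (hf u hu), hfx.n0,
      hfx.a0]
  have hdeg : ∀ l' < s.nat 0, ∀ i, r < i → i ≤ d →
      s'.realArr (11 + 2 * j) l' (s'.natArr 5 l' 0 0) i = 0 := by
    intro l' hl' i h1 h2
    obtain ⟨p1, p2, p3, p4⟩ := hI.ptr l' hl'
    have := (hp.input l' hl').deg (s'.natArr 5 l' 0 0 - 1) (by omega) i h1 h2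
    rw [Nat.sub_add_cancel p1] at this
    rw [hcoef, this]
  refine ⟨?_, ?_, hdeg l hl, ?_⟩
  · obtain ⟨h, h1, h2⟩ := hp.deriv l hl
    refine ⟨h, h1, fun u hu a ha hbest => ?_⟩
    obtain ⟨b, hb, rfl⟩ := ha
    rw [hval u hu b hb, ← hf u hu l (by rwa [hfx.n0])]
    refine h2 u ⟨hI.lo.trans hu.1, hu.2.trans he⟩ _ ⟨b, hb, rfl⟩ fun b' hb' => ?_
    have := hbest b' hb'
    rwa [hval u hu b' hb', hval u hu b hb] at this
  · rintro _ ⟨b, hb, rfl⟩ i h1 h2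
    rw [hI.wok l (by rwa [hfx.n0]) _ (by rw [hfx.n1]; exact hp.eff l hl b hb) i h2]
    refine Finset.sum_eq_zero fun l' hl' => ?_
    rw [hdeg l' (by rw [← hfx.n0]; exact Finset.mem_range.1 hl') i h1 h2, mul_zero]
  · unfold signAt
    split_ifs <;> norm_num

theorem findNext_fixes (d j : ℕ) : (findNext d j).Fixes j := by
  obtain ⟨k1, k2, k3, k4⟩ := findNext_keep d j
  exact ⟨k1 _ (by omega), k1 _ (by omega), k2 _ (by omega), k4 _, k4 _, k4 _, k4 _, k3 _, k3 _, k3 _,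
    k3 _⟩

theorem inner_fixes (d j : ℕ) : (inner d j).Fixes j := by
  obtain ⟨k1, k2, k3, k4⟩ := inner_keep d j
  constructor <;> first | exact k1 _ (by omega) | exact k2 _ (by omega) | exact k3 _ (by omega) |
    exact k4 _ (by omega)

theorem advance_fixes (d j : ℕ) : (advance d j).Fixes j := by
  obtain ⟨k1, k2, k3, k4⟩ := advance_keep d j
  constructor <;> first | exact k1 _ (by omega) | exact k2 _ | exact k3 _ (by omega) |
    exact k4 _ (by omega)

theorem clearRow_fixes (d j : ℕ) : (clearRow d j).Fixes j := by
  obtain ⟨k1, k2, k3, k4, -⟩ := clearRow_keep d j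
  constructor <;> first | exact k1 _ (by omega) | exact k2 _ | exact k3 _ (by omega) |
    exact k4 _ (by omega)

theorem Prog.Fixes.forN {j x : ℕ} {e : NExpr} {p : Prog d} (h : p.Fixes j) (h0 : x ≠ 0)
    (h1 : x ≠ 1) : (Prog.forN x e p).Fixes j := by
  constructor <;> simp only [Prog.keepN_forN, Prog.keepR_forN, Prog.keepNA_forN, Prog.keepRA_forN]
  · exact ⟨h0.symm, h.n0⟩
  · exact ⟨h1.symm, h.n1⟩
  · exact h.r4
  · exact h.a0
  · exact h.a3
  · exact h.ae
  · exact h.ac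
  · exact h.b0
  · exact h.b4
  · exact h.bn
  · exact h.ba

/-- The event lies strictly before the end of the interval, so the location has a further piece to
which its pointer can move. The number of pieces still ahead then drops by one. -/
theorem SweepInv.advance {r j k : ℕ} {s s1 s2 : Store} {f g : ℕ → ℝ → ℝ}
    {GoodA Good : ℕ → ℝ → ℕ → Prop} (hp : LevelPre d r j s f g GoodA Good)
    (hs : s1.real 5 < s.real 4)
    (hI : SweepInv d r j s g Good k s1) {le : ℕ} {e : ℝ} (hse : s1.real 5 ≤ e) (he : e < s.real 4)
    (hE : ∀ l < s.nat 0, e ≤ (tab j s l).fin (s1.natArr 5 l 0 0)) (hle : le < s.nat 0)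
    (hEle : e = (tab j s le).fin (s1.natArr 5 le 0 0)) (h5 : s2.real 5 = e)
    (hptr : s2.natArr 5 le 0 0 = s1.natArr 5 le 0 0 + 1)
    (hptr' : ∀ l ≠ le, s2.natArr 5 l 0 0 = s1.natArr 5 l 0 0) :
    (∀ l < s.nat 0, 1 ≤ s2.natArr 5 l 0 0 ∧ s2.natArr 5 l 0 0 ≤ (tab j s l).cnt ∧
      (tab j s l).fin (s2.natArr 5 l 0 0 - 1) ≤ s2.real 5 ∧
      s2.real 5 ≤ (tab j s l).fin (s2.natArr 5 l 0 0)) ∧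
    (∑ l ∈ Finset.range (s.nat 0), ((tab j s l).cnt - s2.natArr 5 l 0 0) + 1 ≤ k - 1) := by
  have hlt : s1.natArr 5 le 0 0 < (tab j s le).cnt := by
    refine lt_of_le_of_ne (hI.ptr le hle).2.1 fun h => ?_
    rw [h, (hp.input le hle).last] at hEle
    exact he.ne hEle
  refine ⟨fun l hl => ?_, ?_⟩
  · by_cases h : l = le
    · subst h
      rw [hptr, h5, Nat.add_sub_cancel]
      refine ⟨by omega, by omega, hEle.ge, ?_⟩
      rw [hEle]
      exact (hp.input l hl).mono _ hlt
    · rw [hptr' l h, h5]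
      obtain ⟨p1, p2, p3, p4⟩ := hI.ptr l hl
      exact ⟨p1, p2, p3.trans hse, hE l hl⟩
  · have := hI.fuel hs
    have hsum : ∑ l ∈ Finset.range (s.nat 0), ((tab j s l).cnt - s2.natArr 5 l 0 0) <
        ∑ l ∈ Finset.range (s.nat 0), ((tab j s l).cnt - s1.natArr 5 l 0 0) := by
      refine Finset.sum_lt_sum (fun l _ => ?_) ⟨le, Finset.mem_range.2 hle, by rw [hptr]; omega⟩
      by_cases h : l = le
      · rw [h, hptr]
        omega
      · rw [hptr' l h]
    omega

/-- The invariant carries a budget: `1 + r n²` new pieces per event, or `n` if `r ≤ 1`. One step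
spends one share of it, and `inner_runs` guarantees that this suffices. -/
theorem sweepStep_runs (hd : 1 ≤ d) (j : ℕ) : ∃ K, ∀ (s : Store) (r : ℕ) (f g : ℕ → ℝ → ℝ)
    (GoodA Good : ℕ → ℝ → ℕ → Prop), LevelPre d r j s f g GoodA Good →
    ∀ k s', SweepInv d r j s g Good k s' → s'.real 5 < s.real 4 → ∃ k', k = k' + 1 ∧
      Runs (sweepStep d j) s' (K * ((s.nat 0 + 1) * (s.nat 1 + 1) * (r * s.nat 1 ^ 2 + 2)))
        (SweepInv d r j s g Good k') := by
  obtain ⟨K1, hK1⟩ := inner_runs hd j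
  obtain ⟨K2, hK2⟩ := advance_runs d j
  refine ⟨K1 + K2 + 100, fun s r f g GoodA Good hp k s' hI hlt => ?_⟩
  have hk := hI.fuel hlt
  obtain ⟨k, rfl⟩ : ∃ k', k = k' + 1 := ⟨k - 1, by omega⟩
  refine ⟨k, rfl, ?_⟩
  set m := s.nat 0 with hm
  set n := s.nat 1 with hn
  obtain ⟨fk1, fk2, fk3, fk4⟩ := findNext_keep d j
  obtain ⟨ik1, ik2, ik3, ik4⟩ := inner_keep d j
  obtain ⟨ak1, ak2, ak3, ak4⟩ := advance_keep d j
  have hfx := hI.fixed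
  have hrows : ∀ s1 : Store, s1.natArr = s'.natArr → s1.realArr = s'.realArr →
      s1.real 5 = s'.real 5 → s1.real 4 = s.real 4 → s1.nat 0 = m → s1.nat 1 = n →
      s1.real 6 ≤ s.real 4 → s'.real 5 ≤ s1.real 6 →
      (∀ l < m, s1.real 6 ≤ (tab j s l).fin (s'.natArr 5 l 0 0)) →
      Runs (.forN 2 (.var 0) (inner d j)) s1 ((K1 * (n + 1) * (r * n ^ 2 + 2) + 11) * (m + 1))
        (fun s2 => ∀ l < m, TabOK d (r + 1) (g l) (Good l) (s1.real 6) (tab (j + 1) s2 l) ∧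
          s2.realArr 4 l 0 0 = g l (s1.real 6) ∧
          (tab (j + 1) s2 l).cnt ≤ (tab (j + 1) s' l).cnt + (1 + r * n ^ 2) ∧
          (r ≤ 1 → (tab (j + 1) s2 l).cnt ≤ (tab (j + 1) s' l).cnt + n)) := by
    intro s1 e1 e2 e3 e4 e5 e6 e7 e8 e9
    refine (Runs.forRows (x := 2) (e := .var 0) (p := inner d j)
      (c := K1 * (n + 1) * (r * n ^ 2 + 2)) (N := m) (inner_onRow d j) (ik1 2 (by omega))
      (fun s2 h => (h.nat 0 (by simpa using ik1 0 (by omega))).trans e5)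
      (fun l s2 => TabOK d (r + 1) (g l) (Good l) (s1.real 6) (tab (j + 1) s2 l) ∧
          s2.realArr 4 l 0 0 = g l (s1.real 6) ∧
          (tab (j + 1) s2 l).cnt ≤ (tab (j + 1) s' l).cnt + (1 + r * n ^ 2) ∧
          (r ≤ 1 → (tab (j + 1) s2 l).cnt ≤ (tab (j + 1) s' l).cnt + n)) ?_ ?_).mono
      (by simp [NExpr.cost]) fun s2 h => h.1
    · intro l s2 s3 h h'
      have : tab (j + 1) s3 l = tab (j + 1) s2 l := by simp only [tab, h.1, h.2]
      rw [this, h.2]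
      exact h'
    · intro l hl s2 hF hx hrow
      have g1 : s2.nat 1 = n := (hF.nat 1 (by simpa using ik1 1 (by omega))).trans e6
      have g5 : s2.real 5 = s'.real 5 := (hF.real 5 (by simpa using ik2 5 (by omega))).trans e3
      have g6 : s2.real 6 = s1.real 6 := hF.real 6 (by simpa using ik2 6 (by omega))
      have b0 : s2.natArr 0 = s.natArr 0 := by
        rw [hF.natArr 0 (by simpa using ik3 0 (by omega)), e1, hfx.b0]
      have b4 : s2.natArr 4 = s.natArr 4 := by
        rw [hF.natArr 4 (by simpa using ik3 4 (by omega)), e1, hfx.b4]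
      have b5 : s2.natArr 5 = s'.natArr 5 := by
        rw [hF.natArr 5 (by simpa using ik3 5 (by omega)), e1]
      have a5 : s2.realArr 5 = s'.realArr 5 := by
        rw [hF.realArr 5 (by simpa using ik4 5 (by omega)), e2]
      have ac : s2.realArr (11 + 2 * j) = s'.realArr (11 + 2 * j) := by
        rw [hF.realArr _ (by simpa using ik4 _ (by omega)), e2]
      have ht : tab (j + 1) s2 l = tab (j + 1) s' l := by simp only [tab, hrow.1, hrow.2, e1, e2]
      have hv : s2.realArr 4 l = s'.realArr 4 l := by rw [hrow.2 4, e2]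
      have hsg : signAt s2 l = signAt s l := by simp only [signAt, b0]
      obtain ⟨o1, o2, -, -⟩ := hI.out l hl
      have := hK1 s2 r (g l) (Good l) (by rw [g1]; exact hp.pos) (by rw [g5]; exact hI.lo)
        (by rw [g5, g6]; exact e8)
        (by
          rw [g1, hx, a5, ac, b5, b4, hsg, g5, g6]
          exact hp.local hI e7 e9 hl)
        (by rw [g5, hx, ht]; exact o1) (by rw [g5, hx, hv]; exact o2)
      rw [g1, g6, hx, ht] at this
      exact this
  have hset : ∀ s2 : Store, Runs (d := d) (.setReal 5 (.var 6)) s2 2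
      (fun s3 => s3 = s2.setReal 5 (s2.real 6)) := fun s2 =>
    ⟨_, _, .setReal _ _ _, by simp [RExpr.cost], rfl⟩
  have hfn := (findNext_runs d j s').frame
  rw [hfx.n0, hfx.r4, hfx.ae] at hfn
  refine (hfn.seq (R := SweepInv d r j s g Good k)
    (c' := (K1 * (n + 1) * (r * n ^ 2 + 2) + 11) * (m + 1) + (2 + (K2 * (m + 1) * (n + 1) + 5)))
    ?_).mono ?_ fun _ h => h
  swap
  · have h1 : (m + 1) * (n + 1) * 1 ≤ (m + 1) * (n + 1) * (r * n ^ 2 + 2) :=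
      Nat.mul_le_mul_left _ (by omega)
    have h2 : (m + 1) * 1 ≤ (m + 1) * (n + 1) := Nat.mul_le_mul_left _ (by omega)
    have h3 := Nat.mul_le_mul_left K2 h1
    nlinarith
  rintro s1 ⟨⟨q1, q2, q3⟩, hF1⟩
  have na1 : s1.natArr = s'.natArr := funext fun x => hF1.natArr x (fk3 x)
  have ra1 : s1.realArr = s'.realArr := funext fun x => hF1.realArr x (fk4 x)
  have r5 : s1.real 5 = s'.real 5 := hF1.real 5 (fk2 5 (by omega))
  have fx1 : Fixed j s s1 := hfx.trans ((findNext_fixes d j).fixed hF1)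
  have hEle : ∀ l < m, s1.real 6 ≤ (tab j s l).fin (s'.natArr 5 l 0 0) := q2
  have hse : s'.real 5 ≤ s1.real 6 := by
    rcases q3 with ⟨h, -⟩ | ⟨h, -, h'⟩
    · rw [h]
      exact hI.hi
    · rw [h']
      exact (hI.ptr _ h).2.2.2
  refine (hrows s1 na1 ra1 r5 fx1.r4 fx1.n0 fx1.n1 q1 hse hEle).frame.seq ?_
  rintro s2 ⟨hpost, hF2⟩
  have fx2 : Fixed j s s2 := fx1.trans
    (((inner_fixes d j).forN (by omega) (by omega)).fixed hF2)
  have r6 : s2.real 6 = s1.real 6 := hF2.real 6 (by simpa using ik2 6 (by omega))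
  have n7 : s2.nat 7 = s1.nat 7 := hF2.nat 7 (by simpa using ik1 7 (by omega))
  have b5 : s2.natArr 5 = s'.natArr 5 := by
    rw [hF2.natArr 5 (by simpa using ik3 5 (by omega)), na1]
  have a5 : s2.realArr 5 = s'.realArr 5 := by
    rw [hF2.realArr 5 (by simpa using ik4 5 (by omega)), ra1]
  refine (hset s2).seq_eq ?_
  set s3 := s2.setReal 5 (s2.real 6) with hs3
  have r53 : s3.real 5 = s1.real 6 := by simp [hs3, Store.setReal, r6]
  have fx3 : Fixed j s s3 := fx2.trans ⟨rfl, rfl, by simp [hs3, Store.setReal], rfl, rfl, rfl, rfl,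
    rfl, rfl, rfl, rfl⟩
  have wok3 : WOK d j s3 := by
    have h := hI.wok
    intro l hl a ha i hi
    have e0 : s3.nat 0 = s'.nat 0 := fx3.n0.trans hfx.n0.symm
    have := h l (by rwa [← e0]) a (by rwa [hfx.n1, ← fx3.n1]) i hi
    rw [fx3.n0, show s3.realArr 5 = s'.realArr 5 from a5,
      show s3.natArr 5 = s'.natArr 5 from b5, fx3.a0, fx3.ac, ← hfx.a0, ← hfx.ac, ← hfx.n0, this]
  have hout : ∀ l < m, TabOK d (r + 1) (g l) (Good l) (s1.real 6) (tab (j + 1) s2 l) ∧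
      s2.realArr 4 l 0 0 = g l (s1.real 6) ∧
      (tab (j + 1) s2 l).cnt + k * (1 + r * n ^ 2) ≤ pieces j s * (1 + r * n ^ 2) ∧
      (r ≤ 1 → (tab (j + 1) s2 l).cnt + k * n ≤ pieces j s * n) := by
    intro l hl
    obtain ⟨t1, t2, t3, t4⟩ := hpost l hl
    obtain ⟨o1, o2, o3, o4⟩ := hI.out l hl
    simp only [← hn] at o3 o4
    rw [Nat.succ_mul] at o3
    refine ⟨t1, t2, ?_, fun hr => ?_⟩
    · omega
    · have h4 := o4 hr
      have h4' := t4 hr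
      rw [Nat.succ_mul] at h4
      omega
  have hcond : (BExpr.natLt (d := d) (.var 7) (.var 0)).Holds s3 ↔ s1.nat 7 < m := by
    show s3.nat 7 < s3.nat 0 ↔ _
    rw [fx3.n0, show s3.nat 7 = s1.nat 7 from n7]
  refine (Runs.branch (c := K2 * (m + 1) * (n + 1) + 1) (fun hb => ?_) fun hb => ?_).mono
    (by simp [BExpr.cost, NExpr.cost]) fun _ h => h
  · rw [hcond] at hb
    have h7 : s3.nat 7 = s1.nat 7 := n7
    have hadv := (hK2 s3 (by rw [h7, fx3.n0]; exact hb) wok3).frame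
    rw [fx3.n0, fx3.n1, h7] at hadv
    refine hadv.mono (Nat.le_succ _) ?_
    rintro s4 ⟨⟨w4, p4, p4'⟩, hF4⟩
    rw [show s3.natArr 5 = s'.natArr 5 from b5] at p4 p4'
    have r54 : s4.real 5 = s1.real 6 := (hF4.real 5 (ak2 5)).trans r53
    rcases q3 with ⟨-, h⟩ | ⟨-, h2, h3⟩
    · exact absurd h hb.ne
    obtain ⟨hptr, hfuel⟩ := hI.advance hp hlt hse h2 hEle hb h3 r54 p4 p4'
    have ht : ∀ l, tab (j + 1) s4 l = tab (j + 1) s2 l := by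
      intro l
      simp only [tab, hF4.natArr _ (ak3 (10 + 2 * (j + 1)) (by omega)),
        hF4.natArr _ (ak3 (11 + 2 * (j + 1)) (by omega)),
        hF4.realArr _ (ak4 (10 + 2 * (j + 1)) (by omega)),
        hF4.realArr _ (ak4 (11 + 2 * (j + 1)) (by omega))]
      rfl
    have hv : s4.realArr 4 = s2.realArr 4 := hF4.realArr 4 (ak4 4 (by omega))
    refine ⟨fx3.trans ((advance_fixes d j).fixed hF4), by rw [r54]; exact hI.lo.trans hse,
      by rw [r54]; exact q1, hptr, w4, fun l hl => ?_, fun _ => hfuel⟩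
    rw [ht, r54, hv]
    exact hout l hl
  · rw [hcond] at hb
    rcases q3 with ⟨h, -⟩ | ⟨h, -⟩
    · refine ⟨_, _, .nop _, by omega, ?_⟩
      refine ⟨fx3, by rw [r53]; exact hI.lo.trans hse, by rw [r53]; exact q1, fun l hl => ?_, wok3,
        fun l hl => ?_, fun h' => by rw [r53, h] at h'; exact absurd h' (lt_irrefl _)⟩
      · rw [show s3.natArr 5 = s'.natArr 5 from b5, r53]
        obtain ⟨p1, p2, p3, p4⟩ := hI.ptr l hl
        exact ⟨p1, p2, p3.trans hse, hEle l hl⟩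
      · rw [r53]
        exact hout l hl
    · exact absurd h hb

theorem level_keep (d j : ℕ) :
    (∀ x, x ≠ 2 ∧ x ≠ 3 ∧ x ≠ 4 ∧ x ≠ 5 ∧ x ≠ 6 ∧ x ≠ 7 ∧ x ≠ 8 ∧ x ≠ 9 → (level d j).keepN x) ∧
    (∀ x, x ≠ 5 ∧ x ≠ 6 ∧ x ≠ 7 ∧ x ≠ 8 ∧ x ≠ 9 ∧ x ≠ 11 → (level d j).keepR x) ∧
    (∀ x, x ≠ 5 ∧ x ≠ 12 + 2 * j ∧ x ≠ 13 + 2 * j → (level d j).keepNA x) ∧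
    ∀ x, x ≠ 4 ∧ x ≠ 5 ∧ x ≠ 12 + 2 * j ∧ x ≠ 13 + 2 * j → (level d j).keepRA x := by
  obtain ⟨fk1, fk2, fk3, fk4⟩ := findNext_keep d j
  obtain ⟨ik1, ik2, ik3, ik4⟩ := inner_keep d j
  obtain ⟨ak1, ak2, ak3, ak4⟩ := advance_keep d j
  obtain ⟨ck1, ck2, ck3, ck4, -⟩ := clearRow_keep d j
  refine ⟨fun x hx => ?_, fun x hx => ?_, fun x hx => ?_, fun x hx => ?_⟩ <;>
    simp only [level, sweepStep, Prog.keepN, Prog.keepR, Prog.keepNA, Prog.keepRA, Prog.keepN_forN,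
      Prog.keepR_forN, Prog.keepNA_forN, Prog.keepRA_forN, true_and, and_true]
  · exact ⟨⟨by omega, ck1 x (by omega)⟩, ⟨by omega, ak1 x (by omega)⟩, fk1 x (by omega),
      ⟨by omega, ik1 x (by omega)⟩, ak1 x (by omega)⟩
  · exact ⟨ck2 x, ak2 x, hx.1, fk2 x (by omega), ik2 x (by omega), hx.1, ak2 x⟩
  · exact ⟨ck3 x (by omega), ak3 x (by omega), fk3 x, ik3 x (by omega), ak3 x (by omega)⟩
  · exact ⟨ck4 x (by omega), ak4 x (by omega), fk4 x, ik4 x (by omega), ak4 x (by omega)⟩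

theorem TabOK.cnt_pos {r : ℕ} {g : ℝ → ℝ} {Good : ℝ → ℕ → Prop} {z : ℝ} {t : Tab}
    (h : TabOK d r g Good z t) (hz : 0 < z) : 0 < t.cnt := by
  refine Nat.pos_of_ne_zero fun h0 => hz.ne ?_
  rw [← h.last, h0, h.zero]

/-- The term `m n · m` of the running time pays for loading the first pieces, the other one for the
sweep with a work of `m n (r n² + 2)` per event. -/
theorem level_runs (hd : 1 ≤ d) (j : ℕ) : ∃ K, ∀ (s : Store) (r : ℕ) (f g : ℕ → ℝ → ℝ)
    (GoodA Good : ℕ → ℝ → ℕ → Prop), LevelPre d r j s f g GoodA Good →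
    (∀ l < s.nat 0, g l 0 = s.realArr 3 l 0 0) →
    Runs (level d j) s (K * ((s.nat 0 + 1) * (s.nat 1 + 1) *
      (s.nat 0 + 1 + (pieces j s + 1) * (r * s.nat 1 ^ 2 + 2)))) (fun s' =>
      ∀ l < s.nat 0, TabOK d (r + 1) (g l) (Good l) (s.real 4) (tab (j + 1) s' l) ∧
        s'.realArr 4 l 0 0 = g l (s.real 4) ∧
        (tab (j + 1) s' l).cnt ≤ pieces j s * (1 + r * s.nat 1 ^ 2) ∧
        (r ≤ 1 → (tab (j + 1) s' l).cnt ≤ pieces j s * s.nat 1)) := by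
  obtain ⟨K1, hK1⟩ := clearRow_runs d j
  obtain ⟨K2, hK2⟩ := advance_runs d j
  obtain ⟨K3, hK3⟩ := sweepStep_runs hd j
  refine ⟨K1 + K2 + K3 + 100, fun s r f g GoodA Good hp hg0 => ?_⟩
  have hstep := hK3 s r f g GoodA Good hp
  set m := s.nat 0 with hm
  set n := s.nat 1 with hn
  obtain ⟨ak1, ak2, ak3, ak4⟩ := advance_keep d j
  obtain ⟨ck1, ck2, ck3, ck4, ck5⟩ := clearRow_keep d j
  have hclear : Runs (.forN 2 (.var 0) (clearRow d j)) s ((K1 * (n + 1) + 11) * (m + 1)) (fun s' =>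
      ∀ l < m, Cleared d j n (s.realArr 3 l 0 0) l s') := by
    refine (Runs.forRows (x := 2) (e := .var 0) (p := clearRow d j) (c := K1 * (n + 1)) (N := m)
      ck5 (ck1 2 (by omega)) (fun s' h => h.nat 0 (by simpa using ck1 0 (by omega)))
      (fun l s' => Cleared d j n (s.realArr 3 l 0 0) l s') ?_ ?_).mono
      (by simp [NExpr.cost]) fun s' h => h.1
    · intro l s2 s3 h h'
      have ht : tab (j + 1) s3 l = tab (j + 1) s2 l := by simp only [tab, h.1, h.2]
      refine ⟨by rw [h.2]; exact h'.val, by rw [h.1]; exact h'.ptr, by rw [ht]; exact h'.cnt,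
        by rw [ht]; exact h'.fin, by rw [ht]; exact h'.coef, by rw [h.2]; exact h'.poly⟩
    · intro l hl s' hF hx hrow
      have := hK1 s'
      rw [hF.nat 1 (by simpa using ck1 1 (by omega)), hx,
        hF.realArr 3 (by simpa using ck4 3 (by omega))] at this
      exact this
  have hset : ∀ s2 : Store, Runs (d := d) (.setReal 5 (.lit 0)) s2 2
      (fun s3 => s3 = s2.setReal 5 0) := fun s2 =>
    ⟨_, _, .setReal _ _ _, by simp [RExpr.cost], by simp [RExpr.eval]⟩
  refine (hclear.frame.seq (c' := (K2 * (m + 1) * (n + 1) + 11) * (m + 1) + (2 +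
    (K3 * ((m + 1) * (n + 1) * (r * n ^ 2 + 2)) + 4) * (pieces j s + 1))) (R := fun s' =>
      ∀ l < m, TabOK d (r + 1) (g l) (Good l) (s.real 4) (tab (j + 1) s' l) ∧
        s'.realArr 4 l 0 0 = g l (s.real 4) ∧
        (tab (j + 1) s' l).cnt ≤ pieces j s * (1 + r * n ^ 2) ∧
        (r ≤ 1 → (tab (j + 1) s' l).cnt ≤ pieces j s * n)) ?_).mono ?_ fun _ h => h
  swap
  · generalize pieces j s = E
    generalize hX : r * n ^ 2 + 2 = X
    have h1 : (m + 1) * 1 ≤ (m + 1) * (n + 1) := Nat.mul_le_mul_left _ (by omega)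
    have h2 : (m + 1) * (n + 1) * 1 ≤ (m + 1) * (n + 1) * (m + 1) :=
      Nat.mul_le_mul_left _ (by omega)
    have h3 : (m + 1) * (n + 1) * (E + 1) * 1 ≤ (m + 1) * (n + 1) * (E + 1) * X :=
      Nat.mul_le_mul_left _ (by omega)
    have h4 : 1 * (E + 1) ≤ (m + 1) * (n + 1) * (E + 1) := Nat.mul_le_mul_right _ (by nlinarith)
    have h5 := Nat.mul_le_mul_left K1 h2
    have h6 : (m + 1) * (n + 1) ≤ (m + 1) * (n + 1) * (m + 1) := by omega
    set A := (m + 1) * (n + 1) * (m + 1) with hA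
    set B := (m + 1) * (n + 1) * (E + 1) * X with hB
    have e1 : (m + 1) * (n + 1) * (m + 1 + (E + 1) * X) = A + B := by rw [hA, hB]; ring
    rw [e1]
    have e2 : (K1 * (n + 1) + 11) * (m + 1) ≤ K1 * A + 11 * A := by
      have : (K1 * (n + 1) + 11) * (m + 1) = K1 * ((m + 1) * (n + 1)) + 11 * (m + 1) := by ring
      rw [this]
      exact Nat.add_le_add (Nat.mul_le_mul_left _ h6) (Nat.mul_le_mul_left _ (by omega))
    have e3 : (K2 * (m + 1) * (n + 1) + 11) * (m + 1) ≤ K2 * A + 11 * A := by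
      have : (K2 * (m + 1) * (n + 1) + 11) * (m + 1) = K2 * A + 11 * (m + 1) := by rw [hA]; ring
      rw [this]
      exact Nat.add_le_add le_rfl (Nat.mul_le_mul_left _ (by omega))
    have e4 : (K3 * ((m + 1) * (n + 1) * X) + 4) * (E + 1) ≤ K3 * B + 4 * B := by
      have : (K3 * ((m + 1) * (n + 1) * X) + 4) * (E + 1) = K3 * B + 4 * (E + 1) := by
        rw [hB]; ring
      rw [this]
      exact Nat.add_le_add le_rfl (Nat.mul_le_mul_left _ (by omega))
    have e5 : 1 ≤ A := by rw [hA]; exact Nat.one_le_iff_ne_zero.2 (by positivity)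
    have e6 : (K1 + K2 + K3 + 100) * (A + B) = K1 * A + K2 * A + K3 * A + 100 * A + K1 * B + K2 * B
      + K3 * B + 100 * B := by ring
    rw [e6]
    omega
  rintro s1 ⟨hC, hF1⟩
  have fx1 : Fixed j s s1 := ((clearRow_fixes d j).forN (by omega) (by omega)).fixed hF1
  -- Advancing every location once from its zero piece to piece `1` builds the initial action
  -- polynomials.
  have hadv := Runs.forN (x := 7) (e := .var 0) (p := advance d j)
    (c := K2 * (m + 1) * (n + 1)) (N := m) (s := s1) (ak1 7 (by omega))
    (fun s' h => (h.nat 0 (by simpa using ak1 0 (by omega))).trans fx1.n0)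
    (fun i s' => WOK d j s' ∧ ∀ l < m, s'.natArr 5 l 0 0 = if l < i then 1 else 0)
    (fun i s' v h => ⟨by
      have := h.1
      simpa [WOK, Store.setNat] using this, h.2⟩)
    (by
      refine ⟨fun l hl a ha i hi => ?_, fun l hl => (hC l hl).ptr⟩
      rw [fx1.n0] at hl ⊢
      rw [fx1.n1] at ha
      rw [(hC l hl).poly a ha i hi]
      symm
      refine Finset.sum_eq_zero fun l' hl' => ?_
      have hl' := Finset.mem_range.1 hl'
      have := (hp.input l' hl').coef_zero i hi
      rw [(hC l' hl').ptr, fx1.ac, show s.realArr (11 + 2 * j) l' 0 i = 0 from this, mul_zero])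
    (by
      rintro i hi s' hF hx ⟨hW, hP⟩
      have e0 : s'.nat 0 = m := (hF.nat 0 (by simpa using ak1 0 (by omega))).trans fx1.n0
      have e1 : s'.nat 1 = n := (hF.nat 1 (by simpa using ak1 1 (by omega))).trans fx1.n1
      have := hK2 s' (by omega) hW
      rw [e0, e1, hx] at this
      refine this.weaken fun s'' ⟨w, p, p'⟩ => ⟨w, fun l hl => ?_⟩
      by_cases h : l = i
      · subst h
        rw [p, hP l hl, if_neg (lt_irrefl l), if_pos (by omega)]
      · rw [p' l h, hP l hl]
        by_cases h' : l < i
        · rw [if_pos h', if_pos (by omega)]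
        · rw [if_neg h', if_neg (by omega)])
  refine (hadv.mono (by simp [NExpr.cost]) fun _ h => h).seq ?_
  rintro s2 ⟨⟨hW2, hP2⟩, hF2⟩
  have fx2 : Fixed j s s2 := fx1.trans (((advance_fixes d j).forN (by omega) (by omega)).fixed hF2)
  refine (hset s2).seq_eq ?_
  set s3 := s2.setReal 5 0 with hs3
  have r53 : s3.real 5 = 0 := by simp [hs3, Store.setReal]
  have fx3 : Fixed j s s3 := fx2.trans ⟨rfl, rfl, by simp [hs3, Store.setReal], rfl, rfl, rfl, rfl,
    rfl, rfl, rfl, rfl⟩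
  have ht : ∀ l, tab (j + 1) s3 l = tab (j + 1) s1 l := by
    intro l
    simp only [tab, hs3, Store.setReal,
      hF2.natArr (10 + 2 * (j + 1)) (by simpa using ak3 _ (by omega)),
      hF2.natArr (11 + 2 * (j + 1)) (by simpa using ak3 _ (by omega)),
      hF2.realArr (10 + 2 * (j + 1)) (by simpa using ak4 _ (by omega)),
      hF2.realArr (11 + 2 * (j + 1)) (by simpa using ak4 _ (by omega))]
  have hv : s3.realArr 4 = s1.realArr 4 := hF2.realArr 4 (by simpa using ak4 4 (by omega))
  -- With all pointers at piece `1`, a location has `cnt - 1` events ahead of it, which is how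
  -- `pieces` counts.
  have hI : SweepInv d r j s g Good (pieces j s) s3 := by
    refine ⟨fx3, r53.ge, by rw [r53]; exact hp.len.le, fun l hl => ?_, ?_, fun l hl => ?_,
      fun _ => ?_⟩
    · have h1 : s3.natArr 5 l 0 0 = 1 := by
        rw [show s3.natArr 5 l 0 0 = s2.natArr 5 l 0 0 from rfl, hP2 l hl, if_pos hl]
      have h2 := (hp.input l hl).cnt_pos hp.len
      rw [h1, r53]
      refine ⟨le_rfl, h2, (hp.input l hl).zero.le, ?_⟩
      rw [← (hp.input l hl).zero]
      exact (hp.input l hl).mono 0 h2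
    · simpa [WOK, hs3, Store.setReal] using hW2
    · have hc := hC l hl
      rw [r53, ht, hv]
      refine ⟨⟨hc.fin, hc.coef, ?_, ?_, ?_, ?_, ?_⟩, ?_, ?_, fun _ => ?_⟩
      · rw [hc.cnt, hc.fin]
      · rw [hc.cnt]; omega
      · rw [hc.cnt]; omega
      · rw [hc.cnt]; omega
      · rw [hc.cnt]; omega
      · rw [hc.val, hg0 l hl]
      · rw [hc.cnt, zero_add]
      · rw [hc.cnt, zero_add]
    · rw [pieces, add_comm]
      refine Nat.add_le_add_left (Finset.sum_le_sum fun l hl => ?_) _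
      rw [show s3.natArr 5 l 0 0 = s2.natArr 5 l 0 0 from rfl, hP2 l (Finset.mem_range.1 hl),
        if_pos (Finset.mem_range.1 hl)]
  refine (Runs.loop (b := .realLt (.var 5) (.var 4)) (p := sweepStep d j)
    (c := K3 * ((m + 1) * (n + 1) * (r * n ^ 2 + 2))) (SweepInv d r j s g Good) ?_ (pieces j s) s3
    hI).mono (by simp [BExpr.cost, RExpr.cost]) ?_
  · intro k s' hI' hb
    refine hstep k s' hI' ?_
    have := hb
    simp only [BExpr.Holds, RExpr.eval, hI'.fixed.r4] at this
    exact this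
  · rintro s' ⟨hb, k, hI'⟩ l hl
    have he : s'.real 5 = s.real 4 := by
      refine le_antisymm hI'.hi ?_
      simpa only [BExpr.Holds, RExpr.eval, hI'.fixed.r4, not_lt] using hb
    obtain ⟨o1, o2, o3, o4⟩ := hI'.out l hl
    rw [he] at o1 o2
    exact ⟨o1, o2, (Nat.le_add_right _ _).trans o3, fun hr => (Nat.le_add_right _ _).trans (o4 hr)⟩

end CTMG
end

/-! ### Elementary properties of action qualities and net functions -/

noncomputable section

set_option linter.unusedSectionVars false

namespace CTMG

namespace MarkovGame

variable {L A : Type} [Fintype L] [Fintype A] [DecidableEq L] {M : MarkovGame L A}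

theorem IsNormed.rate_sum (hM : M.IsNormed) {l : L} {a : A} (ha : a ∈ M.enabled l) :
    ∑ l', (M.rate l a l' : ℝ) = 1 := by
  have := hM l a ha
  rw [exitRate] at this
  exact_mod_cast congrArg (fun q : ℚ≥0 => (q : ℝ)) this

/-- The diagonal entry of the generator is the self-loop rate minus one. Hence the quality is a mean
minus the value of the location itself, and comparing actions amounts to comparing means; self-loops
need no special treatment. -/
theorem IsNormed.quality_eq (hM : M.IsNormed) {l : L} {a : A} (ha : a ∈ M.enabled l) (x : L → ℝ) :
    M.quality x l a = ∑ l', (M.rate l a l' : ℝ) * x l' - x l := by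
  have h1 : M.quality x l a - ∑ l', (M.rate l a l' : ℝ) * x l' =
      (M.gen l a l - M.rate l a l) * x l := by
    rw [quality, ← Finset.sum_sub_distrib]
    rw [Finset.sum_eq_single_of_mem l (Finset.mem_univ l)]
    · ring
    · intro l' _ hl'
      simp [gen, hl']
  have h2 : M.gen l a l - M.rate l a l = -1 := by
    have := Finset.sum_erase_add Finset.univ (fun k => (M.rate l a k : ℝ)) (Finset.mem_univ l)
    rw [hM.rate_sum ha] at this
    rw [gen, if_pos rfl]
    linarith
  rw [h2] at h1
  linarith

theorem quality_continuous (l : L) (a : A) : Continuous fun x => M.quality x l a := by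
  unfold quality
  fun_prop

theorem optQuality_continuous (l : L) : Continuous fun x => M.optQuality x l := by
  unfold optQuality
  split_ifs
  · exact Continuous.finset_sup'_apply _ fun a _ => quality_continuous l a
  · exact Continuous.finset_inf'_apply _ fun a _ => quality_continuous l a

theorem netStep_continuous (x : L → ℝ) (k : ℕ) : Continuous (M.netStep x k) := by
  induction k with
  | zero => exact continuous_const
  | succ k ih =>
    refine continuous_pi fun l => ?_
    have h : Continuous fun u => M.optQuality (M.netStep x k u) l :=
      (optQuality_continuous l).comp ih
    exact continuous_const.add
      (intervalIntegral.continuous_primitive (fun a b => h.intervalIntegrable a b) 0)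

/-- The integrand is continuous, since a maximum or minimum of finitely many linear maps is. So the
net functions are differentiable at every real argument, and no piecewise argument is needed at the
breakpoints. -/
theorem netStep_hasDerivAt (x : L → ℝ) (k : ℕ) (l : L) (s : ℝ) :
    HasDerivAt (fun u => M.netStep x (k + 1) u l) (M.optQuality (M.netStep x k s) l) s := by
  have h : Continuous fun u => M.optQuality (M.netStep x k u) l :=
    (optQuality_continuous l).comp (netStep_continuous x k)
  exact (intervalIntegral.integral_hasDerivAt_right (h.intervalIntegrable _ _)
    (h.stronglyMeasurableAtFilter _ _) h.continuousAt).const_add (x l)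

theorem netStep_zero (x : L → ℝ) (k : ℕ) : M.netStep x k 0 = x := by
  funext l
  cases k with
  | zero => rfl
  | succ k => simp [netStep]

theorem exists_isOptAction (x : L → ℝ) (l : L) : ∃ a, M.IsOptAction x l a := by
  by_cases hl : l ∈ M.reach
  · obtain ⟨a, ha, h⟩ := Finset.exists_mem_eq_sup' (M.enabled_nonempty l) (M.quality x l)
    exact ⟨a, ha, by rw [optQuality, if_pos hl, h]⟩
  · obtain ⟨a, ha, h⟩ := Finset.exists_mem_eq_inf' (M.enabled_nonempty l) (M.quality x l)
    exact ⟨a, ha, by rw [optQuality, if_neg hl, h]⟩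

theorem quality_le_opt {x : L → ℝ} {l : L} {a : A} (hl : l ∈ M.reach) (ha : a ∈ M.enabled l) :
    M.quality x l a ≤ M.optQuality x l := by
  rw [optQuality, if_pos hl]
  exact Finset.le_sup' (M.quality x l) ha

theorem opt_le_quality {x : L → ℝ} {l : L} {a : A} (hl : l ∉ M.reach) (ha : a ∈ M.enabled l) :
    M.optQuality x l ≤ M.quality x l a := by
  rw [optQuality, if_neg hl]
  exact Finset.inf'_le (M.quality x l) ha

/-- The form in which the program certifies optimality: one comparison of means, with a sign for the
owner of the location. -/
theorem IsNormed.isOptAction (hM : M.IsNormed) {x : L → ℝ} {l : L} {a : A} (ha : a ∈ M.enabled l)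
    (h : ∀ b ∈ M.enabled l,
      (if l ∈ M.reach then (1 : ℝ) else -1) * ∑ l', (M.rate l b l' : ℝ) * x l' ≤
      (if l ∈ M.reach then (1 : ℝ) else -1) * ∑ l', (M.rate l a l' : ℝ) * x l') :
    M.IsOptAction x l a := by
  refine ⟨ha, ?_⟩
  by_cases hl : l ∈ M.reach
  · refine le_antisymm (quality_le_opt hl ha) ?_
    rw [optQuality, if_pos hl]
    refine Finset.sup'_le _ _ fun b hb => ?_
    have := h b hb
    rw [if_pos hl] at this
    rw [hM.quality_eq ha, hM.quality_eq hb]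
    linarith
  · refine le_antisymm ?_ (opt_le_quality hl ha)
    rw [optQuality, if_neg hl]
    refine Finset.le_inf' _ _ fun b hb => ?_
    have := h b hb
    rw [if_neg hl] at this
    rw [hM.quality_eq ha, hM.quality_eq hb]
    linarith

end MarkovGame

end CTMG
end

noncomputable section

namespace CTMG

/-! ### The levels of one interval -/

/-- The store holds the game `M`, and row `l` of array `4` lists the enabled actions of `l`. -/
structure GameOK {m n : ℕ} (M : MarkovGame (Fin m) (Fin n)) (s : Store) : Prop where
  n0 : s.nat 0 = m
  n1 : s.nat 1 = n
  rate : ∀ (l : Fin m) (a : Fin n) (l' : Fin m), s.realArr 0 l a l' = M.rate l a l'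
  reach : ∀ l : Fin m, 0 < s.natArr 0 l 0 0 ↔ l ∈ M.reach
  eff_mem : ∀ l : Fin m, ∀ b < n, ∃ h : s.natArr 4 l b 0 < n, ⟨_, h⟩ ∈ M.enabled l
  eff_id : ∀ l : Fin m, ∀ b ∈ M.enabled l, s.natArr 4 l b 0 = b

section

variable {d m n : ℕ}

def netF (M : MarkovGame (Fin m) (Fin n)) (x : Fin m → ℝ) (j l : ℕ) (u : ℝ) : ℝ :=
  if h : l < m then M.netStep x j u ⟨l, h⟩ else 0

/-- Level `0` is constant and involves no choice. On level `j + 1` the relevant actions are optimal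
for the functions of level `j`. -/
def GoodAt (M : MarkovGame (Fin m) (Fin n)) (x : Fin m → ℝ) : ℕ → ℕ → ℝ → ℕ → Prop
  | 0, _, _, _ => True
  | j + 1, l, u, a => ∃ (hl : l < m) (ha : a < n), M.IsOptAction (M.netStep x j u) ⟨l, hl⟩ ⟨a, ha⟩

theorem GameOK.sum_eq {M : MarkovGame (Fin m) (Fin n)} {s : Store} (hG : GameOK M s)
    (x : Fin m → ℝ) (j : ℕ) (u : ℝ) (l : Fin m) (a : Fin n) :
    ∑ l' ∈ Finset.range m, s.realArr 0 l a l' * netF M x j l' u =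
      ∑ l', (M.rate l a l' : ℝ) * M.netStep x j u l' := by
  rw [← Fin.sum_univ_eq_sum_range (fun l' => s.realArr 0 l a l' * netF M x j l' u) m]
  refine Finset.sum_congr rfl fun l' _ => ?_
  rw [hG.rate, netF, dif_pos l'.2]

/-- Links program and game: the list of actions contains each enabled action and nothing else, so
being best among the listed actions is optimality, and the mean minus the own value is then the
derivative of the next level. -/
theorem GameOK.levelPre {M : MarkovGame (Fin m) (Fin n)} (hM : M.IsNormed) {s : Store}
    (hG : GameOK M s) (hn : 0 < n) (hε : 0 < s.real 4) {j : ℕ} (hj : j ≤ d) {x : Fin m → ℝ}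
    {GoodA : ℕ → ℝ → ℕ → Prop}
    (hin : ∀ l < m, TabOK d j (netF M x j l) (GoodA l) (s.real 4) (tab j s l)) :
    LevelPre d j j s (netF M x j) (netF M x (j + 1)) GoodA (GoodAt M x (j + 1)) := by
  refine ⟨hG.n1 ▸ hn, hε, hj, hG.n0 ▸ hin, ?_, ?_⟩
  · rw [hG.n0, hG.n1]
    intro l hl b hb
    exact (hG.eff_mem ⟨l, hl⟩ b hb).1
  · rw [hG.n0]
    intro l hl
    refine ⟨fun u => M.optQuality (M.netStep x j u) ⟨l, hl⟩, fun u => ?_, ?_⟩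
    · have := M.netStep_hasDerivAt x j ⟨l, hl⟩ u
      exact this.congr_of_eventuallyEq (Filter.Eventually.of_forall fun u => dif_pos hl)
    · rintro u - _ ⟨b, hb, rfl⟩ hbest
      rw [hG.n1] at hb hbest
      obtain ⟨ha, hen⟩ := hG.eff_mem ⟨l, hl⟩ b hb
      have hopt : M.IsOptAction (M.netStep x j u) ⟨l, hl⟩ ⟨_, ha⟩ := by
        refine hM.isOptAction hen fun b' hb' => ?_
        have h1 := hbest b' b'.2
        rw [hG.eff_id ⟨l, hl⟩ b' hb'] at h1
        rw [hG.sum_eq x j u ⟨l, hl⟩ ⟨_, ha⟩, hG.sum_eq x j u ⟨l, hl⟩ b'] at h1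
        simp only [signAt, hG.reach ⟨l, hl⟩] at h1
        exact h1
      refine ⟨⟨hl, ha, hopt⟩, ?_⟩
      rw [hG.sum_eq x j u ⟨l, hl⟩ ⟨_, ha⟩, netF, dif_pos hl, ← hM.quality_eq hen]
      exact hopt.2.symm

/-- The part of the store that is not changed by the computation of the levels. -/
structure Outer (s s' : Store) : Prop where
  nat : ∀ x, x < 2 ∨ 10 ≤ x → s'.nat x = s.nat x
  real : ∀ x, x < 5 ∨ x = 10 ∨ x = 12 → s'.real x = s.real x
  natArr : ∀ x, x < 10 → x ≠ 5 → s'.natArr x = s.natArr x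
  realArr : ∀ x, x < 10 → x ≠ 4 → x ≠ 5 → s'.realArr x = s.realArr x

theorem Outer.trans {s s' s'' : Store} (h : Outer s s') (h' : Outer s' s'') : Outer s s'' :=
  ⟨fun x hx => (h'.nat x hx).trans (h.nat x hx), fun x hx => (h'.real x hx).trans (h.real x hx),
    fun x h1 h2 => (h'.natArr x h1 h2).trans (h.natArr x h1 h2),
    fun x h1 h2 h3 => (h'.realArr x h1 h2 h3).trans (h.realArr x h1 h2 h3)⟩

theorem level_outer {j : ℕ} {s s' : Store} (hF : Frame (level d j) s s') : Outer s s' := by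
  obtain ⟨k1, k2, k3, k4⟩ := level_keep d j
  exact ⟨fun x hx => hF.nat x (k1 x (by omega)), fun x hx => hF.real x (k2 x (by omega)),
    fun x h1 h2 => hF.natArr x (k3 x (by omega)),
    fun x h1 h2 h3 => hF.realArr x (k4 x (by omega))⟩

theorem GameOK.congr {M : MarkovGame (Fin m) (Fin n)} {s s' : Store} (hG : GameOK M s)
    (hn : ∀ x < 2, s'.nat x = s.nat x) (h0 : s'.realArr 0 = s.realArr 0)
    (h1 : s'.natArr 0 = s.natArr 0) (h4 : s'.natArr 4 = s.natArr 4) : GameOK M s' := by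
  refine ⟨(hn 0 (by omega)).trans hG.n0, (hn 1 (by omega)).trans hG.n1, ?_, ?_, ?_, ?_⟩
  · rw [h0]; exact hG.rate
  · rw [h1]; exact hG.reach
  · rw [h4]; exact hG.eff_mem
  · rw [h4]; exact hG.eff_id

theorem GameOK.of_outer {M : MarkovGame (Fin m) (Fin n)} {s s' : Store} (hG : GameOK M s)
    (h : Outer s s') : GameOK M s' :=
  hG.congr (fun x hx => h.nat x (by omega)) (h.realArr 0 (by omega) (by omega) (by omega))
    (h.natArr 0 (by omega) (by omega)) (h.natArr 4 (by omega) (by omega))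

/-- Writes the constant functions of level `0`. -/
def startRow (d : ℕ) : Prog d :=
  .seq (.putReal 10 (.var 2) (.lit 0) (.lit 0) (.lit 0))
  (.seq (.putReal 10 (.var 2) (.lit 1) (.lit 0) (.var 4))
  (.seq (.putNat 10 (.var 2) (.lit 0) (.lit 0) (.lit 1))
  (.seq (.unroll (fun i => .seq (.putReal 11 (.var 2) (.lit 0) (.lit i) (.lit 0))
    (.putReal 11 (.var 2) (.lit 1) (.lit i) (.lit 0))) (d + 1))
    (.putReal 11 (.var 2) (.lit 1) (.lit 0) (.get 3 (.var 2) (.lit 0) (.lit 0))))))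

theorem startRow_wp (s : Store) (x : ℝ) (hx : s.realArr 3 (s.nat 2) 0 0 = x) :
    (startRow d).wp (fun s' => (tab 0 s' (s.nat 2)).cnt = 1 ∧ (tab 0 s' (s.nat 2)).fin 0 = 0 ∧
      (tab 0 s' (s.nat 2)).fin 1 = s.real 4 ∧ (∀ i ≤ d, (tab 0 s' (s.nat 2)).coef 0 i = 0) ∧
      (∀ i ≤ d, (tab 0 s' (s.nat 2)).coef 1 i = if i = 0 then x else 0)) s := by
  set l := s.nat 2 with hl
  simp only [startRow, Prog.wp, NExpr.eval, RExpr.eval, ← hl]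
  set s1 := ((s.putReal 10 l 0 0 ((0 : ℚ) : ℝ)).putReal 10 l 1 0 ((s.putReal 10 l 0 0
    ((0 : ℚ) : ℝ)).real 4)).putNat 10 l 0 0 1 with hs1
  refine Prog.wp_mono (Prog.wp_unroll (fun it s' => s'.nat = s.nat ∧ s'.natArr = s1.natArr ∧
      (∀ arr ≠ 11, s'.realArr arr = s1.realArr arr) ∧
      ∀ i < it, s'.realArr 11 l 0 i = 0 ∧ s'.realArr 11 l 1 i = 0)
      ⟨rfl, rfl, fun _ _ => rfl, by simp⟩ ?_) ?_
  · rintro it hit s' ⟨a1, a2, a3, a4⟩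
    simp only [Prog.wp, NExpr.eval, RExpr.eval]
    refine ⟨a1, a2, fun arr h => ?_, fun i h => ?_⟩
    · rw [← a3 arr h]
      funext x y z
      simp [Store.putReal, h]
    · simp only [Store.putReal, a1, ← hl]
      rcases Nat.lt_succ_iff_lt_or_eq.1 h with h' | rfl
      · obtain ⟨b1, b2⟩ := a4 i h'
        simp [h'.ne, b1, b2]
      · simp
  · rintro s' ⟨a1, a2, a3, a4⟩
    simp only [tab, Store.putReal, a1, a2, ← hl]
    have e3 : s'.realArr 3 = s.realArr 3 := by
      rw [a3 3 (by omega)]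
      rfl
    refine ⟨?_, ?_, ?_, fun i hi => ?_, fun i hi => ?_⟩
    · simp [hs1, Store.putNat]
    · simp [a3 10, hs1, Store.putNat, Store.putReal]
    · simp [a3 10, hs1, Store.putNat, Store.putReal]
    · simp [(a4 i (by omega)).1]
    · simp [(a4 i (by omega)).2, e3, hx]

/-- A bound for the number of pieces of a location on level `j`. -/
def cntBound (m n : ℕ) : ℕ → ℕ
  | 0 => 1
  | 1 => 1
  | 2 => n
  | 3 => 3 * m * n ^ 3
  | _ => 12 * m ^ 2 * n ^ 5

theorem pieces_le {j c : ℕ} {s : Store} (h : ∀ l < s.nat 0, (tab j s l).cnt ≤ c) :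
    pieces j s ≤ 1 + s.nat 0 * (c - 1) := by
  refine Nat.add_le_add_left ((Finset.sum_le_card_nsmul _ _ (c - 1) fun l hl => ?_).trans ?_) _
  · have := h l (Finset.mem_range.1 hl)
    omega
  · simp

/-- Converts a bound on the pieces of each location into one on the intervals between events.
Location-wise counts multiply by `m`, except on levels `0` and `1`, where there are no inner events
at all. -/
theorem pieces_bound {j m n : ℕ} (hm : 0 < m) (hn : 0 < n) (hj : j ≤ 3) {E : ℕ}
    (hE : E ≤ 1 + m * (cntBound m n j - 1)) :
    (j ≤ 1 → E = 1 ∨ E = 0) ∧ (j = 2 → E ≤ m * n) ∧ (j = 3 → E ≤ 3 * m ^ 2 * n ^ 3) := by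
  have key : ∀ c, 0 < c → 1 + m * (c - 1) ≤ m * c := by
    intro c hc
    obtain ⟨c, rfl⟩ : ∃ c', c = c' + 1 := ⟨c - 1, by omega⟩
    rw [Nat.add_sub_cancel, mul_add]
    omega
  refine ⟨fun h => ?_, fun h => ?_, fun h => ?_⟩
  · interval_cases j <;> simp [cntBound] at hE <;> omega
  · subst h
    exact hE.trans (key n hn)
  · subst h
    refine (hE.trans (key _ (by simp only [cntBound]; positivity))).trans (le_of_eq ?_)
    simp only [cntBound]
    ring

/-- Level `1` is affine with one piece; level `2` comes from an envelope of affine functions, hence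
`n` pieces. Then `m n` intervals with `1 + 2n² ≤ 3n²` pieces give level `3`, and `3 m² n³` intervals
with `1 + 3n² ≤ 4n²` pieces give level `4`. -/
theorem cntBound_succ {j m n : ℕ} (hm : 0 < m) (hn : 0 < n) (hj : j ≤ 3) {E c : ℕ}
    (hE : E ≤ 1 + m * (cntBound m n j - 1)) (h1 : c ≤ E * (1 + j * n ^ 2))
    (h2 : j ≤ 1 → c ≤ E * n) : c ≤ cntBound m n (j + 1) := by
  obtain ⟨e1, e2, e3⟩ := pieces_bound hm hn hj hE
  interval_cases j
  · have := e1 (by omega)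
    simp only [cntBound]
    have : E * (1 + 0 * n ^ 2) = E := by ring
    omega
  · have h2 := h2 le_rfl
    simp only [cntBound]
    rcases e1 le_rfl with h | h <;> rw [h] at h2 <;> omega
  · have e2 := e2 rfl
    simp only [cntBound]
    refine h1.trans ((Nat.mul_le_mul_right _ e2).trans ?_)
    have : 1 ≤ n ^ 2 := Nat.one_le_pow _ _ hn
    calc m * n * (1 + 2 * n ^ 2) ≤ m * n * (n ^ 2 + 2 * n ^ 2) :=
          Nat.mul_le_mul_left _ (by omega)
      _ = 3 * m * n ^ 3 := by ring
  · have e3 := e3 rfl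
    simp only [cntBound]
    refine h1.trans ((Nat.mul_le_mul_right _ e3).trans ?_)
    have : 1 ≤ n ^ 2 := Nat.one_le_pow _ _ hn
    calc 3 * m ^ 2 * n ^ 3 * (1 + 3 * n ^ 2) ≤ 3 * m ^ 2 * n ^ 3 * (n ^ 2 + 3 * n ^ 2) :=
          Nat.mul_le_mul_left _ (by omega)
      _ = 12 * m ^ 2 * n ^ 5 := by ring

/-- The number of steps of one interval, up to a constant factor. -/
theorem level_cost {j d m n : ℕ} (hm : 0 < m) (hn : 0 < n) (hd : d = 2 ∨ d = 3) (hj : j ≤ d) {E : ℕ}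
    (hE : E ≤ 1 + m * (cntBound m n j - 1)) :
    (m + 1) * (n + 1) * (m + 1 + (E + 1) * (j * n ^ 2 + 2)) ≤ 200 * (m ^ d * n ^ (2 * d)) := by
  obtain ⟨e1, e2, e3⟩ := pieces_bound hm hn (by omega) hE
  -- The number of intervals between the events of level `d`, the worst case: `m n` for `d = 2` and
  -- `m² n³` for `d = 3`.
  have hE' : E + 1 ≤ 4 * (m ^ (d - 1) * n ^ (2 * d - 3)) := by
    have p1 : 1 ≤ m ^ (d - 1) * n ^ (2 * d - 3) := Nat.one_le_iff_ne_zero.2 (by positivity)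
    have hcase : j ≤ 1 ∨ j = 2 ∨ j = 3 := by omega
    rcases hcase with h | h | h
    · have := e1 h
      omega
    · have := e2 h
      have : m * n ≤ m ^ (d - 1) * n ^ (2 * d - 3) := by
        refine Nat.mul_le_mul ?_ ?_
        · exact Nat.le_self_pow (by omega) m
        · exact Nat.le_self_pow (by omega) n
      omega
    · obtain rfl : d = 3 := by omega
      have := e3 h
      have p2 : 1 ≤ m ^ 2 * n ^ 3 := p1
      show E + 1 ≤ 4 * (m ^ 2 * n ^ 3)
      nlinarith
  have hn2 : 1 ≤ n ^ 2 := Nat.one_le_pow _ _ hn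
  have hj' : j * n ^ 2 + 2 ≤ 5 * n ^ 2 := by
    have : j * n ^ 2 ≤ 3 * n ^ 2 := Nat.mul_le_mul_right _ (by omega)
    omega
  have h2 := Nat.mul_le_mul hE' hj'
  have h3 : m + 1 ≤ 2 * m := by omega
  have h4 : n + 1 ≤ 2 * n := by omega
  have h5 : 2 * m ≤ 2 * (m ^ (d - 1) * n ^ (2 * d - 3) * n ^ 2) := by
    refine Nat.mul_le_mul_left _ ?_
    calc m = m * 1 * 1 := by ring
      _ ≤ m ^ (d - 1) * n ^ (2 * d - 3) * n ^ 2 :=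
        Nat.mul_le_mul (Nat.mul_le_mul (Nat.le_self_pow (by omega) m)
          (Nat.one_le_pow _ _ hn)) hn2
  calc (m + 1) * (n + 1) * (m + 1 + (E + 1) * (j * n ^ 2 + 2))
      ≤ (2 * m) * (2 * n) * (2 * (m ^ (d - 1) * n ^ (2 * d - 3) * n ^ 2) +
        4 * (m ^ (d - 1) * n ^ (2 * d - 3)) * (5 * n ^ 2)) :=
        Nat.mul_le_mul (Nat.mul_le_mul h3 h4) (Nat.add_le_add (h3.trans h5) h2)
    _ = 88 * (m ^ (d - 1 + 1) * n ^ (2 * d - 3 + 3)) := by ring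
    _ ≤ 200 * (m ^ d * n ^ (2 * d)) := by
        rw [show d - 1 + 1 = d by omega, show 2 * d - 3 + 3 = 2 * d by omega]
        exact Nat.mul_le_mul_right _ (by omega)

end

end CTMG
end

noncomputable section

namespace CTMG

variable {d m n : ℕ}

/-! ### One interval -/

theorem TabOK.start {g : ℝ → ℝ} {Good : ℝ → ℕ → Prop} {z x : ℝ} {t : Tab} (hg : ∀ u, g u = x)
    (hGood : ∀ u a, Good u a) (hz : 0 ≤ z) (h1 : t.cnt = 1) (h2 : t.fin 0 = 0) (h3 : t.fin 1 = z)
    (h4 : ∀ i ≤ d, t.coef 0 i = 0) (h5 : ∀ i ≤ d, t.coef 1 i = if i = 0 then x else 0) :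
    TabOK d 0 g Good z t := by
  have hq : ∀ q < t.cnt, q = 0 := fun q hq => by omega
  refine ⟨h2, h4, by rw [h1, h3], ?_, fun q _ u _ => hGood _ _, ?_, ?_⟩
  · intro q hq'
    obtain rfl := hq q hq'
    rw [h2, h3]
    exact hz
  · intro _ q hq' u _
    obtain rfl := hq q hq'
    rw [hg, pv, Finset.sum_eq_single_of_mem 0 (Finset.mem_range.2 (by omega))]
    · simp [h5 0 (by omega)]
    · intro i hi hi0
      have := Finset.mem_range.1 hi
      simp [h5 i (by omega), hi0]
  · intro q hq' i hi hid
    obtain rfl := hq q hq'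
    rw [h5 i hid, if_neg (by omega)]

theorem TabOK.fin_mem {r : ℕ} {g : ℝ → ℝ} {Good : ℝ → ℕ → Prop} {z : ℝ} {t : Tab}
    (h : TabOK d r g Good z t) {q : ℕ} (hq : q ≤ t.cnt) : t.fin q ∈ Set.Icc 0 z := by
  constructor
  · induction q with
    | zero => exact h.zero.ge
    | succ q ih => exact (ih (by omega)).trans (h.mono q (by omega))
  · induction hq using Nat.decreasingInduction with
    | self => exact h.last.le
    | of_succ q hq ih => exact (h.mono q hq).trans ih

/-- Computes the tables of all levels in one interval. -/
def levels (d : ℕ) : Prog d :=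
  .seq (.forN 2 (.var 0) (startRow d)) (.unroll (level d) (d + 1))

theorem startRow_keep (d : ℕ) :
    (startRow d).Straight ∧ (startRow d).onRow 2 ∧ (∀ x, (startRow d).keepN x) ∧
    (∀ x, (startRow d).keepR x) ∧
    (∀ x, x ≠ 10 → (startRow d).keepNA x) ∧
    ∀ x, x ≠ 10 ∧ x ≠ 11 → (startRow d).keepRA x := by
  refine ⟨?_, ?_, fun x => ?_, fun x => ?_, fun x hx => ?_, fun x hx => ?_⟩
  · exact ⟨trivial, trivial, trivial,
      Prog.unroll_all (·.Straight) trivial (fun _ _ h h' => ⟨h, h'⟩) fun _ _ => ⟨trivial, trivial⟩,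
      trivial⟩
  · exact ⟨rfl, rfl, rfl,
      Prog.unroll_all (·.onRow 2) trivial (fun _ _ h h' => ⟨h, h'⟩) fun _ _ => ⟨rfl, rfl⟩, rfl⟩
  · exact ⟨trivial, trivial, trivial,
      Prog.unroll_all (·.keepN x) trivial (fun _ _ h h' => ⟨h, h'⟩) fun _ _ => ⟨trivial, trivial⟩,
      trivial⟩
  · exact ⟨trivial, trivial, trivial,
      Prog.unroll_all (·.keepR x) trivial (fun _ _ h h' => ⟨h, h'⟩) fun _ _ => ⟨trivial, trivial⟩,
      trivial⟩
  · exact ⟨trivial, trivial, hx,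
      Prog.unroll_all (·.keepNA x) trivial (fun _ _ h h' => ⟨h, h'⟩) fun _ _ => ⟨trivial, trivial⟩,
      trivial⟩
  · exact ⟨hx.1, hx.1, trivial,
      Prog.unroll_all (·.keepRA x) trivial (fun _ _ h h' => ⟨h, h'⟩) fun _ _ => ⟨hx.2, hx.2⟩,
      hx.2⟩

theorem startRows_runs (M : MarkovGame (Fin m) (Fin n)) (x : Fin m → ℝ) (s : Store)
    (hm : s.nat 0 = m) (hε : 0 ≤ s.real 4) (hX : ∀ l : Fin m, s.realArr 3 l 0 0 = x l) :
    Runs (.forN 2 (.var 0) (startRow d)) s (((startRow d).bound + 1 + 10) * (m + 1)) fun s' =>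
      Outer s s' ∧ ∀ l < m, TabOK d 0 (netF M x 0 l) (GoodAt M x 0 l) (s.real 4) (tab 0 s' l) ∧
        (tab 0 s' l).cnt = 1 := by
  obtain ⟨k0, k1, k2, k3, k4, k5⟩ := startRow_keep d
  refine (Runs.forRows (x := 2) (e := .var 0) (p := startRow d) (c := (startRow d).bound) (N := m)
    k1 (k2 2) (fun s' hF => (hF.nat 0 (Prog.keepN_forN.2 ⟨by omega, k2 0⟩)).trans hm)
    (fun l s' => TabOK d 0 (netF M x 0 l) (GoodAt M x 0 l) (s.real 4) (tab 0 s' l) ∧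
      (tab 0 s' l).cnt = 1) ?_ ?_).weaken ?_
  · intro i s1 s2 hrow h
    have : tab 0 s2 i = tab 0 s1 i := by
      simp only [tab, hrow.1, hrow.2]
    rw [this]
    exact h
  · intro l hl s' hF hl' hrow
    refine Runs.straight k0 (Prog.wp_mono (startRow_wp s' (x ⟨l, hl⟩) ?_) ?_)
    · rw [hl', hrow.2]
      exact hX ⟨l, hl⟩
    · rw [hl', hF.real 4 (by simp [k3])]
      rintro s'' ⟨h1, h2, h3, h4, h5⟩
      exact ⟨TabOK.start (fun u => dif_pos hl) (fun _ _ => trivial) hε h1 h2 h3 h4 h5, h1⟩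
  · rintro s' ⟨h, hF⟩
    refine ⟨⟨fun y hy => hF.nat y ?_, fun y hy => hF.real y ?_, fun y h1 h2 => hF.natArr y ?_,
      fun y h1 h2 h3 => hF.realArr y ?_⟩, h⟩
    · exact Prog.keepN_forN.2 ⟨by omega, k2 y⟩
    · exact Prog.keepR_forN.2 (k3 y)
    · exact Prog.keepNA_forN.2 (k4 y (by omega))
    · exact Prog.keepRA_forN.2 (k5 y (by omega))

/-- Level `d + 1` is obtained from functions of degree at most `d`, so roots of degree `d` suffice.
Its table represents no polynomials (`TabOK.rep` is void for `d + 1`), but its actions and the value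
at the end are exact. -/
theorem levels_runs (hd : d = 2 ∨ d = 3) : ∃ K, ∀ (m n : ℕ) (M : MarkovGame (Fin m) (Fin n))
    (x : Fin m → ℝ) (s : Store), M.IsNormed → 0 < m → 0 < n → GameOK M s → 0 < s.real 4 →
    (∀ l : Fin m, s.realArr 3 l 0 0 = x l) →
    Runs (levels d) s (K * (m ^ d * n ^ (2 * d))) fun s' => Outer s s' ∧
      ∀ l < m, TabOK d (d + 1) (netF M x (d + 1) l) (GoodAt M x (d + 1) l) (s.real 4)
        (tab (d + 1) s' l) ∧ (tab (d + 1) s' l).cnt ≤ cntBound m n (d + 1) ∧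
        s'.realArr 4 l 0 0 = netF M x (d + 1) l (s.real 4) := by
  choose K hK using fun j => level_runs (d := d) (by omega) j
  refine ⟨2 * ((startRow d).bound + 1 + 10) +
    ((∑ j ∈ Finset.range (d + 1), K j) * 200 * (d + 1) + 1),
    fun m n M x s hM hm hn hG hε hX => ?_⟩
  have hP : m ≤ m ^ d * n ^ (2 * d) ∧ 1 ≤ m ^ d * n ^ (2 * d) := by
    refine ⟨?_, Nat.one_le_iff_ne_zero.2 (by positivity)⟩
    calc m = m * 1 := by ring
      _ ≤ _ := Nat.mul_le_mul (Nat.le_self_pow (by omega) m) (Nat.one_le_pow _ _ hn)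
  have h2 : ∀ s1, (Outer s s1 ∧ ∀ l < m, TabOK d 0 (netF M x 0 l) (GoodAt M x 0 l) (s.real 4)
      (tab 0 s1 l) ∧ (tab 0 s1 l).cnt = 1) →
      Runs (.unroll (level d) (d + 1)) s1
        (((∑ j ∈ Finset.range (d + 1), K j) * (200 * (m ^ d * n ^ (2 * d)))) * (d + 1) + 1)
        fun s' => Outer s s' ∧ ∀ l < m, TabOK d (d + 1) (netF M x (d + 1) l)
          (GoodAt M x (d + 1) l) (s.real 4) (tab (d + 1) s' l) ∧
          (tab (d + 1) s' l).cnt ≤ cntBound m n (d + 1) ∧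
          (0 < d + 1 → s'.realArr 4 l 0 0 = netF M x (d + 1) l (s.real 4)) := by
    rintro s1 ⟨ho1, ht1⟩
    refine Runs.unroll (fun j s' => Outer s s' ∧ ∀ l < m, TabOK d j (netF M x j l)
          (GoodAt M x j l) (s.real 4) (tab j s' l) ∧
          (tab j s' l).cnt ≤ cntBound m n j ∧
          (0 < j → s'.realArr 4 l 0 0 = netF M x j l (s.real 4)))
      ⟨ho1, fun l hl => ⟨(ht1 l hl).1, (ht1 l hl).2.le, fun h => absurd h (by omega)⟩⟩ ?_
    rintro j hj s' ⟨ho, ht⟩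
    have hG' := hG.of_outer ho
    have h4 : s'.real 4 = s.real 4 := ho.real 4 (by omega)
    have h3 := ho.realArr 3 (by omega) (by omega) (by omega)
    have hE : pieces j s' ≤ 1 + m * (cntBound m n j - 1) := by
      have := pieces_le (j := j) (c := cntBound m n j) (s := s')
        (fun l hl => (ht l (hG'.n0 ▸ hl)).2.1)
      rwa [hG'.n0] at this
    refine (hK j s' j _ _ _ _ (hG'.levelPre hM hn (h4 ▸ hε) (by omega : j ≤ d)
      (h4 ▸ fun l hl => (ht l hl).1)) ?_).frame.mono ?_ ?_
    · rw [hG'.n0, h3]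
      intro l hl
      rw [netF, dif_pos hl, MarkovGame.netStep_zero]
      exact (hX ⟨l, hl⟩).symm
    · rw [hG'.n0, hG'.n1]
      refine Nat.mul_le_mul ?_ (level_cost hm hn hd (by omega) hE)
      exact Finset.single_le_sum (f := K) (fun _ _ => Nat.zero_le _) (Finset.mem_range.2 hj)
    · rintro s'' ⟨h, hF⟩
      refine ⟨ho.trans (level_outer hF), fun l hl => ?_⟩
      obtain ⟨e1, e2, e3, e4⟩ := h l (hG'.n0.symm ▸ hl)
      rw [h4] at e1 e2
      rw [hG'.n1] at e3 e4
      exact ⟨e1, cntBound_succ hm hn (by omega) hE e3 e4, fun _ => e2⟩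
  refine ((startRows_runs M x s hG.n0 hε.le hX).seq h2).mono ?_ ?_
  · generalize (startRow d).bound = b
    generalize ∑ j ∈ Finset.range (d + 1), K j = S
    obtain ⟨p1, p2⟩ := hP
    generalize m ^ d * n ^ (2 * d) = P at *
    have a1 : (b + 1 + 10) * (m + 1) ≤ 2 * (b + 1 + 10) * P := by
      calc (b + 1 + 10) * (m + 1) ≤ (b + 1 + 10) * (2 * P) := Nat.mul_le_mul_left _ (by omega)
        _ = _ := by ring
    calc _ ≤ 2 * (b + 1 + 10) * P + (S * (200 * P) * (d + 1) + P) := by omega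
      _ = _ := by ring
  · rintro s' ⟨ho, h⟩
    exact ⟨ho, fun l hl => ⟨(h l hl).1, (h l hl).2.1, (h l hl).2.2 (by omega)⟩⟩

/-! ### The table of the strategy -/

/-- The table of location `l` in the output lists `Good` actions on the interval from `z`
to `T`. -/
structure OutOK (Good : ℝ → ℕ → Prop) (T z : ℝ) (l : ℕ) (s : Store) : Prop where
  first : s.realArr 2 l 0 0 = T
  last : s.realArr 2 l (s.natArr 2 l 0 0) 0 = z
  step : ∀ q < s.natArr 2 l 0 0, s.realArr 2 l (q + 1) 0 ≤ s.realArr 2 l q 0 ∧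
    ∀ t ∈ Set.Ioc (s.realArr 2 l (q + 1) 0) (s.realArr 2 l q 0), Good t (s.natArr 3 l q 0)

def copyPiece (d : ℕ) : Prog d :=
  .seq (.putReal 2 (.var 2) (.add (.get 2 (.var 2) (.lit 0) (.lit 0)) (.lit 1)) (.lit 0)
    (.sub (.var 12) (.get (10 + 2 * (d + 1)) (.var 2) (.add (.var 10) (.lit 1)) (.lit 0))))
  (.seq (.putNat 3 (.var 2) (.get 2 (.var 2) (.lit 0) (.lit 0)) (.lit 0)
    (.get (11 + 2 * (d + 1)) (.var 2) (.add (.var 10) (.lit 1)) (.lit 0)))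
    (.putNat 2 (.var 2) (.lit 0) (.lit 0) (.add (.get 2 (.var 2) (.lit 0) (.lit 0)) (.lit 1))))

/-- Appends the table of the last level to the output and moves on to the next interval. -/
def copyRow (d : ℕ) : Prog d :=
  .seq (.setNat 11 (.get (10 + 2 * (d + 1)) (.var 2) (.lit 0) (.lit 0)))
  (.seq (.forN 10 (.var 11) (copyPiece d))
    (.putReal 3 (.var 2) (.lit 0) (.lit 0) (.get 4 (.var 2) (.lit 0) (.lit 0))))

theorem copyPiece_keep (d : ℕ) :
    (∀ x, (copyPiece d).keepN x) ∧ (∀ x, (copyPiece d).keepR x) ∧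
    (∀ x, x ≠ 2 ∧ x ≠ 3 → (copyPiece d).keepNA x) ∧ ∀ x, x ≠ 2 → (copyPiece d).keepRA x := by
  refine ⟨fun x => ?_, fun x => ?_, fun x hx => ?_, fun x hx => ?_⟩ <;>
    simp_all [copyPiece, Prog.keepN, Prog.keepR, Prog.keepNA, Prog.keepRA]

theorem copyRow_keep (d : ℕ) :
    (copyRow d).onRow 2 ∧ (∀ x, x ≠ 10 ∧ x ≠ 11 → (copyRow d).keepN x) ∧
    (∀ x, (copyRow d).keepR x) ∧ (∀ x, x ≠ 2 ∧ x ≠ 3 → (copyRow d).keepNA x) ∧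
    ∀ x, x ≠ 2 ∧ x ≠ 3 → (copyRow d).keepRA x := by
  refine ⟨?_, fun x hx => ?_, fun x => ?_, fun x hx => ?_, fun x hx => ?_⟩ <;>
    simp_all [copyRow, copyPiece, Prog.keepN, Prog.keepR, Prog.keepNA, Prog.keepRA, Prog.onRow]

/-- The net runs backwards: the time `u` left in the interval corresponds to `t = z - u`, where `z`
is the right end. Half-open pieces in `u` thus become the pieces in `t` that are open on the left,
as the output format demands. -/
theorem copyPiece_wp {Good : ℝ → ℕ → Prop} {T : ℝ} {s : Store} {l q : ℕ} (hl : s.nat 2 = l)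
    (hq : s.nat 10 = q) (h : OutOK Good T (s.real 12 - (tab (d + 1) s l).fin q) l s)
    (hmono : (tab (d + 1) s l).fin q ≤ (tab (d + 1) s l).fin (q + 1))
    (hgood : ∀ u ∈ Set.Ico ((tab (d + 1) s l).fin q) ((tab (d + 1) s l).fin (q + 1)),
      Good (s.real 12 - u) ((tab (d + 1) s l).act (q + 1))) :
    (copyPiece d).wp (fun s' =>
      OutOK Good T (s.real 12 - (tab (d + 1) s l).fin (q + 1)) l s') s := by
  obtain ⟨h1, h2, h3⟩ := h
  simp only [tab] at hmono hgood h2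
  subst hl hq
  set l := s.nat 2 with hl
  set c := s.natArr 2 l 0 0 with hc
  refine Prog.wp_mono (Q := fun s' => s'.natArr 2 l 0 0 = c + 1 ∧
    (∀ q, s'.realArr 2 l q 0 = if q = c + 1 then
      s.real 12 - s.realArr (10 + 2 * (d + 1)) l (s.nat 10 + 1) 0 else s.realArr 2 l q 0) ∧
    ∀ q, s'.natArr 3 l q 0 = if q = c then
      s.natArr (11 + 2 * (d + 1)) l (s.nat 10 + 1) 0 else s.natArr 3 l q 0) ?_ ?_
  · simp [copyPiece, Prog.wp, NExpr.eval, RExpr.eval, Store.putReal, Store.putNat, hc, hl]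
  rintro s' ⟨e1, e2, e3⟩
  refine ⟨by rw [e2, if_neg (by omega), h1], by rw [e1, e2, if_pos rfl, tab], ?_⟩
  intro q hq
  rw [e1] at hq
  rw [e2, e2, e3, if_neg (by omega : q ≠ c + 1)]
  rcases Nat.lt_succ_iff_lt_or_eq.1 hq with hlt | rfl
  · rw [if_neg (by omega), if_neg (by omega)]
    exact h3 q hlt
  · rw [if_pos rfl, if_pos rfl, h2]
    refine ⟨by linarith, fun t ht => ?_⟩
    have := hgood (s.real 12 - t) ⟨by linarith [ht.2], by linarith [ht.1]⟩
    rwa [sub_sub_cancel] at this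

theorem copyRow_runs (d : ℕ) {Good : ℝ → ℕ → Prop} {T ε : ℝ} {s : Store} {l : ℕ}
    (hl : s.nat 2 = l) {r : ℕ} {g : ℝ → ℝ} {GoodA : ℝ → ℕ → Prop}
    (ht : TabOK d r g GoodA ε (tab (d + 1) s l)) (h : OutOK Good T (s.real 12) l s)
    (hgood : ∀ u ∈ Set.Ico 0 ε, ∀ a, GoodA u a → Good (s.real 12 - u) a) :
    Runs (copyRow d) s ((((copyPiece d).bound + 25) * ((tab (d + 1) s l).cnt + 1)))
      (fun s' => OutOK Good T (s.real 12 - ε) l s' ∧ s'.realArr 3 l 0 0 = s.realArr 4 l 0 0) := by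
  obtain ⟨k1, k2, k3, k4⟩ := copyPiece_keep d
  set N := (tab (d + 1) s l).cnt with hN
  have hs1 : Runs (d := d) (.setNat 11 (.get (10 + 2 * (d + 1)) (.var 2) (.lit 0) (.lit 0))) s 5
      (fun s' => s' = s.setNat 11 N) := by
    refine ⟨_, _, .setNat _ _ _, by simp [NExpr.cost], ?_⟩
    simp [NExpr.eval, hl, hN, tab]
  set s1 := s.setNat 11 N with hs1'
  have hloop : Runs (d := d) (.forN 10 (.var 11) (copyPiece d)) s1
      (((copyPiece d).bound + 1 + 10) * (N + 1)) _ :=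
    Runs.forN (x := 10) (e := .var 11) (p := copyPiece d) (c := (copyPiece d).bound) (N := N)
    (k1 10) (fun s' hF => by
      rw [NExpr.eval, hF.nat 11 (Prog.keepN_forN.2 ⟨by omega, k1 _⟩)]
      simp [s1, Store.setNat])
    (fun q s' => OutOK Good T (s.real 12 - (tab (d + 1) s l).fin q) l s')
    (fun i s' v h => ⟨h.1, h.2, h.3⟩)
    (by rw [ht.zero, sub_zero]; exact ⟨h.1, h.2, h.3⟩)
    (by
      intro q hq s' hF hq' hI
      have hr : s'.real 12 = s.real 12 := hF.real 12 (Prog.keepR_forN.2 (k2 _))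
      have hl' : s'.nat 2 = l := by
        rw [hF.nat 2 (Prog.keepN_forN.2 ⟨by omega, k1 _⟩), ← hl]
        simp [s1, Store.setNat]
      have htab : tab (d + 1) s' l = tab (d + 1) s l := by
        have e1 := hF.natArr (10 + 2 * (d + 1)) (Prog.keepNA_forN.2 (k3 _ (by omega)))
        have e2 := hF.natArr (11 + 2 * (d + 1)) (Prog.keepNA_forN.2 (k3 _ (by omega)))
        have e3 := hF.realArr (10 + 2 * (d + 1)) (Prog.keepRA_forN.2 (k4 _ (by omega)))
        have e4 := hF.realArr (11 + 2 * (d + 1)) (Prog.keepRA_forN.2 (k4 _ (by omega)))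
        simp only [tab, e1, e2, e3, e4]
        rfl
      refine Runs.straight (p := copyPiece d) ⟨trivial, trivial, trivial⟩ ?_
      have := copyPiece_wp (d := d) (Good := Good) (T := T) hl' hq' (by rw [hr, htab]; exact hI)
        (by rw [htab]; exact ht.mono q hq) (by
          rw [htab, hr]
          intro u hu
          refine hgood u ⟨(ht.fin_mem (by omega)).1.trans hu.1,
            hu.2.trans_le (ht.fin_mem (by omega)).2⟩ _ (ht.good q hq u ⟨hu.1, hu.2.le⟩))
      rwa [hr, htab] at this)
  refine (hs1.seq_eq (hloop.seq (c' := 9) (R := fun s' => OutOK Good T (s.real 12 - ε) l s' ∧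
    s'.realArr 3 l 0 0 = s.realArr 4 l 0 0) ?_)).mono ?_ fun _ h => h
  · rintro s' ⟨hI, hF⟩
    have hl' : s'.nat 2 = l := by
      rw [hF.nat 2 (Prog.keepN_forN.2 ⟨by omega, k1 _⟩), ← hl]
      simp [s1, Store.setNat]
    rw [ht.last] at hI
    refine ⟨_, _, .putReal _ _ _ _ _ _, by simp [NExpr.cost, RExpr.cost], ?_, ?_⟩
    · obtain ⟨h1, h2, h3⟩ := hI
      refine ⟨?_, ?_, ?_⟩
      · simpa [Store.putReal] using h1
      · simpa [Store.putReal] using h2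
      · simpa [Store.putReal] using h3
    · simp only [Store.putReal, NExpr.eval, RExpr.eval, hl', and_self, if_true]
      rw [hF.realArr 4 (Prog.keepRA_forN.2 (k4 _ (by omega)))]
      rfl
  · generalize (copyPiece d).bound = b
    nlinarith

end CTMG
end

/-! ### The loop over the intervals of the net -/

noncomputable section

namespace CTMG

variable {d m n : ℕ}

/-- Computes the next interval of the net. -/
def interval (d : ℕ) : Prog d :=
  .seq (.setReal 12 (.sub (.var 0) (.mul (.var 10) (.var 4))))
  (.seq (levels d)
  (.seq (.forN 2 (.var 0) (copyRow d)) (.setReal 10 (.add (.var 10) (.lit 1)))))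

/-- In location `l`, the action `a` may be played at time `t` by a strategy of the net. -/
def GoodNet (M : MarkovGame (Fin m) (Fin n)) (G : Finset (Fin m)) (k N : ℕ) (T : ℝ) (l : ℕ) (t : ℝ)
    (a : ℕ) : Prop :=
  ∃ i < N, t ∈ Set.Ioc (T - (i + 1) * (T / N)) (T - i * (T / N)) ∧
    GoodAt M (M.netGrid G k (T / N) i) k l (T - i * (T / N) - t) a

/-- The state after `c` intervals of the net of level `k`. -/
structure NetInv (M : MarkovGame (Fin m) (Fin n)) (G : Finset (Fin m)) (k N : ℕ) (T : ℝ) (c : ℕ)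
    (s : Store) : Prop where
  game : GameOK M s
  bound : s.real 0 = T
  number : s.real 3 = N
  len : s.real 4 = T / N
  count : s.real 10 = c
  values : ∀ l : Fin m, s.realArr 3 l 0 0 = M.netGrid G k (T / N) c l
  out : ∀ l < m, OutOK (GoodNet M G k N T l) T (T - c * (T / N)) l s
  init : ∀ l : Fin m, s.realArr 1 l 0 0 = M.init l

theorem NetInv.of_same {M : MarkovGame (Fin m) (Fin n)} {G : Finset (Fin m)} {k N : ℕ} {T : ℝ} {c : ℕ}
    {s s' : Store} (h : NetInv M G k N T c s) (h0 : s'.nat 0 = s.nat 0) (h1 : s'.nat 1 = s.nat 1)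
    (hr : ∀ x, x = 0 ∨ x = 3 ∨ x = 4 ∨ x = 10 → s'.real x = s.real x)
    (hna : s'.natArr = s.natArr) (hra : s'.realArr = s.realArr) : NetInv M G k N T c s' := by
  obtain ⟨h1', h2, h3, h4, h5, h6, h7, h8⟩ := h
  refine ⟨h1'.congr (fun x hx => by interval_cases x <;> assumption) (by rw [hra]) (by rw [hna])
    (by rw [hna]), (hr 0 (by omega)).trans h2,
    (hr 3 (by omega)).trans h3, (hr 4 (by omega)).trans h4, (hr 10 (by omega)).trans h5, ?_,
    fun l hl => ?_, ?_⟩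
  · rw [hra]; exact h6
  · obtain ⟨o1, o2, o3⟩ := h7 l hl
    exact ⟨by rw [hra]; exact o1, by rw [hra, hna]; exact o2, by rw [hra, hna]; exact o3⟩
  · rw [hra]; exact h8

theorem copyRows_cost (hm : 0 < m) (hn : 0 < n) (hd : d = 2 ∨ d = 3) (b : ℕ) :
    ((b + 25) * (cntBound m n (d + 1) + 1) + 1 + 10) * (m + 1) ≤
      50 * (b + 25) * (m ^ d * n ^ (2 * d)) := by
  have h1 : cntBound m n (d + 1) + 1 ≤ 13 * (m ^ (d - 1) * n ^ (2 * d - 1)) := by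
    have p1 : 1 ≤ m ^ (d - 1) * n ^ (2 * d - 1) := Nat.one_le_iff_ne_zero.2 (by positivity)
    rcases hd with rfl | rfl
    · simp only [cntBound] at p1 ⊢
      have : 3 * m * n ^ 3 = 3 * (m ^ (2 - 1) * n ^ (2 * 2 - 1)) := by norm_num; ring
      omega
    · simp only [cntBound] at p1 ⊢
      have : 12 * m ^ 2 * n ^ 5 = 12 * (m ^ (3 - 1) * n ^ (2 * 3 - 1)) := by norm_num; ring
      omega
  have h2 : cntBound m n (d + 1) + 2 ≤ 14 * (m ^ (d - 1) * n ^ (2 * d - 1)) := by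
    have p1 : 1 ≤ m ^ (d - 1) * n ^ (2 * d - 1) := Nat.one_le_iff_ne_zero.2 (by positivity)
    omega
  calc ((b + 25) * (cntBound m n (d + 1) + 1) + 1 + 10) * (m + 1)
      ≤ ((b + 25) * (cntBound m n (d + 1) + 2)) * (2 * m) :=
        Nat.mul_le_mul (by rw [mul_add, mul_add]; omega) (by omega)
    _ ≤ ((b + 25) * (14 * (m ^ (d - 1) * n ^ (2 * d - 1)))) * (2 * m) :=
        Nat.mul_le_mul_right _ (Nat.mul_le_mul_left _ h2)
    _ = 28 * (b + 25) * (m ^ (d - 1 + 1) * n ^ (2 * d - 1)) := by ring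
    _ ≤ 50 * (b + 25) * (m ^ d * n ^ (2 * d)) := by
        rw [show d - 1 + 1 = d by omega]
        exact Nat.mul_le_mul (Nat.mul_le_mul_right _ (by omega))
          (Nat.mul_le_mul_left _ (Nat.pow_le_pow_right hn (by omega)))

theorem copyRows_runs (M : MarkovGame (Fin m) (Fin n)) {Good : ℕ → ℝ → ℕ → Prop} {T ε : ℝ}
    {s : Store} (hm : s.nat 0 = m) {x : Fin m → ℝ} {B : ℕ}
    (ht : ∀ l < m, TabOK d (d + 1) (netF M x (d + 1) l) (GoodAt M x (d + 1) l) ε (tab (d + 1) s l) ∧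
      (tab (d + 1) s l).cnt ≤ B ∧ s.realArr 4 l 0 0 = netF M x (d + 1) l ε)
    (ho : ∀ l < m, OutOK (Good l) T (s.real 12) l s)
    (hgood : ∀ l < m, ∀ u ∈ Set.Ico 0 ε, ∀ a, GoodAt M x (d + 1) l u a →
      Good l (s.real 12 - u) a) :
    Runs (.forN 2 (.var 0) (copyRow d)) s ((((copyPiece d).bound + 25) * (B + 1) + 1 + 10) * (m + 1))
      (fun s' => (∀ l < m, OutOK (Good l) T (s.real 12 - ε) l s' ∧
        s'.realArr 3 l 0 0 = netF M x (d + 1) l ε) ∧ Frame (.forN 2 (.var 0) (copyRow d)) s s') := by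
  obtain ⟨k1, k2, k3, k4, k5⟩ := copyRow_keep d
  refine Runs.forRows (x := 2) (e := .var 0) (p := copyRow d)
    (c := ((copyPiece d).bound + 25) * (B + 1)) (N := m) k1 (k2 2 (by omega))
    (fun s' hF => (hF.nat 0 (Prog.keepN_forN.2 ⟨by omega, k2 0 (by omega)⟩)).trans hm)
    (fun l s' => OutOK (Good l) T (s.real 12 - ε) l s' ∧
        s'.realArr 3 l 0 0 = netF M x (d + 1) l ε) ?_ ?_
  · rintro i s1 s2 ⟨hr1, hr2⟩ ⟨⟨o1, o2, o3⟩, hx⟩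
    exact ⟨⟨by rw [hr2]; exact o1, by rw [hr2, hr1]; exact o2, by rw [hr1, hr1, hr2]; exact o3⟩,
      by rw [hr2]; exact hx⟩
  · rintro l hl s' hF hl' ⟨hr1, hr2⟩
    have htab : tab (d + 1) s' l = tab (d + 1) s l := by
      simp only [tab, hr1, hr2]
    have h12 : s'.real 12 = s.real 12 := hF.real 12 (Prog.keepR_forN.2 (k3 12))
    obtain ⟨t1, t2, t3⟩ := ht l hl
    obtain ⟨o1, o2, o3⟩ := ho l hl
    refine (copyRow_runs d hl' (htab ▸ t1) (Good := Good l) (T := T) ?_ ?_).mono ?_ ?_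
    · rw [h12]
      exact ⟨by rw [hr2]; exact o1, by rw [hr2, hr1]; exact o2, by rw [hr1, hr1, hr2]; exact o3⟩
    · rw [h12]
      exact hgood l hl
    · rw [htab]
      exact Nat.mul_le_mul_left _ (by omega)
    · rintro s'' ⟨h1, h2⟩
      rw [h12] at h1
      rw [hr2, t3] at h2
      exact ⟨h1, h2⟩

/-- Each interval costs the same `O(m^d n^(2d))`, because its start values are plain numbers: no
piecewise structure is inherited from earlier intervals. -/
theorem interval_runs (hd : d = 2 ∨ d = 3) : ∃ K, ∀ (m n : ℕ) (M : MarkovGame (Fin m) (Fin n))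
    (G : Finset (Fin m)) (T : ℝ) (N c : ℕ) (s : Store), M.IsNormed → 0 < m → 0 < n → 0 < T →
    c < N → NetInv M G (d + 1) N T c s →
    Runs (interval d) s (K * (m ^ d * n ^ (2 * d))) (NetInv M G (d + 1) N T (c + 1)) := by
  obtain ⟨K, hK⟩ := levels_runs hd
  refine ⟨10 + K + 50 * ((copyPiece d).bound + 25),
    fun m n M G T N c s hM hm hn hT hc hI => ?_⟩
  obtain ⟨k1, k2, k3, k4, k5⟩ := copyRow_keep d
  have hN : (0 : ℝ) < N := by
    exact_mod_cast (by omega : 0 < N)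
  have hε : 0 < T / N := div_pos hT hN
  set ε := T / N with hε'
  have hP : 1 ≤ m ^ d * n ^ (2 * d) := Nat.one_le_iff_ne_zero.2 (by positivity)
  have h0 : Runs (d := d) (.setReal 12 (.sub (.var 0) (.mul (.var 10) (.var 4)))) s 6
      (fun s' => s' = s.setReal 12 (T - c * ε)) := by
    refine ⟨_, _, .setReal _ _ _, by simp [RExpr.cost], ?_⟩
    simp [RExpr.eval, hI.bound, hI.count, hI.len, hε']
  set s1 := s.setReal 12 (T - c * ε) with hs1
  have h12 : s1.real 12 = T - c * ε := by simp [s1, Store.setReal]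
  have hI1 : NetInv M G (d + 1) N T c s1 :=
    hI.of_same rfl rfl (fun x hx => Function.update_of_ne (by omega) _ _) rfl rfl
  have hl := hK m n M (M.netGrid G (d + 1) ε c) s1 hM hm hn hI1.game (by rw [hI1.len]; exact hε)
    hI1.values
  rw [hI1.len] at hl
  have hstep : ∀ s2, (Outer s1 s2 ∧ ∀ l < m,
      TabOK d (d + 1) (netF M (M.netGrid G (d + 1) ε c) (d + 1) l)
        (GoodAt M (M.netGrid G (d + 1) ε c) (d + 1) l) ε (tab (d + 1) s2 l) ∧
      (tab (d + 1) s2 l).cnt ≤ cntBound m n (d + 1) ∧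
      s2.realArr 4 l 0 0 = netF M (M.netGrid G (d + 1) ε c) (d + 1) l ε) →
      Runs (.seq (.forN 2 (.var 0) (copyRow d)) (.setReal 10 (.add (.var 10) (.lit 1)))) s2
        (50 * ((copyPiece d).bound + 25) * (m ^ d * n ^ (2 * d)) + 4)
        (NetInv M G (d + 1) N T (c + 1)) := by
    rintro s2 ⟨hO, ht⟩
    have e12 : s2.real 12 = T - c * ε := (hO.real 12 (by omega)).trans h12
    have hna : ∀ x, x = 2 ∨ x = 3 → s2.natArr x = s1.natArr x := fun x hx =>
      hO.natArr x (by omega) (by omega)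
    have hra : ∀ x, x = 1 ∨ x = 2 → s2.realArr x = s1.realArr x := fun x hx =>
      hO.realArr x (by omega) (by omega) (by omega)
    have hG2 := hI1.game.of_outer hO
    refine ((copyRows_runs (Good := GoodNet M G (d + 1) N T) (T := T) M hG2.n0 ht ?_ ?_).mono
      (copyRows_cost hm hn hd _) fun _ h => h).seq (c' := 4) ?_
    · rw [e12]
      intro l hl
      obtain ⟨o1, o2, o3⟩ := hI1.out l hl
      refine ⟨?_, ?_, ?_⟩
      · rw [hra 2 (by omega)]; exact o1
      · rw [hra 2 (by omega), hna 2 (by omega)]; exact o2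
      · rw [hra 2 (by omega), hna 2 (by omega), hna 3 (by omega)]; exact o3
    · rw [e12]
      intro l hl u hu a ha
      refine ⟨c, hc, ⟨?_, ?_⟩, ?_⟩
      · rw [← hε']; linarith [hu.2]
      · rw [← hε']; linarith [hu.1]
      · rw [← hε', sub_sub_cancel]; exact ha
    · rintro s3 ⟨hrow, hF⟩
      have f1 : ∀ x, x < 2 → s3.nat x = s2.nat x := fun x hx =>
        hF.nat x (Prog.keepN_forN.2 ⟨by omega, k2 x (by omega)⟩)
      have f2 : ∀ x, s3.real x = s2.real x := fun x => hF.real x (Prog.keepR_forN.2 (k3 x))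
      have f3 : ∀ x, x ≠ 2 ∧ x ≠ 3 → s3.natArr x = s2.natArr x := fun x hx =>
        hF.natArr x (Prog.keepNA_forN.2 (k4 x hx))
      have f4 : ∀ x, x ≠ 2 ∧ x ≠ 3 → s3.realArr x = s2.realArr x := fun x hx =>
        hF.realArr x (Prog.keepRA_forN.2 (k5 x hx))
      refine ⟨_, _, .setReal _ _ _, by simp [RExpr.cost], ?_⟩
      have hr : ∀ x, x < 5 → s3.real x = s1.real x := fun x hx =>
        (f2 x).trans (hO.real x (by omega))
      have h10 : ∀ v, ∀ x ≠ 10, (s3.setReal 10 v).real x = s3.real x := fun v x hx =>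
        Function.update_of_ne hx _ _
      refine ⟨hG2.congr f1 (f4 0 (by omega)) (f3 0 (by omega)) (f3 4 (by omega)),
        ?_, ?_, ?_, ?_, ?_, ?_, ?_⟩
      · rw [h10 _ _ (by omega), hr 0 (by omega)]; exact hI1.bound
      · rw [h10 _ _ (by omega), hr 3 (by omega)]; exact hI1.number
      · rw [h10 _ _ (by omega), hr 4 (by omega)]; exact hI1.len
      · simp only [Store.setReal, Function.update_self, RExpr.eval, f2 10, hO.real 10 (by omega),
          hI1.count]
        push_cast
        rfl
      · intro l
        show s3.realArr 3 l 0 0 = _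
        rw [(hrow l l.2).2, netF, dif_pos l.2]
        rfl
      · intro l hl
        obtain ⟨o1, o2, o3⟩ := (hrow l hl).1
        have : T - ((c + 1 : ℕ) : ℝ) * ε = s2.real 12 - ε := by
          rw [e12]; push_cast; ring
        rw [← hε', this]
        exact ⟨o1, o2, o3⟩
      · show ∀ l : Fin m, s3.realArr 1 l 0 0 = _
        rw [f4 1 (by omega), hra 1 (by omega)]; exact hI1.init
  refine (h0.seq_eq (hl.seq hstep)).mono ?_ fun _ h => h
  generalize m ^ d * n ^ (2 * d) = P at *
  generalize (copyPiece d).bound = b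
  nlinarith

end CTMG
end

noncomputable section

namespace CTMG

variable {d m n : ℕ}

/-! ### Initialization -/

def effTest (d : ℕ) : Prog d :=
  .seq (.setReal 6 (.lit 0))
  (.seq (.forN 4 (.var 0) (.setReal 6 (.add (.var 6) (.get 0 (.var 2) (.var 3) (.var 4)))))
  (.branch (.realLt (.lit 0) (.var 6))
    (.seq (.putNat 4 (.var 2) (.var 3) (.lit 0) (.var 3)) (.setNat 5 (.var 3)))
    (.putNat 4 (.var 2) (.var 3) (.lit 0) (.var 1))))

/-- Slots of disabled actions hold the impossible number `n` after the first pass; the second pass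
overwrites them with some enabled action. The list then has fixed length `n`, and repetitions do no
harm to an optimum. -/
def effFill (d : ℕ) : Prog d :=
  .branch (.natLt (.get 4 (.var 2) (.var 3) (.lit 0)) (.var 1)) .nop
    (.putNat 4 (.var 2) (.var 3) (.lit 0) (.var 5))

/-- Lists the enabled actions of a location, with repetitions. -/
def effRow (d : ℕ) : Prog d :=
  .seq (.setNat 5 (.lit 0)) (.seq (.forN 3 (.var 1) (effTest d)) (.forN 3 (.var 1) (effFill d)))

def initRow (d : ℕ) : Prog d :=
  .seq (.branch (.natLt (.lit 0) (.get 1 (.var 2) (.lit 0) (.lit 0)))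
    (.putReal 3 (.var 2) (.lit 0) (.lit 0) (.lit 1)) (.putReal 3 (.var 2) (.lit 0) (.lit 0) (.lit 0)))
    (.putReal 2 (.var 2) (.lit 0) (.lit 0) (.var 0))

def setupRow (d : ℕ) : Prog d := .seq (effRow d) (initRow d)

/-- Computes the number of intervals. -/
def findN (d : ℕ) : Prog d :=
  .seq (.setReal 3 (.lit 0))
    (.loop (.realLt (.mul (.npow (.var 3) (d + 1)) (.var 1))
      (.mul (.lit (2 ^ (d + 3))) (.npow (.var 0) (d + 2)))) (.setReal 3 (.add (.var 3) (.lit 1))))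

/-- The algorithm. -/
def netProg (d : ℕ) : Prog d :=
  .seq (.forN 2 (.var 0) (setupRow d))
  (.seq (findN d)
  (.seq (.setReal 4 (.div (.var 0) (.var 3)))
  (.seq (.setReal 10 (.lit 0))
  (.seq (.loop (.realLt (.var 10) (.var 3)) (interval d))
  (.seq (.setReal 2 (.lit 0))
    (.forN 2 (.var 0) (.setReal 2 (.add (.var 2) (.mul (.get 1 (.var 2) (.lit 0) (.lit 0))
      (.get 3 (.var 2) (.lit 0) (.lit 0)))))))))))

/-- Action number `b` is enabled in `l`. -/
def En (M : MarkovGame (Fin m) (Fin n)) (l : Fin m) (b : ℕ) : Prop :=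
  ∃ h : b < n, ⟨b, h⟩ ∈ M.enabled l

theorem effTest_keep (d : ℕ) :
    (effTest d).onRow 2 ∧ (∀ x, x ≠ 4 ∧ x ≠ 5 → (effTest d).keepN x) ∧
    (∀ x, x ≠ 6 → (effTest d).keepR x) ∧ (∀ x, x ≠ 4 → (effTest d).keepNA x) ∧
    ∀ x, (effTest d).keepRA x := by
  refine ⟨?_, fun x hx => ?_, fun x hx => ?_, fun x hx => ?_, fun x => ?_⟩ <;>
    simp_all [effTest, Prog.keepN, Prog.keepR, Prog.keepNA, Prog.keepRA, Prog.onRow]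

theorem setupRow_keep (d : ℕ) :
    (setupRow d).onRow 2 ∧ (∀ x, x ≠ 3 ∧ x ≠ 4 ∧ x ≠ 5 → (setupRow d).keepN x) ∧
    (∀ x, x ≠ 6 → (setupRow d).keepR x) ∧ (∀ x, x ≠ 4 → (setupRow d).keepNA x) ∧
    ∀ x, x ≠ 2 ∧ x ≠ 3 → (setupRow d).keepRA x := by
  refine ⟨?_, fun x hx => ?_, fun x hx => ?_, fun x hx => ?_, fun x hx => ?_⟩ <;>
    simp_all [setupRow, effRow, effFill, initRow, effTest, Prog.keepN, Prog.keepR, Prog.keepNA,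
      Prog.keepRA, Prog.onRow]

theorem effTest_runs (M : MarkovGame (Fin m) (Fin n)) (l : Fin m) {s : Store} {a : ℕ}
    (ha : a < n) (h0 : s.nat 0 = m) (h1 : s.nat 1 = n) (h2 : s.nat 2 = l) (h3 : s.nat 3 = a)
    (hr : ∀ (a : Fin n) (l' : Fin m), s.realArr 0 l a l' = M.rate l a l') :
    Runs (effTest d) s (40 * (m + 1)) (fun s' =>
      (∀ b ≠ a, s'.natArr 4 l b 0 = s.natArr 4 l b 0) ∧
      (En M l a → s'.natArr 4 l a 0 = a ∧ s'.nat 5 = a) ∧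
      (¬ En M l a → s'.natArr 4 l a 0 = n ∧ s'.nat 5 = s.nat 5)) := by
  have hs1 : Runs (d := d) (.setReal 6 (.lit 0)) s 2 (fun s' => s' = s.setReal 6 0) :=
    ⟨_, _, .setReal _ _ _, by simp [RExpr.cost], by simp [RExpr.eval]⟩
  set s1 := s.setReal 6 0 with hs1'
  set p : Prog d := .setReal 6 (.add (.var 6) (.get 0 (.var 2) (.var 3) (.var 4))) with hp
  have hn : ∀ x, p.keepN x := fun x => trivial
  have hloop : Runs (.forN 4 (.var 0) p) s1 ((7 + 1 + 10) * (m + 1)) (fun s' =>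
      s'.real 6 = ∑ l' ∈ Finset.range m, s.realArr 0 l a l' ∧ Frame (.forN 4 (.var 0) p) s1 s') := by
    refine Runs.forN (s := s1) (x := 4) (e := .var 0) (p := p) (c := 7) (N := m) trivial
      (fun s' hF => (hF.nat 0 (Prog.keepN_forN.2 ⟨by omega, hn 0⟩)).trans h0)
      (fun i s' => s'.real 6 = ∑ l' ∈ Finset.range i, s.realArr 0 l a l')
      (fun _ _ _ h => h)
      (by simp [s1, Store.setReal]) ?_
    intro i hi s' hF hi' h
    have e2 : s'.nat 2 = l := (hF.nat 2 (Prog.keepN_forN.2 ⟨by omega, hn _⟩)).trans h2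
    have e3 : s'.nat 3 = a := (hF.nat 3 (Prog.keepN_forN.2 ⟨by omega, hn _⟩)).trans h3
    have e0 : s'.realArr 0 = s.realArr 0 := hF.realArr 0 (Prog.keepRA_forN.2 trivial)
    refine ⟨_, _, .setReal _ _ _, by simp [RExpr.cost, NExpr.cost], ?_⟩
    simp [Store.setReal, RExpr.eval, NExpr.eval, h, e2, e3, hi', e0, Finset.sum_range_succ]
  have hEn : En M l a ↔ 0 < ∑ l' ∈ Finset.range m, s.realArr 0 l a l' := by
    rw [← Fin.sum_univ_eq_sum_range (fun l' => s.realArr 0 l a l') m,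
      Finset.sum_congr rfl fun l' _ => hr ⟨a, ha⟩ l']
    have : En M l a ↔ 0 < ∑ l', M.rate l ⟨a, ha⟩ l' := 
      ⟨fun ⟨_, h⟩ => (Finset.mem_filter.1 h).2,
        fun h => ⟨ha, Finset.mem_filter.2 ⟨Finset.mem_univ _, h⟩⟩⟩
    rw [this]
    exact_mod_cast Iff.rfl
  refine (hs1.seq_eq (hloop.seq (c' := 20) ?_)).mono (by nlinarith) fun _ h => h
  rintro s2 ⟨h6, hF⟩
  have e2 : s2.nat 2 = l := (hF.nat 2 (Prog.keepN_forN.2 ⟨by omega, hn _⟩)).trans h2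
  have e3 : s2.nat 3 = a := (hF.nat 3 (Prog.keepN_forN.2 ⟨by omega, hn _⟩)).trans h3
  have e1 : s2.nat 1 = n := (hF.nat 1 (Prog.keepN_forN.2 ⟨by omega, hn _⟩)).trans h1
  have e5 : s2.nat 5 = s.nat 5 := hF.nat 5 (Prog.keepN_forN.2 ⟨by omega, hn _⟩)
  have e4 : s2.natArr 4 = s.natArr 4 := hF.natArr 4 (Prog.keepNA_forN.2 trivial)
  refine (Runs.straight (p := .branch (.realLt (.lit 0) (.var 6))
    (.seq (.putNat 4 (.var 2) (.var 3) (.lit 0) (.var 3)) (.setNat 5 (.var 3)))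
    (.putNat 4 (.var 2) (.var 3) (.lit 0) (.var 1))) ⟨⟨trivial, trivial⟩, trivial⟩ ?_).mono ?_
    fun _ h => h
  · refine ⟨fun hb => ?_, fun hb => ?_⟩
    · have hen : En M l a := by
        rw [hEn, ← h6]
        simpa [BExpr.Holds, RExpr.eval] using hb
      simp only [Prog.wp, NExpr.eval, Store.setNat, Store.putNat, e2, e3]
      refine ⟨fun b hb => ?_, fun _ => ?_, fun h => absurd hen h⟩
      · simp [hb, e4]
      · simp
    · have hen : ¬ En M l a := by
        rw [hEn, ← h6]
        simpa [BExpr.Holds, RExpr.eval] using hb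
      simp only [Prog.wp, NExpr.eval, Store.putNat, e2, e3]
      refine ⟨fun b hb => ?_, fun h => absurd h hen, fun _ => ?_⟩
      · simp [hb, e4]
      · simp [e1, e5]
  · simp [Prog.bound, BExpr.cost, RExpr.cost, NExpr.cost]

/-- Scalar `5` ends up holding the last enabled action, which exists by the definition of a game. -/
theorem effRow_runs (M : MarkovGame (Fin m) (Fin n)) (l : Fin m) {s : Store}
    (h0 : s.nat 0 = m) (h1 : s.nat 1 = n) (h2 : s.nat 2 = l)
    (hr : ∀ (a : Fin n) (l' : Fin m), s.realArr 0 l a l' = M.rate l a l') :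
    Runs (effRow d) s (100 * ((m + 1) * (n + 1))) (fun s' => ∀ b < n,
      En M l (s'.natArr 4 l b 0) ∧ (En M l b → s'.natArr 4 l b 0 = b)) := by
  obtain ⟨k1, k2, k3, k4, k5⟩ := effTest_keep d
  obtain ⟨⟨a1, ha1⟩, hen⟩ : ∃ a : Fin n, En M l a := by
    obtain ⟨a, ha⟩ := M.enabled_nonempty l
    exact ⟨a, a.2, ha⟩
  have hs1 : Runs (d := d) (.setNat 5 (.lit 0)) s 2 (fun s' => s' = s.setNat 5 0) :=
    ⟨_, _, .setNat _ _ _, by simp [NExpr.cost], by simp [NExpr.eval]⟩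
  set s1 := s.setNat 5 0 with hs1'
  have e : ∀ x, x < 3 → s1.nat x = s.nat x := fun x hx => Function.update_of_ne (by omega) _ _
  have hloop : Runs (.forN 3 (.var 1) (effTest d)) s1 ((40 * (m + 1) + 1 + 10) * (n + 1)) (fun s' =>
      ((∀ b < n, (En M l b → s'.natArr 4 l b 0 = b) ∧ (¬ En M l b → s'.natArr 4 l b 0 = n)) ∧
      ((∃ b < n, En M l b) → En M l (s'.nat 5))) ∧ Frame (.forN 3 (.var 1) (effTest d)) s1 s') := by
    refine Runs.forN (x := 3) (e := .var 1) (p := effTest d) (c := 40 * (m + 1)) (N := n)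
      (k2 3 (by omega))
      (fun s' hF => (hF.nat 1 (Prog.keepN_forN.2 ⟨by omega, k2 1 (by omega)⟩)).trans
        ((e 1 (by omega)).trans h1))
      (fun a s' => (∀ b < a, (En M l b → s'.natArr 4 l b 0 = b) ∧
        (¬ En M l b → s'.natArr 4 l b 0 = n)) ∧ ((∃ b < a, En M l b) → En M l (s'.nat 5)))
      ?_ (by simp) ?_
    · exact fun i s v h => ⟨h.1, by simpa [Store.setNat] using h.2⟩
    intro a ha s' hF ha' ⟨hI1, hI2⟩
    have e' : ∀ x, x < 3 → s'.nat x = s.nat x := fun x hx =>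
      (hF.nat x (Prog.keepN_forN.2 ⟨by omega, k2 x (by omega)⟩)).trans (e x hx)
    refine (effTest_runs M l ha ((e' 0 (by omega)).trans h0) ((e' 1 (by omega)).trans h1)
      ((e' 2 (by omega)).trans h2) ha' ?_).weaken ?_
    · rw [hF.realArr 0 (Prog.keepRA_forN.2 (k5 0))]
      exact hr
    · rintro s'' ⟨g1, g2, g3⟩
      refine ⟨fun b hb => ?_, ?_⟩
      · rcases Nat.lt_succ_iff_lt_or_eq.1 hb with h | rfl
        · rw [g1 b h.ne]
          exact hI1 b h
        · exact ⟨fun h => (g2 h).1, fun h => (g3 h).1⟩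
      · rintro ⟨b, hb, hbe⟩
        by_cases hae : En M l a
        · rw [(g2 hae).2]
          exact hae
        · rw [(g3 hae).2]
          rcases Nat.lt_succ_iff_lt_or_eq.1 hb with h | rfl
          · exact hI2 ⟨b, h, hbe⟩
          · exact absurd hbe hae
  refine (hs1.seq_eq (hloop.seq (c' := (20 + 1 + 10) * (n + 1)) ?_)).mono (by nlinarith) fun _ h => h
  rintro s2 ⟨⟨hI1, hI2⟩, hF2⟩
  have hI2 := hI2 ⟨a1, ha1, hen⟩
  have e' : ∀ x, x < 3 → s2.nat x = s.nat x := fun x hx =>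
    (hF2.nat x (Prog.keepN_forN.2 ⟨by omega, k2 x (by omega)⟩)).trans (e x hx)
  have kf : ∀ x, (effFill d).keepN x := fun x => ⟨trivial, trivial⟩
  refine (Runs.forN (x := 3) (e := .var 1) (p := effFill d) (c := 20) (N := n) (kf 3)
    (fun s' hF => (hF.nat 1 (Prog.keepN_forN.2 ⟨by omega, kf 1⟩)).trans
        ((e' 1 (by omega)).trans h1))
    (fun a s' => ∀ b < n, (En M l b → s'.natArr 4 l b 0 = b) ∧
        (¬ En M l b → s'.natArr 4 l b 0 = if b < a then s2.nat 5 else n))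
    (fun _ _ _ h => h) (by simpa using hI1) ?_).weaken ?_
  · intro a ha s' hF ha' hI
    have f : ∀ x, x ≠ 3 → s'.nat x = s2.nat x := fun x hx =>
      hF.nat x (Prog.keepN_forN.2 ⟨hx, kf x⟩)
    have f2 : s'.nat 2 = l := (f 2 (by omega)).trans ((e' 2 (by omega)).trans h2)
    have f1 : s'.nat 1 = n := (f 1 (by omega)).trans ((e' 1 (by omega)).trans h1)
    refine (Runs.straight (p := effFill d) ⟨trivial, trivial⟩ ?_).mono ?_ fun _ h => h
    · refine ⟨fun hb => ?_, fun hb => ?_⟩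
      · simp only [BExpr.Holds, NExpr.eval, f2, f1, ha'] at hb
        have hae : En M l a := by
          by_contra h
          rw [(hI a ha).2 h] at hb
          simp at hb
        intro b hbn
        refine ⟨(hI b hbn).1, fun h => ?_⟩
        have : b ≠ a := fun h' => h (h' ▸ hae)
        rw [(hI b hbn).2 h]
        simp only [(by omega : b < a + 1 ↔ b < a)]
      · simp only [BExpr.Holds, NExpr.eval, f2, f1, ha'] at hb
        have hae : ¬ En M l a := by
          intro h
          rw [(hI a ha).1 h] at hb
          exact hb ha
        simp only [Prog.wp, NExpr.eval, f2, ha', f 5 (by omega)]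
        intro b hbn
        by_cases hba : b = a
        · subst hba
          exact ⟨fun h => absurd h hae, fun _ => by simp [Store.putNat]⟩
        · simp only [Store.putNat, hba, and_false, false_and, if_false]
          refine ⟨(hI b hbn).1, fun h => ?_⟩
          rw [(hI b hbn).2 h]
          simp only [(by omega : b < a + 1 ↔ b < a)]
    · simp [effFill, Prog.bound, BExpr.cost, NExpr.cost]
  · rintro s' ⟨hI, -⟩ b hb
    refine ⟨?_, (hI b hb).1⟩
    by_cases h : En M l b
    · rw [(hI b hb).1 h]
      exact h
    · rw [(hI b hb).2 h, if_pos hb]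
      exact hI2

end CTMG
end

/-! ### Correctness of the set-up, the number of intervals, and the whole program -/

noncomputable section

namespace CTMG

variable {d m n : ℕ}

theorem effRow_keep (d : ℕ) :
    (∀ x, x ≠ 3 ∧ x ≠ 4 ∧ x ≠ 5 → (effRow d).keepN x) ∧
    (∀ x, x ≠ 6 → (effRow d).keepR x) ∧ (∀ x, x ≠ 4 → (effRow d).keepNA x) ∧
    ∀ x, (effRow d).keepRA x := by
  refine ⟨fun x hx => ?_, fun x hx => ?_, fun x hx => ?_, fun x => ?_⟩ <;>
    simp_all [effRow, effFill, effTest, Prog.keepN, Prog.keepR, Prog.keepNA, Prog.keepRA]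

theorem setupRow_runs (M : MarkovGame (Fin m) (Fin n)) (G : Finset (Fin m)) (T : ℝ) (l : Fin m)
    {s : Store} (h0 : s.nat 0 = m) (h1 : s.nat 1 = n) (h2 : s.nat 2 = l)
    (hr : ∀ (a : Fin n) (l' : Fin m), s.realArr 0 l a l' = M.rate l a l') (hT : s.real 0 = T)
    (hG : 0 < s.natArr 1 l 0 0 ↔ l ∈ G) :
    Runs (setupRow d) s (100 * ((m + 1) * (n + 1)) + 40) (fun s' =>
      (∀ b < n, En M l (s'.natArr 4 l b 0) ∧ (En M l b → s'.natArr 4 l b 0 = b)) ∧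
      s'.realArr 3 l 0 0 = (if l ∈ G then 1 else 0) ∧ s'.realArr 2 l 0 0 = T) := by
  obtain ⟨k1, k2, k3, k4⟩ := effRow_keep d
  refine (effRow_runs M l h0 h1 h2 hr).frame.seq ?_
  rintro s' ⟨hI, hF⟩
  have e2 : s'.nat 2 = l := (hF.nat 2 (k1 2 (by omega))).trans h2
  have e0 : s'.real 0 = T := (hF.real 0 (k2 0 (by omega))).trans hT
  have e1 : s'.natArr 1 = s.natArr 1 := hF.natArr 1 (k3 1 (by omega))
  refine (Runs.straight (p := initRow d) ⟨⟨trivial, trivial⟩, trivial⟩ ?_).mono ?_ fun _ h => h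
  · refine ⟨fun hb => ?_, fun hb => ?_⟩
    · simp only [BExpr.Holds, NExpr.eval, e2, e1, hG] at hb
      simp only [Prog.wp, NExpr.eval, RExpr.eval, Store.putReal, e2, hb, if_true]
      exact ⟨hI, by simp, by simp [e0]⟩
    · simp only [BExpr.Holds, NExpr.eval, e2, e1, hG] at hb
      simp only [Prog.wp, NExpr.eval, RExpr.eval, Store.putReal, e2, hb, if_false]
      exact ⟨hI, by simp, by simp [e0]⟩
  · simp [initRow, Prog.bound, BExpr.cost, NExpr.cost, RExpr.cost]

theorem setup_runs (M : MarkovGame (Fin m) (Fin n)) (G : Finset (Fin m)) (T π : ℝ) :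
    Runs (.forN 2 (.var 0) (setupRow d)) (inputStore M G T π)
      ((100 * ((m + 1) * (n + 1)) + 40 + 1 + 10) * (m + 1)) (fun s => GameOK M s ∧ s.real 0 = T ∧
        s.real 1 = π ∧ (∀ l : Fin m, s.realArr 1 l 0 0 = M.init l) ∧
        (∀ l : Fin m, s.realArr 3 l 0 0 = if l ∈ G then 1 else 0) ∧
        ∀ l < m, s.realArr 2 l 0 0 = T ∧ s.natArr 2 l 0 0 = 0) := by
  obtain ⟨k1, k2, k3, k4, k5⟩ := setupRow_keep d
  set s := inputStore M G T π with hs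
  have i0 : s.nat 0 = m := rfl
  have i1 : s.nat 1 = n := rfl
  have iT : s.real 0 = T := rfl
  have iπ : s.real 1 = π := rfl
  have ir : ∀ (l : Fin m) (a : Fin n) (l' : Fin m), s.realArr 0 l a l' = M.rate l a l' := by
    intro l a l'
    simp [s, inputStore]
  have iR : ∀ l : Fin m, 0 < s.natArr 0 l 0 0 ↔ l ∈ M.reach := by
    intro l
    by_cases h : l ∈ M.reach <;> simp [s, inputStore, h]
  have iG : ∀ l : Fin m, 0 < s.natArr 1 l 0 0 ↔ l ∈ G := by
    intro l
    by_cases h : l ∈ G <;> simp [s, inputStore, h]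
  have ii : ∀ l : Fin m, s.realArr 1 l 0 0 = M.init l := by
    intro l
    simp [s, inputStore]
  have i2 : ∀ l, s.natArr 2 l 0 0 = 0 := by
    intro l
    simp [s, inputStore]
  refine (Runs.forRows (s := s) (x := 2) (e := .var 0) (p := setupRow d)
    (c := 100 * ((m + 1) * (n + 1)) + 40) (N := m) k1 (k2 2 (by omega))
    (fun s' hF => (hF.nat 0 (Prog.keepN_forN.2 ⟨by omega, k2 0 (by omega)⟩)).trans i0)
    (fun l s' => ∀ hl : l < m, (∀ b < n, En M ⟨l, hl⟩ (s'.natArr 4 l b 0) ∧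
      (En M ⟨l, hl⟩ b → s'.natArr 4 l b 0 = b)) ∧
      s'.realArr 3 l 0 0 = (if ⟨l, hl⟩ ∈ G then 1 else 0) ∧ s'.realArr 2 l 0 0 = T) ?_ ?_).weaken ?_
  · rintro l s1 s2 ⟨hr1, hr2⟩ h hl
    obtain ⟨a1, a2, a3⟩ := h hl
    exact ⟨by rw [hr1]; exact a1, by rw [hr2]; exact a2, by rw [hr2]; exact a3⟩
  · rintro l hl s' hF hl' -
    have e : ∀ x, x < 2 → s'.nat x = s.nat x := fun x hx =>
      hF.nat x (Prog.keepN_forN.2 ⟨by omega, k2 x (by omega)⟩)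
    refine (setupRow_runs M G T ⟨l, hl⟩ ((e 0 (by omega)).trans i0) ((e 1 (by omega)).trans i1)
      hl' ?_ ((hF.real 0 (Prog.keepR_forN.2 (k3 0 (by omega)))).trans iT) ?_).weaken
      fun _ h _ => h
    · rw [hF.realArr 0 (Prog.keepRA_forN.2 (k5 0 (by omega)))]
      exact ir ⟨l, hl⟩
    · rw [hF.natArr 1 (Prog.keepNA_forN.2 (k4 1 (by omega)))]
      exact iG ⟨l, hl⟩
  · rintro s' ⟨h, hF⟩
    have e : ∀ x, x < 2 → s'.nat x = s.nat x := fun x hx =>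
      hF.nat x (Prog.keepN_forN.2 ⟨by omega, k2 x (by omega)⟩)
    have er : ∀ x, x < 2 → s'.real x = s.real x := fun x hx =>
      hF.real x (Prog.keepR_forN.2 (k3 x (by omega)))
    refine ⟨⟨(e 0 (by omega)).trans i0, (e 1 (by omega)).trans i1, ?_, ?_, ?_, ?_⟩,
      (er 0 (by omega)).trans iT, (er 1 (by omega)).trans iπ, ?_, ?_, ?_⟩
    · rw [hF.realArr 0 (Prog.keepRA_forN.2 (k5 0 (by omega)))]
      exact ir
    · rw [hF.natArr 0 (Prog.keepNA_forN.2 (k4 0 (by omega)))]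
      exact iR
    · intro l b hb
      exact ((h l l.2 l.2).1 b hb).1
    · intro l b hb
      exact ((h l l.2 l.2).1 b b.2).2 ⟨b.2, hb⟩
    · rw [hF.realArr 1 (Prog.keepRA_forN.2 (k5 1 (by omega)))]
      exact ii
    · intro l
      exact (h l l.2 l.2).2.1
    · intro l hl
      refine ⟨(h l hl hl).2.2, ?_⟩
      rw [hF.natArr 2 (Prog.keepNA_forN.2 (k4 2 (by omega)))]
      exact i2 l

/-- The least number of intervals for which the error bound is at most `π`. -/
structure IsNumber (d : ℕ) (T π : ℝ) (N : ℕ) : Prop where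
  le : 2 ^ (d + 3) * T ^ (d + 2) ≤ (N : ℝ) ^ (d + 1) * π
  lt : ∀ i < N, (i : ℝ) ^ (d + 1) * π < 2 ^ (d + 3) * T ^ (d + 2)

theorem exists_isNumber (d : ℕ) {T π : ℝ} (hπ : 0 < π) : ∃ N, IsNumber d T π N := by
  have h : ∃ N : ℕ, 2 ^ (d + 3) * T ^ (d + 2) ≤ (N : ℝ) ^ (d + 1) * π := by
    obtain ⟨N, hN⟩ := exists_nat_ge (2 ^ (d + 3) * T ^ (d + 2) / π)
    refine ⟨N, ?_⟩
    rw [div_le_iff₀ hπ] at hN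
    refine hN.trans (mul_le_mul_of_nonneg_right ?_ hπ.le)
    exact_mod_cast Nat.le_self_pow (by omega) N
  classical
  exact ⟨Nat.find h, Nat.find_spec h, fun i hi => not_le.1 (Nat.find_min h hi)⟩

/-- Without rounding or conversion between the two sorts, the number of intervals is found by
counting up in a real variable. This costs `O(N + 1)`, which the main loop dominates. -/
theorem findN_runs (s : Store) {N : ℕ} {T π : ℝ} (hT : s.real 0 = T) (hπ : s.real 1 = π)
    (hN : IsNumber d T π N) :
    ∃ K, K = 4 + (BExpr.realLt (.mul (.npow (.var 3) (d + 1)) (.var 1))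
      (.mul (.lit (2 ^ (d + 3))) (.npow (.var 0) (d + 2))) : BExpr d).cost + 1 + 2 ∧
    Runs (findN d) s (K * (N + 1)) (fun s' => s' = s.setReal 3 N) := by
  refine ⟨_, rfl, ?_⟩
  set b : BExpr d := .realLt (.mul (.npow (.var 3) (d + 1)) (.var 1))
      (.mul (.lit (2 ^ (d + 3))) (.npow (.var 0) (d + 2))) with hb
  have hs1 : Runs (d := d) (.setReal 3 (.lit 0)) s 2 (fun s' => s' = s.setReal 3 (0 : ℕ)) :=
    ⟨_, _, .setReal _ _ _, by simp [RExpr.cost], by simp [RExpr.eval]⟩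
  have hholds : ∀ i : ℕ, b.Holds (s.setReal 3 i) ↔
      (i : ℝ) ^ (d + 1) * π < 2 ^ (d + 3) * T ^ (d + 2) := by
    intro i
    have e1 : (s.setReal 3 i).real 1 = π := hπ
    have e0 : (s.setReal 3 i).real 0 = T := hT
    have e3 : (s.setReal 3 i).real 3 = i := by simp [Store.setReal]
    simp [hb, BExpr.Holds, RExpr.eval, e0, e1, e3]
  have hloop := Runs.loop (b := b) (p := .setReal 3 (.add (.var 3) (.lit 1))) (c := 4)
    (fun k s' => ∃ i : ℕ, i + k = N ∧ s' = s.setReal 3 i) (by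
      rintro k _ ⟨i, hi, rfl⟩ h
      rw [hholds] at h
      have hiN : i ≠ N := by
        rintro rfl
        exact absurd h (not_lt.2 hN.le)
      refine ⟨k - 1, by omega, _, _, .setReal _ _ _, by simp [RExpr.cost], i + 1, by omega, ?_⟩
      simp [RExpr.eval, Store.setReal]) N _ ⟨0, by omega, rfl⟩
  refine (hs1.seq_eq hloop).mono (by nlinarith) ?_
  rintro _ ⟨hnb, k, i, hi, rfl⟩
  rw [hholds] at hnb
  have : ¬ i < N := fun h => hnb (hN.lt i h)
  obtain rfl : i = N := by omega
  rfl

theorem result_runs (M : MarkovGame (Fin m) (Fin n)) {G : Finset (Fin m)} {k N c : ℕ} {T : ℝ}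
    {s : Store} (hI : NetInv M G k N T c s) :
    Runs (.seq (.setReal 2 (.lit 0))
      (.forN 2 (.var 0) (.setReal 2 (.add (.var 2) (.mul (.get 1 (.var 2) (.lit 0) (.lit 0))
        (.get 3 (.var 2) (.lit 0) (.lit 0))))) : Prog d)) s (40 * (m + 1))
      (fun s' => NetInv M G k N T c s' ∧
        s'.real 2 = ∑ l : Fin m, M.init l * s'.realArr 3 l 0 0) := by
  have hs1 : Runs (d := d) (.setReal 2 (.lit 0)) s 2 (fun s' => s' = s.setReal 2 0) :=
    ⟨_, _, .setReal _ _ _, by simp [RExpr.cost], by simp [RExpr.eval]⟩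
  set p : Prog d := .setReal 2 (.add (.var 2) (.mul (.get 1 (.var 2) (.lit 0) (.lit 0))
        (.get 3 (.var 2) (.lit 0) (.lit 0)))) with hp
  have hn : ∀ x, p.keepN x := fun x => trivial
  have hloop : Runs (.forN 2 (.var 0) p) (s.setReal 2 0) ((12 + 1 + 10) * (m + 1)) _ :=
    Runs.forN (s := s.setReal 2 0) (x := 2) (e := .var 0) (p := p) (c := 12) (N := m) trivial
      (fun s' hF => (hF.nat 0 (Prog.keepN_forN.2 ⟨by omega, hn 0⟩)).trans hI.game.n0)
      (fun i s' => s'.real 2 = ∑ l ∈ Finset.range i, s.realArr 1 l 0 0 * s.realArr 3 l 0 0)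
      (fun _ _ _ h => h) (by simp [Store.setReal]) (by
        intro i hi s' hF hi' h
        have e1 : s'.realArr 1 = s.realArr 1 := hF.realArr 1 (Prog.keepRA_forN.2 trivial)
        have e3 : s'.realArr 3 = s.realArr 3 := hF.realArr 3 (Prog.keepRA_forN.2 trivial)
        refine ⟨_, _, .setReal _ _ _, by simp [RExpr.cost, NExpr.cost], ?_⟩
        simp [Store.setReal, RExpr.eval, NExpr.eval, h, hi', e1, e3, Finset.sum_range_succ])
  refine (hs1.seq_eq hloop).mono (by nlinarith) ?_
  rintro s' ⟨h, hF⟩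
  have hna : s'.natArr = s.natArr := by
    funext x
    exact hF.natArr x (Prog.keepNA_forN.2 trivial)
  have hra : s'.realArr = s.realArr := by
    funext x
    exact hF.realArr x (Prog.keepRA_forN.2 trivial)
  have hr : ∀ x, x ≠ 2 → s'.real x = s.real x := fun x hx =>
    (hF.real x (Prog.keepR_forN.2 hx)).trans (Function.update_of_ne hx _ _)
  have hnat : ∀ x, x ≠ 2 → s'.nat x = s.nat x := fun x hx =>
    hF.nat x (Prog.keepN_forN.2 ⟨hx, hn x⟩)
  refine ⟨hI.of_same (hnat 0 (by omega)) (hnat 1 (by omega)) (fun x hx => hr x (by omega)) hna hra,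
    ?_⟩
  rw [h, ← Fin.sum_univ_eq_sum_range (fun l => s.realArr 1 l 0 0 * s.realArr 3 l 0 0), hra]
  exact Finset.sum_congr rfl fun l _ => by rw [hI.init]

/-- For `T = 0` no interval is computed, and the quotient `0 / 0` for the interval length is
harmless. -/
theorem netProg_runs (hd : d = 2 ∨ d = 3) : ∃ K : ℕ, ∀ (m n : ℕ) (M : MarkovGame (Fin m) (Fin n))
    (G : Finset (Fin m)) (T π : ℝ) (N : ℕ), M.IsNormed → 0 < m → 0 < n → 0 ≤ T →
    IsNumber d T π N → (T = 0 → N = 0) →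
    Runs (netProg d) (inputStore M G T π) (K * (m ^ d * n ^ (2 * d) * (N + 1))) (fun s =>
      NetInv M G (d + 1) N T N s ∧ s.real 2 = ∑ l : Fin m, M.init l * s.realArr 3 l 0 0) := by
  obtain ⟨K, hK⟩ := interval_runs hd
  refine ⟨2000 + (4 + (BExpr.realLt (.mul (.npow (.var 3) (d + 1)) (.var 1))
      (.mul (.lit (2 ^ (d + 3))) (.npow (.var 0) (d + 2))) : BExpr d).cost + 1 + 2) + (K + 4),
    fun m n M G T π N hM hm hn hT hN hN0 => ?_⟩
  have hP : (m + 1) * (n + 1) * (m + 1) ≤ 8 * (m ^ d * n ^ (2 * d)) ∧ m + 1 ≤ 2 * (m ^ d * n ^ (2 * d))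
      ∧ 1 ≤ m ^ d * n ^ (2 * d) := by
    have h1 : m ^ 2 * n ≤ m ^ d * n ^ (2 * d) :=
      Nat.mul_le_mul (Nat.pow_le_pow_right hm (by omega)) (Nat.le_self_pow (by omega) n)
    refine ⟨?_, ?_, Nat.one_le_iff_ne_zero.2 (by positivity)⟩
    · calc _ ≤ (2 * m) * (2 * n) * (2 * m) :=
            Nat.mul_le_mul (Nat.mul_le_mul (by omega) (by omega)) (by omega)
        _ = 8 * (m ^ 2 * n) := by ring
        _ ≤ _ := Nat.mul_le_mul_left _ h1
    · calc m + 1 ≤ 2 * (m * m * n) := by nlinarith [Nat.mul_pos hm hn]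
        _ = 2 * (m ^ 2 * n) := by ring
        _ ≤ _ := Nat.mul_le_mul_left _ h1
  have hsetup := setup_runs (d := d) M G T π
  have hloop : ∀ s, NetInv M G (d + 1) N T 0 s → Runs (.loop (.realLt (.var 10) (.var 3)) (interval d))
      s ((K * (m ^ d * n ^ (2 * d)) + 3 + 1) * (N + 1)) (NetInv M G (d + 1) N T N) := by
    intro s hs
    have key : ∀ (c : ℕ) (s' : Store), NetInv M G (d + 1) N T c s' →
        (BExpr.Holds (d := d) s' (.realLt (.var 10) (.var 3)) ↔ c < N) := by
      intro c s' h
      simp [BExpr.Holds, RExpr.eval, h.count, h.number]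
    refine (Runs.loop (b := .realLt (.var 10) (.var 3)) (p := interval d)
      (c := K * (m ^ d * n ^ (2 * d)))
      (fun k s' => ∃ c, c + k = N ∧ NetInv M G (d + 1) N T c s') ?_ N s ⟨0, by omega, hs⟩).mono
      le_rfl ?_
    · rintro k s' ⟨c, hc, h⟩ hb
      rw [key c s' h] at hb
      -- The body of the loop runs only if `N > 0`, which excludes `T = 0`; so the interval length
      -- is positive.
      have hT' : 0 < T := by
        refine lt_of_le_of_ne hT fun h => ?_
        have := hN0 h.symm
        omega
      exact ⟨k - 1, by omega, (hK m n M G T N c s' hM hm hn hT' hb h).weaken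
        fun s'' h'' => ⟨c + 1, by omega, h''⟩⟩
    · rintro s' ⟨hnb, k, c, hc, h⟩
      rw [key c s' h] at hnb
      obtain rfl : c = N := by omega
      exact h
  refine (hsetup.seq (c' := (4 + (BExpr.realLt (.mul (.npow (.var 3) (d + 1)) (.var 1))
      (.mul (.lit (2 ^ (d + 3))) (.npow (.var 0) (d + 2))) : BExpr d).cost + 1 + 2) * (N + 1) +
      (4 + (2 + ((K * (m ^ d * n ^ (2 * d)) + 3 + 1) * (N + 1) + 40 * (m + 1))))) ?_).mono ?_
      fun _ h => h
  · rintro s1 ⟨g1, g2, g3, g4, g5, g6⟩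
    obtain ⟨_, rfl, hf⟩ := findN_runs (d := d) s1 g2 g3 hN
    refine hf.seq_eq ?_
    have h4 : Runs (d := d) (.setReal 4 (.div (.var 0) (.var 3))) (s1.setReal 3 N) 4
        (fun s' => s' = (s1.setReal 3 N).setReal 4 (T / N)) := by
      refine ⟨_, _, .setReal _ _ _, by simp [RExpr.cost], ?_⟩
      have e0 : (s1.setReal 3 N).real 0 = T := g2
      have e3 : (s1.setReal 3 N).real 3 = N := by simp [Store.setReal]
      simp [RExpr.eval, e0, e3]
    refine h4.seq_eq ?_
    have h10 : Runs (d := d) (.setReal 10 (.lit 0)) ((s1.setReal 3 N).setReal 4 (T / N)) 2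
        (fun s' => s' = ((s1.setReal 3 N).setReal 4 (T / N)).setReal 10 0) :=
      ⟨_, _, .setReal _ _ _, by simp [RExpr.cost], by simp [RExpr.eval]⟩
    refine h10.seq_eq ((hloop _ ?_).seq fun s' hs' => result_runs M hs')
    refine ⟨g1.congr (fun _ _ => rfl) rfl rfl rfl, g2, ?_, ?_, ?_, ?_, fun l hl => ?_, g4⟩
    · simp [Store.setReal]
    · simp [Store.setReal]
    · simp [Store.setReal]
    · exact g5
    · obtain ⟨o1, o2⟩ := g6 l hl
      refine ⟨o1, ?_, fun q hq => ?_⟩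
      · show s1.realArr 2 l (s1.natArr 2 l 0 0) 0 = _
        rw [o2, o1]
        simp
      · have hq : q < s1.natArr 2 l 0 0 := hq
        omega
  · obtain ⟨p1, p2, p3⟩ := hP
    generalize m ^ d * n ^ (2 * d) = P at *
    generalize BExpr.cost _ = b
    have q1 : (100 * ((m + 1) * (n + 1)) + 40 + 1 + 10) * (m + 1) ≤ 902 * P := by
      calc _ = 100 * ((m + 1) * (n + 1) * (m + 1)) + 51 * (m + 1) := by ring
        _ ≤ _ := by omega
    have q2 : (4 + b + 1 + 2) * (N + 1) ≤ (4 + b + 1 + 2) * (P * (N + 1)) :=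
      Nat.mul_le_mul_left _ (Nat.le_mul_of_pos_left _ p3)
    have q3 : (K * P + 3 + 1) * (N + 1) ≤ (K + 4) * (P * (N + 1)) := by
      rw [← mul_assoc]
      refine Nat.mul_le_mul_right _ ?_
      nlinarith
    have q4 : P ≤ P * (N + 1) := Nat.le_mul_of_pos_right _ (by omega)
    calc _ ≤ 902 * P + ((4 + b + 1 + 2) * (P * (N + 1)) + (4 + (2 + ((K + 4) * (P * (N + 1)) +
          40 * (m + 1))))) :=
          Nat.add_le_add q1 (Nat.add_le_add q2 (Nat.add_le_add_left (Nat.add_le_add_left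
            (Nat.add_le_add_right q3 _) _) _))
      _ ≤ 2000 * (P * (N + 1)) + (4 + b + 1 + 2) * (P * (N + 1)) + (K + 4) * (P * (N + 1)) := by
          omega
      _ = _ := by ring

end CTMG
end

noncomputable section

namespace CTMG

variable {m n : ℕ}

/-! ### The strategy in the table -/

/-- The action that the first `c` pieces of the table with end points `e` and actions `a` list
at time `t`. -/
def tableAct (e : ℕ → ℝ) (a : ℕ → ℕ) : ℕ → ℝ → ℕ
  | 0, _ => 0
  | c + 1, t => if e (c + 1) < t ∧ t ≤ e c then a c else tableAct e a c t

theorem tableAct_measurable (e : ℕ → ℝ) (a : ℕ → ℕ) (c : ℕ) : Measurable (tableAct e a c) := by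
  induction c with
  | zero => exact measurable_const
  | succ c ih =>
    exact Measurable.ite (measurableSet_Ioc (a := e (c + 1)) (b := e c)) measurable_const ih

theorem tableAct_eq {e : ℕ → ℝ} {a : ℕ → ℕ} {c : ℕ} (he : ∀ q < c, e (q + 1) ≤ e q) {q : ℕ}
    (hq : q < c) {t : ℝ} (ht : t ∈ Set.Ioc (e (q + 1)) (e q)) : tableAct e a c t = a q := by
  induction c with
  | zero => omega
  | succ c ih =>
    rw [tableAct]
    rcases Nat.lt_succ_iff_lt_or_eq.1 hq with h | rfl
    · have hle : e c ≤ e (q + 1) := by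
        have : ∀ j, q + 1 ≤ j → j ≤ c → e j ≤ e (q + 1) := by
          intro j hj
          induction j, hj using Nat.le_induction with
          | base => exact fun _ => le_rfl
          | succ j hj ih' => exact fun h' => (he j (by omega)).trans (ih' (by omega))
        exact this c h le_rfl
      rw [if_neg fun h' => absurd (h'.2.trans hle) (not_le.2 ht.1)]
      exact ih (fun q hq => he q (by omega)) h
    · exact if_pos ht

theorem exists_piece {e : ℕ → ℝ} {c : ℕ} {t : ℝ} (h0 : t ≤ e 0) (hc : e c < t) :
    ∃ q < c, t ∈ Set.Ioc (e (q + 1)) (e q) := by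
  induction c with
  | zero => exact absurd hc (not_lt.2 h0)
  | succ c ih =>
    by_cases h : e c < t
    · obtain ⟨q, hq, h'⟩ := ih h
      exact ⟨q, by omega, h'⟩
    · exact ⟨c, by omega, hc, not_lt.1 h⟩

open Classical in
/-- Action number `v`, if it is enabled in `l`. -/
def toAct (M : MarkovGame (Fin m) (Fin n)) (l : Fin m) (v : ℕ) : Fin n :=
  if h : En M l v then ⟨v, h.1⟩ else (M.enabled_nonempty l).choose

theorem toAct_mem (M : MarkovGame (Fin m) (Fin n)) (l : Fin m) (v : ℕ) :
    toAct M l v ∈ M.enabled l := by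
  unfold toAct
  split_ifs with h
  · exact h.2
  · exact (M.enabled_nonempty l).choose_spec

/-- Outside the table an arbitrary enabled action is played, since a strategy must be defined at all
times. Measurability holds because the action is a function of a measurable step function with
natural values. -/
def tableStrategy (M : MarkovGame (Fin m) (Fin n)) (s : Store) : M.Strategy where
  act l t := toAct M l (tableAct (fun q => s.realArr 2 l q 0) (fun q => s.natArr 3 l q 0)
    (s.natArr 2 l 0 0) t)
  measurable l a := by
    have := tableAct_measurable (fun q => s.realArr 2 l q 0) (fun q => s.natArr 3 l q 0)
      (s.natArr 2 l 0 0)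
    exact this (MeasurableSet.of_discrete (s := {v | toAct M l v = a}))
  enabled l _ := toAct_mem M l _

theorem tableStrategy_eq {M : MarkovGame (Fin m) (Fin n)} {s : Store} {l : Fin m}
    {Good : ℝ → ℕ → Prop} {T z : ℝ} (h : OutOK Good T z l s) (hGood : ∀ t a, Good t a → En M l a)
    {q : ℕ} (hq : q < s.natArr 2 l 0 0) {t : ℝ}
    (ht : t ∈ Set.Ioc (s.realArr 2 l (q + 1) 0) (s.realArr 2 l q 0)) :
    ((tableStrategy M s).act l t : ℕ) = s.natArr 3 l q 0 := by
  have h1 := tableAct_eq (e := fun q => s.realArr 2 l q 0) (a := fun q => s.natArr 3 l q 0)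
    (fun q hq => (h.step q hq).1) hq ht
  have h2 := hGood _ _ ((h.step q hq).2 t ht)
  have h3 : (tableStrategy M s).act l t = toAct M l (s.natArr 3 l q 0) :=
    congrArg (toAct M l) h1
  rw [h3, toAct, dif_pos h2]

/-- The output table covers `(0, T]` without gaps, so every time lies in one of its pieces, and the
action listed there was certified in the interval of the net that contains this time. -/
theorem NetInv.strategy {M : MarkovGame (Fin m) (Fin n)} {G : Finset (Fin m)} {k N : ℕ} {T : ℝ}
    {s : Store} (h : NetInv M G (k + 1) N T N s) (hT : 0 ≤ T) (hN : N = 0 → T = 0) :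
    ∃ σ : M.Strategy, HoldsStrategy s T σ ∧ ∃ N', 0 < N' ∧ M.FollowsNet G T (k + 1) N' σ ∧
      (∀ l : Fin m, s.realArr 3 l 0 0 = M.netGrid G (k + 1) (T / N') N' l) ∧ (N' = N ∨ T = 0) := by
  have hGood : ∀ l : Fin m, ∀ t a, GoodNet M G (k + 1) N T l t a → En M l a := by
    rintro l t a ⟨i, -, -, hl, ha, hopt⟩
    exact ⟨ha, hopt.1⟩
  -- For `N = 0` the division gives `0`, and the claim rests on `T = 0`.
  have hlast : T - N * (T / N) = 0 := by
    rcases Nat.eq_zero_or_pos N with h0 | h0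
    · simp [hN h0]
    · have : (N : ℝ) ≠ 0 := by positivity
      field_simp
      simp
  refine ⟨tableStrategy M s, fun l => ?_, ?_⟩
  · have ho := h.out l l.2
    exact ⟨ho.first, ho.last.trans hlast, fun q hq => ⟨(ho.step q hq).1, fun t ht =>
      tableStrategy_eq ho (hGood l) hq ht⟩⟩
  rcases hT.eq_or_lt with rfl | hT'
  -- For `T = 0` the program uses no interval, but a net must have at least one. A single interval
  -- of length zero is followed vacuously and has the same values.
  · refine ⟨1, one_pos, ?_, fun l => ?_, Or.inr rfl⟩
    · intro i hi t ht
      simp at ht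
    · have hgrid : ∀ N, M.netGrid G (k + 1) 0 N = M.netGrid G (k + 1) 0 0 := by
        intro N
        induction N with
        | zero => rfl
        | succ N ih =>
          rw [← ih]
          exact MarkovGame.netStep_zero _ _
      rw [h.values, zero_div, zero_div, hgrid N, hgrid 1]
  · have hN' : 0 < N := Nat.pos_of_ne_zero fun h0 => hT'.ne' (hN h0)
    have hε : 0 < T / N := div_pos hT' (by exact_mod_cast hN')
    refine ⟨N, hN', ?_, h.values, Or.inl rfl⟩
    intro i hi t ht l
    have ho := h.out l l.2
    have ht0 : 0 < t := by
      refine lt_of_le_of_lt ?_ ht.1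
      rw [← hlast]
      have : ((i : ℝ) + 1) ≤ N := by exact_mod_cast hi
      nlinarith
    have htT : t ≤ T := ht.2.trans (by have : 0 ≤ (i : ℝ) * (T / N) := by positivity
                                       linarith)
    obtain ⟨q, hq, htq⟩ := exists_piece (e := fun q => s.realArr 2 l q 0) (c := s.natArr 2 l 0 0)
      (htT.trans_eq ho.first.symm) ((ho.last.trans hlast).trans_lt ht0)
    have hact := tableStrategy_eq ho (hGood l) hq htq
    obtain ⟨i', hi', ht', hl, ha, hopt⟩ := (ho.step q hq).2 t htq
    -- The certificate of the table names some interval containing `t`; the half-open intervals are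
    -- disjoint, so it is the given one.
    have hii : i' = i := by
      have e1 : (i' : ℝ) < i + 1 := by
        by_contra h'
        nlinarith [ht.1, ht'.2, not_lt.1 h']
      have e2 : (i : ℝ) < i' + 1 := by
        by_contra h'
        nlinarith [ht'.1, ht.2, not_lt.1 h']
      have e1 : i' < i + 1 := by exact_mod_cast e1
      have e2 : i < i' + 1 := by exact_mod_cast e2
      omega
    subst hii
    have : (tableStrategy M s).act l t = ⟨s.natArr 3 l q 0, ha⟩ := Fin.ext hact
    rw [this]
    exact hopt

end CTMG
end

noncomputable section

namespace CTMG

/-! ### Transient distributions -/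

/-- A measurable family of stochastic matrices. -/
structure IsKernel {L : Type} [Fintype L] (w : L → L → ℝ → ℝ) : Prop where
  measurable : ∀ l l', Measurable (w l l')
  nonneg : ∀ l l' t, 0 ≤ w l l' t
  sum_eq : ∀ l t, ∑ l', w l l' t = 1

/-- The transient probabilities of exactly `n` jumps, multiplied with `exp t`. -/
def flow {L : Type} [Fintype L] (w : L → L → ℝ → ℝ) (μ : L → ℝ) : ℕ → ℝ → L → ℝ
  | 0, _, l => μ l
  | n + 1, t, l => ∫ u in (0 : ℝ)..t, ∑ l', flow w μ n u l' * w l' l u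

variable {L : Type} [Fintype L] {w : L → L → ℝ → ℝ} {μ : L → ℝ}

theorem IsKernel.le_one (hw : IsKernel w) (l l' : L) (t : ℝ) : w l l' t ≤ 1 := by
  rw [← hw.sum_eq l t]
  exact Finset.single_le_sum (fun i _ => hw.nonneg l i t) (Finset.mem_univ l')

theorem IsKernel.integrable_mul (hw : IsKernel w) {f : ℝ → ℝ} {a b : ℝ}
    (hf : ContinuousOn f (Set.uIcc a b)) (l l' : L) :
    IntervalIntegrable (fun u => f u * w l l' u) MeasureTheory.volume a b := by
  have h : IntervalIntegrable (w l l') MeasureTheory.volume a b := by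
    refine IntervalIntegrable.mono_fun' (g := fun _ => 1) intervalIntegrable_const
      (hw.measurable l l').aestronglyMeasurable (Filter.Eventually.of_forall fun t => ?_)
    show ‖w l l' t‖ ≤ 1
    rw [Real.norm_of_nonneg (hw.nonneg l l' t)]
    exact hw.le_one l l' t
  exact h.continuousOn_mul hf

theorem IsKernel.integrable_sum (hw : IsKernel w) {f : ℝ → L → ℝ} {a b : ℝ}
    (hf : ∀ l, ContinuousOn (fun u => f u l) (Set.uIcc a b)) (l : L) :
    IntervalIntegrable (fun u => ∑ l', f u l' * w l' l u) MeasureTheory.volume a b := by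
  have := IntervalIntegrable.sum Finset.univ (f := fun l' u => f u l' * w l' l u)
    (μ := MeasureTheory.volume) (a := a) (b := b) fun l' _ => hw.integrable_mul (hf l') l' l
  rw [Finset.sum_fn] at this
  exact this

theorem flow_continuous (hw : IsKernel w) (n : ℕ) (l : L) : Continuous fun t => flow w μ n t l := by
  induction n generalizing l with
  | zero => exact continuous_const
  | succ n ih =>
    exact intervalIntegral.continuous_primitive
      (fun a b => hw.integrable_sum (fun l => (ih l).continuousOn) l) 0

theorem flow_nonneg (hw : IsKernel w) (hμ : ∀ l, 0 ≤ μ l) (n : ℕ) {t : ℝ} (ht : 0 ≤ t) (l : L) :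
    0 ≤ flow w μ n t l := by
  induction n generalizing t l with
  | zero => exact hμ l
  | succ n ih =>
    exact intervalIntegral.integral_nonneg ht fun u hu =>
      Finset.sum_nonneg fun l' _ => mul_nonneg (ih hu.1 l') (hw.nonneg l' l u)

/-- Transition probabilities out of a location sum to one, so the total mass satisfies the recursion
of the Poisson weights without the exponential factor. -/
theorem flow_sum (hw : IsKernel w) (hμ : ∑ l, μ l = 1) (n : ℕ) (t : ℝ) :
    ∑ l, flow w μ n t l = t ^ n / n.factorial := by
  induction n generalizing t with
  | zero => simpa [flow] using hμ
  | succ n ih =>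
    simp only [flow]
    rw [← intervalIntegral.integral_finsetSum fun l _ => hw.integrable_sum
      (fun l => (flow_continuous hw n l).continuousOn) l]
    have : ∀ u, ∑ l, ∑ l', flow w μ n u l' * w l' l u = u ^ n / n.factorial := by
      intro u
      rw [Finset.sum_comm, ← ih u]
      refine Finset.sum_congr rfl fun l' _ => ?_
      rw [← Finset.mul_sum, hw.sum_eq, mul_one]
    simp only [this, intervalIntegral.integral_div, integral_pow]
    rw [Nat.factorial_succ]
    push_cast
    field_simp
    simp

theorem flow_le (hw : IsKernel w) (hμ : IsDist μ) (n : ℕ) {t : ℝ} (ht : 0 ≤ t) (l : L) :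
    flow w μ n t l ≤ t ^ n / n.factorial := by
  rw [← flow_sum hw hμ.2 n t]
  exact Finset.single_le_sum (fun i _ => flow_nonneg hw hμ.1 n ht i) (Finset.mem_univ l)

theorem flow_summable (hw : IsKernel w) (hμ : IsDist μ) {t : ℝ} (ht : 0 ≤ t) (l : L) :
    Summable fun n => flow w μ n t l :=
  Summable.of_nonneg_of_le (fun n => flow_nonneg hw hμ.1 n ht l) (fun n => flow_le hw hμ n ht l)
    (Real.summable_pow_div_factorial t)

/-- The transient distribution, multiplied with `exp t`. -/
def totalFlow (w : L → L → ℝ → ℝ) (μ : L → ℝ) (t : ℝ) (l : L) : ℝ := ∑' n, flow w μ n t l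

theorem totalFlow_nonneg (hw : IsKernel w) (hμ : IsDist μ) {t : ℝ} (ht : 0 ≤ t) (l : L) :
    0 ≤ totalFlow w μ t l :=
  tsum_nonneg fun n => flow_nonneg hw hμ.1 n ht l

theorem totalFlow_sum (hw : IsKernel w) (hμ : IsDist μ) {t : ℝ} (ht : 0 ≤ t) :
    ∑ l, totalFlow w μ t l = Real.exp t := by
  simp only [totalFlow]
  rw [← Summable.tsum_finsetSum fun l _ => flow_summable hw hμ ht l]
  simp only [flow_sum hw hμ.2]
  rw [Real.exp_eq_exp_ℝ, NormedSpace.exp_eq_tsum_div]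

/-- The Kolmogorov forward equation in integrated form, obtained by summing the recursion over the
number of jumps. The integrated form makes sense for merely measurable strategies. -/
theorem totalFlow_eq (hw : IsKernel w) (hμ : IsDist μ) {t : ℝ} (ht : 0 ≤ t) (l : L) :
    totalFlow w μ t l = μ l + ∫ u in (0 : ℝ)..t, ∑ l', totalFlow w μ u l' * w l' l u := by
  rw [totalFlow, (flow_summable hw hμ ht l).tsum_eq_zero_add]
  congr 1
  -- Sum and integral are exchanged under the summable bound `t ^ n / n!`.
  refine (intervalIntegral.hasSum_integral_of_dominated_convergence
    (F := fun n u => ∑ l', flow w μ n u l' * w l' l u) (fun n _ => t ^ n / n.factorial) ?_ ?_ ?_ ?_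
    ?_).tsum_eq
  · intro n
    refine (Measurable.aestronglyMeasurable ?_)
    exact Finset.measurable_fun_sum _ fun l' _ =>
      (flow_continuous hw n l').measurable.mul (hw.measurable l' l)
  · refine fun n => Filter.Eventually.of_forall fun u hu => ?_
    rw [Set.uIoc_of_le ht] at hu
    have h1 := fun l' => flow_nonneg hw hμ.1 n hu.1.le l'
    rw [Real.norm_of_nonneg (Finset.sum_nonneg fun l' _ => mul_nonneg (h1 l') (hw.nonneg l' l u))]
    calc ∑ l', flow w μ n u l' * w l' l u ≤ ∑ l', flow w μ n u l' :=
          Finset.sum_le_sum fun l' _ => mul_le_of_le_one_right (h1 l') (hw.le_one l' l u)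
      _ = u ^ n / n.factorial := flow_sum hw hμ.2 n u
      _ ≤ t ^ n / n.factorial := by
          have := pow_le_pow_left₀ hu.1.le hu.2 n
          gcongr
  · exact Filter.Eventually.of_forall fun u _ => Real.summable_pow_div_factorial t
  · exact intervalIntegrable_const
  · refine Filter.Eventually.of_forall fun u hu => ?_
    rw [Set.uIoc_of_le ht] at hu
    have h : ∀ l' ∈ (Finset.univ : Finset L), HasSum (fun n => flow w μ n u l' * w l' l u)
        (totalFlow w μ u l' * w l' l u) := fun l' _ =>
      HasSum.mul_right _ (flow_summable hw hμ hu.1.le l').hasSum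
    exact hasSum_sum h

theorem totalFlow_continuousOn (hw : IsKernel w) (hμ : IsDist μ) (b : ℝ) (l : L) :
    ContinuousOn (fun t => totalFlow w μ t l) (Set.Icc 0 b) := by
  have hc : ∀ n, ContinuousOn (fun t => flow w μ n t l) (Set.Icc 0 b) := fun n =>
    (flow_continuous hw n l).continuousOn
  refine continuousOn_tsum hc (Real.summable_pow_div_factorial b) ?_
  intro n t ht
  rw [Real.norm_of_nonneg (flow_nonneg hw hμ.1 n ht.1 l)]
  refine (flow_le hw hμ n ht.1 l).trans ?_
  have := pow_le_pow_left₀ ht.1 ht.2 n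
  gcongr

/-- If the functions `p l` decrease along the flow up to `K`, their mean increases at most with
rate `K`. -/
theorem totalFlow_drift (hw : IsKernel w) (hμ : IsDist μ) {p p' : ℝ → L → ℝ}
    (hp : ∀ t l, HasDerivAt (fun t => p t l) (p' t l) t) (hp' : ∀ l, Continuous fun t => p' t l)
    {a b K : ℝ} (ha : 0 ≤ a) (hab : a ≤ b)
    (hK : ∀ t ∈ Set.Ioo a b, ∀ l, p' t l + ∑ l', w l l' t * p t l' - p t l ≤ K) :
    ∑ l, Real.exp (-b) * totalFlow w μ b l * p b l ≤
      ∑ l, Real.exp (-a) * totalFlow w μ a l * p a l + K * (b - a) := by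
  have hb : 0 ≤ b := ha.trans hab
  set Y := totalFlow w μ with hY
  set g : ℝ → L → ℝ := fun u l => ∑ l', Y u l' * w l' l u with hg
  set q : ℝ → L → ℝ := fun t l => Real.exp (-t) * p t l with hq
  set q' : ℝ → L → ℝ := fun t l => Real.exp (-t) * (p' t l - p t l) with hq'
  have hYc : ∀ l, ContinuousOn (fun t => Y t l) (Set.uIcc 0 b) := fun l => by
    rw [Set.uIcc_of_le hb]
    exact totalFlow_continuousOn hw hμ b l
  have hgi : ∀ l, IntervalIntegrable (fun u => g u l) MeasureTheory.volume 0 b := fun l =>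
    hw.integrable_sum hYc l
  have hsub : Set.uIcc a b ⊆ Set.uIcc 0 b := by
    rw [Set.uIcc_of_le hb, Set.uIcc_of_le hab]
    exact Set.Icc_subset_Icc_left ha
  have hpc : ∀ l, Continuous fun t => p t l := fun l =>
    continuous_iff_continuousAt.2 fun t => (hp t l).continuousAt
  have hqd : ∀ t l, HasDerivAt (fun t => q t l) (q' t l) t := by
    intro t l
    have h : HasDerivAt (fun t => Real.exp (-t)) (-Real.exp (-t)) t := by
      simpa using (hasDerivAt_id t).neg.exp
    refine (h.mul (hp t l)).congr_deriv ?_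
    simp only [hq']
    ring
  have hq'c : ∀ l, Continuous fun t => q' t l := fun l => by
    have := hpc l
    have := hp' l
    fun_prop
  have hqc : ∀ l, Continuous fun t => q t l := fun l =>
    continuous_iff_continuousAt.2 fun t => (hqd t l).continuousAt
  -- Integration by parts with an absolutely continuous factor: the transient distribution is
  -- differentiable only almost everywhere, because the actions may switch in a measurable way.
  have hYd : ∀ l, ∫ t in a..b, (g t l * q t l + Y t l * q' t l) = Y b l * q b l - Y a l * q a l := by
    intro l
    set Z : ℝ → ℝ := fun t => ∫ u in (0 : ℝ)..t, g u l with hZ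
    have hZac : AbsolutelyContinuousOnInterval Z a b :=
      ((hgi l).absolutelyContinuousOnInterval_intervalIntegral (c := 0) (by simp)).mono hsub
    have hYac : AbsolutelyContinuousOnInterval (fun t => μ l + Z t) a b :=
      (LipschitzOnWith.absolutelyContinuousOnInterval
        (LipschitzWith.const (μ l)).lipschitzOnWith).add hZac
    have hqac : AbsolutelyContinuousOnInterval (fun t => q t l) a b := by
      refine ContDiffOn.absolutelyContinuousOnInterval (ContDiff.contDiffOn ?_)
      rw [contDiff_one_iff_deriv]
      refine ⟨fun t => (hqd t l).differentiableAt, ?_⟩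
      have : deriv (fun t => q t l) = fun t => q' t l := funext fun t => (hqd t l).deriv
      rw [this]
      exact hq'c l
    have hYeq : ∀ t ∈ Set.Icc a b, Y t l = μ l + Z t := fun t ht =>
      totalFlow_eq hw hμ (ha.trans ht.1) l
    have key := hYac.integral_deriv_mul_eq_sub hqac
    simp only [hYeq b ⟨hab, le_rfl⟩, hYeq a ⟨le_rfl, hab⟩]
    rw [← key]
    refine intervalIntegral.integral_congr_ae ?_
    filter_upwards [(hgi l).ae_hasDerivAt_integral] with t ht hmem
    have hmem' : t ∈ Set.uIcc a b := Set.uIoc_subset_uIcc hmem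
    have hd := (ht (hsub hmem') 0 (by simp)).const_add (μ l)
    rw [Set.uIcc_of_le hab] at hmem'
    rw [hd.deriv, (hqd t l).deriv, hYeq t hmem']
  have hint : ∀ l, IntervalIntegrable (fun t => g t l * q t l + Y t l * q' t l)
      MeasureTheory.volume a b := fun l =>
    (((hgi l).mono_set hsub).mul_continuousOn (hqc l).continuousOn).add
      (((hYc l).mono hsub).mul (hq'c l).continuousOn).intervalIntegrable
  have hsum : ∑ l, (Y b l * q b l - Y a l * q a l) ≤ K * (b - a) := by
    simp only [← hYd]
    rw [← intervalIntegral.integral_finsetSum fun l _ => hint l]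
    have hconst : K * (b - a) = ∫ _ in a..b, K := by
      rw [intervalIntegral.integral_const, smul_eq_mul]
      ring
    rw [hconst]
    refine intervalIntegral.integral_mono_on_of_le_Ioo hab ?_ intervalIntegrable_const ?_
    · have := IntervalIntegrable.sum Finset.univ
        (f := fun l t => g t l * q t l + Y t l * q' t l)
        (μ := MeasureTheory.volume) (a := a) (b := b) fun l _ => hint l
      rw [Finset.sum_fn] at this
      exact this
    · intro t ht
      have ht0 : 0 ≤ t := ha.trans ht.1.le
      -- Passing from the forward to the backward equation: the transition matrix is moved from the
      -- distribution to the functions. The exponential factor in `q` produces the term `- p t l`.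
      have e1 : ∑ l, (g t l * q t l + Y t l * q' t l) =
          Real.exp (-t) * ∑ l, Y t l * (p' t l + ∑ l', w l l' t * p t l' - p t l) := by
        have e2 : ∑ l, g t l * q t l = ∑ l, Y t l * ∑ l', w l l' t * q t l' := by
          simp only [hg, Finset.sum_mul, Finset.mul_sum]
          rw [Finset.sum_comm]
          exact Finset.sum_congr rfl fun l _ => Finset.sum_congr rfl fun l' _ => by ring
        rw [Finset.sum_add_distrib, e2, ← Finset.sum_add_distrib, Finset.mul_sum]
        refine Finset.sum_congr rfl fun l _ => ?_
        have e3 : ∑ l', w l l' t * q t l' = Real.exp (-t) * ∑ l', w l l' t * p t l' := by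
          rw [Finset.mul_sum]
          exact Finset.sum_congr rfl fun l' _ => by simp only [hq]; ring
        rw [e3]
        simp only [hq']
        ring
      rw [e1]
      calc Real.exp (-t) * ∑ l, Y t l * (p' t l + ∑ l', w l l' t * p t l' - p t l)
          ≤ Real.exp (-t) * ∑ l, Y t l * K := by
            refine mul_le_mul_of_nonneg_left (Finset.sum_le_sum fun l _ => ?_) (Real.exp_pos _).le
            exact mul_le_mul_of_nonneg_left (hK t ht l) (totalFlow_nonneg hw hμ ht0 l)
        -- The factor `exp t` of the total flow cancels the discount.
        _ = K := by
            rw [← Finset.sum_mul, totalFlow_sum hw hμ ht0, ← mul_assoc, ← Real.exp_add]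
            simp
  rw [Finset.sum_sub_distrib] at hsum
  have e : ∀ t, ∑ l, Real.exp (-t) * Y t l * p t l = ∑ l, Y t l * q t l := fun t =>
    Finset.sum_congr rfl fun l _ => by simp only [hq]; ring
  rw [e, e]
  linarith

end CTMG
end

noncomputable section

set_option linter.unusedSectionVars false

namespace CTMG

namespace MarkovGame

variable {L A : Type} [Fintype L] [Fintype A] [DecidableEq L] {M : MarkovGame L A}

/-! ### The chain of a pair of strategies -/

/-- The transition probabilities under the actions `s`. -/
def kernel (M : MarkovGame L A) (s : L → ℝ → A) (l l' : L) (t : ℝ) : ℝ := M.rate l (s l t) l'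

theorem jumpProb_eq (s : L → ℝ → A) (μ : L → ℝ) (n : ℕ) (t : ℝ) (l : L) :
    M.jumpProb s μ n t l = Real.exp (-t) * flow (M.kernel s) μ n t l := by
  induction n generalizing t l with
  | zero => rfl
  | succ n ih =>
    simp only [jumpProb, flow, kernel]
    rw [← intervalIntegral.integral_const_mul]
    refine intervalIntegral.integral_congr fun u _ => ?_
    simp only [ih, Finset.mul_sum]
    refine Finset.sum_congr rfl fun l' _ => ?_
    -- In a normed game the waiting times do not depend on location and action, so the exponential
    -- weights of successive jumps telescope into one factor.
    have : Real.exp (-t) = Real.exp (-(t - u)) * Real.exp (-u) := by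
      rw [← Real.exp_add]
      congr 1
      ring
    rw [this]
    ring

theorem transient_eq (s : L → ℝ → A) (μ : L → ℝ) (t : ℝ) (l : L) :
    M.transient s μ t l = Real.exp (-t) * totalFlow (M.kernel s) μ t l := by
  simp only [transient, jumpProb_eq, totalFlow]
  exact tsum_mul_left

theorem joint_mem (σ τ : M.Strategy) (l : L) (t : ℝ) : M.joint σ τ l t ∈ M.enabled l := by
  unfold joint
  split_ifs
  · exact σ.enabled l t
  · exact τ.enabled l t

theorem IsNormed.isKernel (hM : M.IsNormed) (σ τ : M.Strategy) : IsKernel (M.kernel (M.joint σ τ)) where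
  measurable l l' := by
    -- On the finite set of actions the discrete σ-algebra is used, for which measurable level sets
    -- suffice.
    let _ : MeasurableSpace A := ⊤
    have h : ∀ ρ : M.Strategy, Measurable (ρ.act l) := fun ρ =>
      measurable_to_countable' fun a => ρ.measurable l a
    have hj : Measurable (M.joint σ τ l) := by
      unfold joint
      split_ifs
      · exact h σ
      · exact h τ
    exact (measurable_from_top (f := fun a => (M.rate l a l' : ℝ))).comp hj
  nonneg l l' t := by
    unfold kernel
    positivity
  sum_eq l t := hM.rate_sum (joint_mem σ τ l t)

theorem IsNormed.goalProb_mem (hM : M.IsNormed) (G : Finset L) {T : ℝ} (hT : 0 ≤ T) {μ : L → ℝ}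
    (hμ : IsDist μ) (σ τ : M.Strategy) : M.goalProb G T μ σ τ ∈ Set.Icc 0 1 := by
  have hw := hM.isKernel σ τ
  have h0 : ∀ l, 0 ≤ M.transient (M.joint σ τ) μ T l := fun l => by
    rw [transient_eq]
    exact mul_nonneg (Real.exp_pos _).le (totalFlow_nonneg hw hμ hT l)
  refine ⟨Finset.sum_nonneg fun l _ => h0 l, ?_⟩
  calc M.goalProb G T μ σ τ ≤ ∑ l, M.transient (M.joint σ τ) μ T l :=
        Finset.sum_le_sum_of_subset_of_nonneg (Finset.subset_univ G) fun l _ _ => h0 l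
    _ = 1 := by
        simp only [transient_eq]
        rw [← Finset.mul_sum, totalFlow_sum hw hμ hT, ← Real.exp_add]
        simp

/-! ### Errors of the approximations in one interval -/

/-- The mean contributes one `δ` and the subtracted own value another. -/
theorem IsNormed.quality_le (hM : M.IsNormed) {x y : L → ℝ} {δ : ℝ} (h : ∀ l, |x l - y l| ≤ δ)
    {l : L} {a : A} (ha : a ∈ M.enabled l) : M.quality x l a ≤ M.quality y l a + 2 * δ := by
  rw [hM.quality_eq ha, hM.quality_eq ha]
  have h1 : ∑ l', (M.rate l a l' : ℝ) * x l' ≤ ∑ l', (M.rate l a l' : ℝ) * y l' + δ := by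
    calc ∑ l', (M.rate l a l' : ℝ) * x l' ≤ ∑ l', ((M.rate l a l' : ℝ) * y l' + M.rate l a l' * δ) :=
          Finset.sum_le_sum fun l' _ => by
            rw [← mul_add]
            exact mul_le_mul_of_nonneg_left (by linarith [(abs_le.1 (h l')).2]) (by positivity)
      _ = _ := by rw [Finset.sum_add_distrib, ← Finset.sum_mul, hM.rate_sum ha, one_mul]
  linarith [(abs_le.1 (h l)).1]

/-- Compare both vectors under one action: the optimal one for `x` when maximizing, the optimal one
for `y` when minimizing. -/
theorem IsNormed.optQuality_le (hM : M.IsNormed) {x y : L → ℝ} {δ : ℝ} (h : ∀ l, |x l - y l| ≤ δ)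
    (l : L) : M.optQuality x l ≤ M.optQuality y l + 2 * δ := by
  by_cases hl : l ∈ M.reach
  · obtain ⟨a, ha, hx⟩ := M.exists_isOptAction x l
    rw [← hx]
    linarith [hM.quality_le h ha, quality_le_opt (x := y) hl ha]
  · obtain ⟨a, ha, hy⟩ := M.exists_isOptAction y l
    rw [← hy]
    linarith [hM.quality_le h ha, opt_le_quality (x := x) hl ha]

theorem IsNormed.abs_optQuality_sub_le (hM : M.IsNormed) {x y : L → ℝ} {δ : ℝ}
    (h : ∀ l, |x l - y l| ≤ δ) (l : L) : |M.optQuality x l - M.optQuality y l| ≤ 2 * δ := by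
  have h' : ∀ l, |y l - x l| ≤ δ := fun l => by rw [abs_sub_comm]; exact h l
  rw [abs_le]
  constructor <;> linarith [hM.optQuality_le h l, hM.optQuality_le h' l]

/-- The mean of `x` under an enabled action is between two values of `x`. -/
theorem IsNormed.exists_le_ge (hM : M.IsNormed) (x : L → ℝ) {l : L} {a : A} (ha : a ∈ M.enabled l) :
    (∃ l', ∑ k, (M.rate l a k : ℝ) * x k ≤ x l') ∧ ∃ l', x l' ≤ ∑ k, (M.rate l a k : ℝ) * x k := by
  have hne : (Finset.univ : Finset L).Nonempty := ⟨l, Finset.mem_univ l⟩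
  have hs := hM.rate_sum ha
  constructor
  · obtain ⟨l', -, h⟩ := Finset.exists_max_image Finset.univ x hne
    refine ⟨l', ?_⟩
    calc _ ≤ ∑ k, (M.rate l a k : ℝ) * x l' :=
          Finset.sum_le_sum fun k hk => mul_le_mul_of_nonneg_left (h k hk) (by positivity)
      _ = x l' := by rw [← Finset.sum_mul, hs, one_mul]
  · obtain ⟨l', -, h⟩ := Finset.exists_min_image Finset.univ x hne
    refine ⟨l', ?_⟩
    calc x l' = ∑ k, (M.rate l a k : ℝ) * x l' := by rw [← Finset.sum_mul, hs, one_mul]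
      _ ≤ _ := Finset.sum_le_sum fun k hk => mul_le_mul_of_nonneg_left (h k hk) (by positivity)

theorem IsNormed.optQuality_mem (hM : M.IsNormed) (x : L → ℝ) (l : L) :
    (∃ l', M.optQuality x l ≤ x l' - x l) ∧ ∃ l', x l' - x l ≤ M.optQuality x l := by
  obtain ⟨a, ha, hx⟩ := M.exists_isOptAction x l
  obtain ⟨⟨l1, h1⟩, l2, h2⟩ := hM.exists_le_ge x ha
  rw [← hx, hM.quality_eq ha]
  exact ⟨⟨l1, by linarith⟩, l2, by linarith⟩

/-- The usual estimate for Picard iterates. It starts from the fact that an optimal quality is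
squeezed between differences of entries of `x`, so it is bounded by the range `b - a`; the Lipschitz
constant `2` enters in each later step. -/
theorem IsNormed.abs_netStep_sub_le (hM : M.IsNormed) {x : L → ℝ} {a b : ℝ}
    (hx : ∀ l, x l ∈ Set.Icc a b) (j : ℕ) {u : ℝ} (hu : 0 ≤ u) (l : L) :
    |M.netStep x (j + 1) u l - M.netStep x j u l| ≤ u ^ (j + 1) * (b - a) := by
  induction j generalizing u l with
  | zero =>
    have h : M.netStep x 1 u l - M.netStep x 0 u l = u * M.optQuality x l := by
      simp only [netStep, intervalIntegral.integral_const, smul_eq_mul]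
      ring
    rw [h, abs_mul, abs_of_nonneg hu, zero_add, pow_one]
    refine mul_le_mul_of_nonneg_left ?_ hu
    obtain ⟨⟨l1, h1⟩, l2, h2⟩ := hM.optQuality_mem x l
    rw [abs_le]
    constructor <;> linarith [(hx l).1, (hx l).2, (hx l1).2, (hx l2).1]
  | succ j ih =>
    have hc : ∀ j, Continuous fun u => M.optQuality (M.netStep x j u) l := fun j =>
      (optQuality_continuous l).comp (netStep_continuous x j)
    have hba : 0 ≤ b - a := by linarith [(hx l).1, (hx l).2]
    have h : M.netStep x (j + 1 + 1) u l - M.netStep x (j + 1) u l = ∫ s in (0 : ℝ)..u,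
        (M.optQuality (M.netStep x (j + 1) s) l - M.optQuality (M.netStep x j s) l) := by
      rw [intervalIntegral.integral_sub ((hc _).intervalIntegrable _ _)
        ((hc _).intervalIntegrable _ _)]
      show (x l + _) - (x l + _) = _
      ring
    rw [h, ← Real.norm_eq_abs]
    refine (intervalIntegral.norm_integral_le_of_norm_le (g := fun s => 2 * (s ^ (j + 1) * (b - a)))
      hu (Filter.Eventually.of_forall fun s hs => ?_) ?_).trans ?_
    · exact hM.abs_optQuality_sub_le (fun l => ih hs.1.le l) l
    · exact Continuous.intervalIntegrable (by fun_prop) _ _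
    · rw [intervalIntegral.integral_const_mul, intervalIntegral.integral_mul_const, integral_pow,
        zero_pow (by omega), sub_zero]
      -- Integrating the power contributes `1 / (j + 2) ≤ 1 / 2`, which absorbs the Lipschitz
      -- constant `2`.
      have h2 : u ^ (j + 1 + 1) / ((j + 1 : ℕ) + 1 : ℝ) ≤ u ^ (j + 1 + 1) / 2 := by
        refine div_le_div_of_nonneg_left (by positivity) (by norm_num) ?_
        push_cast
        linarith [Nat.cast_nonneg (α := ℝ) j]
      nlinarith [mul_le_mul_of_nonneg_right h2 hba]

/-- A maximum principle. -/
theorem le_of_deriv_le {p p' : ℝ → L → ℝ} (hp : ∀ u l, HasDerivAt (fun u => p u l) (p' u l) u)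
    {c ε X : ℝ} (hc : 0 ≤ c) (hε : 0 ≤ ε) (hε1 : ε ≤ 1)
    (h : ∀ u ∈ Set.Icc 0 ε, ∀ l, ∃ l', p' u l + p u l ≤ p u l' + c) (hX : ∀ l, p 0 l ≤ X) {u : ℝ}
    (hu : u ∈ Set.Icc 0 ε) (l : L) : p u l ≤ X + 2 * c * ε := by
  have hne : (Finset.univ : Finset L).Nonempty := ⟨l, Finset.mem_univ l⟩
  have hpc : ∀ l, Continuous fun u => p u l := fun l =>
    continuous_iff_continuousAt.2 fun t => (hp t l).continuousAt
  have hfc : Continuous fun u => Finset.univ.sup' hne (p u) :=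
    Continuous.finset_sup'_apply hne fun l _ => hpc l
  -- The maximum over all locations and times is taken first, so a single location has to be
  -- followed afterwards.
  obtain ⟨v, hv, hmax⟩ := isCompact_Icc.exists_isMaxOn (Set.nonempty_Icc.2 hε) hfc.continuousOn
  obtain ⟨k, -, hk⟩ := Finset.exists_mem_eq_sup' hne (p v)
  have hB : ∀ u ∈ Set.Icc 0 ε, ∀ l, p u l ≤ p v k := fun u hu l => by
    rw [← hk]
    exact (Finset.le_sup' (p u) (Finset.mem_univ l)).trans (hmax hu)
  refine (hB u hu l).trans ?_
  set B := p v k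
  -- The location `k` of the maximum satisfies `p' + p ≤ B + c`; multiplying by `exp` gives
  -- monotonicity, and comparing the times `0` and `v` gives `B ≤ X + c (exp v - 1)`.
  have hanti : AntitoneOn (fun u => Real.exp u * (p u k - (B + c))) (Set.Icc 0 ε) := by
    have hd : ∀ u, HasDerivAt (fun u => Real.exp u * (p u k - (B + c)))
        (Real.exp u * (p u k - (B + c)) + Real.exp u * p' u k) u := fun u =>
      (Real.hasDerivAt_exp u).mul ((hp u k).sub_const _)
    refine antitoneOn_of_deriv_nonpos (convex_Icc 0 ε)
      (fun u _ => (hd u).continuousAt.continuousWithinAt)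
      (fun u _ => (hd u).differentiableAt.differentiableWithinAt) fun u hu => ?_
    rw [(hd u).deriv, ← mul_add]
    have hu' : u ∈ Set.Icc 0 ε := interior_subset hu
    obtain ⟨l', hl'⟩ := h u hu' k
    refine mul_nonpos_of_nonneg_of_nonpos (Real.exp_pos u).le ?_
    linarith [hB u hu' l']
  have h1 := hanti ⟨le_rfl, hε⟩ hv hv.1
  simp only [Real.exp_zero, one_mul] at h1
  -- From `exp v ≤ 1 + v + v²` and `v ≤ ε ≤ 1`.
  have h2 : Real.exp v ≤ 1 + 2 * ε := by
    have := (abs_le.1 (Real.abs_exp_sub_one_sub_id_le (x := v)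
      (by rw [abs_of_nonneg hv.1]; linarith [hv.2]))).2
    nlinarith [hv.1, hv.2]
  have h3 : p v k = B := rfl
  rw [h3] at h1
  nlinarith [hX k]

/-- An exact solution could not leave the range of its start vector. The approximation satisfies the
equation up to `2 δ`, so by the maximum principle it leaves the range by at most `2 · 2δ · ε`. The
lower bound is the same argument for the negated functions. -/
theorem IsNormed.netStep_mem (hM : M.IsNormed) {x : L → ℝ} {a b : ℝ}
    (hx : ∀ l, x l ∈ Set.Icc a b) (hab : a ≤ b) (k : ℕ) {ε : ℝ} (hε : 0 ≤ ε) (hε1 : ε ≤ 1) (l : L) :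
    M.netStep x (k + 1) ε l ∈ Set.Icc (a - 4 * ε ^ (k + 2) * (b - a))
      (b + 4 * ε ^ (k + 2) * (b - a)) := by
  set δ := ε ^ (k + 1) * (b - a) with hδ
  have hδ0 : 0 ≤ δ := mul_nonneg (by positivity) (by linarith)
  have hδ' : ∀ u ∈ Set.Icc 0 ε, ∀ l, |M.netStep x (k + 1) u l - M.netStep x k u l| ≤ δ := by
    intro u hu l
    refine (hM.abs_netStep_sub_le hx k hu.1 l).trans ?_
    exact mul_le_mul_of_nonneg_right (pow_le_pow_left₀ hu.1 hu.2 _) (by linarith)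
  have hd := fun u l => netStep_hasDerivAt (M := M) x k l u
  have e : 2 * (2 * δ) * ε = 4 * ε ^ (k + 2) * (b - a) := by
    rw [hδ]
    ring
  constructor
  · have := le_of_deriv_le (p := fun u l => -M.netStep x (k + 1) u l)
      (p' := fun u l => -M.optQuality (M.netStep x k u) l) (fun u l => (hd u l).neg)
      (c := 2 * δ) (X := -a) (by linarith) hε hε1 ?_ ?_ ⟨hε, le_rfl⟩ l
    · rw [e] at this
      linarith
    · intro u hu l
      obtain ⟨-, l', hl'⟩ := hM.optQuality_mem (M.netStep x k u) l
      refine ⟨l', ?_⟩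
      linarith [(abs_le.1 (hδ' u hu l)).1, (abs_le.1 (hδ' u hu l')).2]
    · intro l
      simp only [netStep_zero]
      linarith [(hx l).1]
  · have := le_of_deriv_le (p := fun u l => M.netStep x (k + 1) u l)
      (p' := fun u l => M.optQuality (M.netStep x k u) l) hd
      (c := 2 * δ) (X := b) (by linarith) hε hε1 ?_ ?_ ⟨hε, le_rfl⟩ l
    · rw [e] at this
      exact this
    · intro u hu l
      obtain ⟨⟨l', hl'⟩, -⟩ := hM.optQuality_mem (M.netStep x k u) l
      refine ⟨l', ?_⟩
      linarith [(abs_le.1 (hδ' u hu l)).2, (abs_le.1 (hδ' u hu l')).1]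
    · intro l
      simp only [netStep_zero]
      exact (hx l).2

/-- As long as the range is at most `2`, each interval enlarges it by at most `8 ε^(k+2) · 2`. By
the hypothesis all these increments sum to at most `1`, and the range of an indicator is at most
`1`. -/
theorem IsNormed.netGrid_mem (hM : M.IsNormed) (G : Finset L) (k : ℕ) {ε : ℝ} {N : ℕ} (hε : 0 ≤ ε)
    (hε1 : ε ≤ 1) (hN : 16 * (N * ε ^ (k + 2)) ≤ 1) {i : ℕ} (hi : i ≤ N) :
    ∃ a b, (∀ l, M.netGrid G (k + 1) ε i l ∈ Set.Icc a b) ∧ a ≤ b ∧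
      b - a ≤ 1 + 16 * (i * ε ^ (k + 2)) := by
  induction i with
  | zero =>
    refine ⟨0, 1, fun l => ?_, by norm_num, by simp⟩
    simp only [netGrid]
    split_ifs <;> simp
  | succ i ih =>
    obtain ⟨a, b, h, hab, ho⟩ := ih (by omega)
    have hi' : (i : ℝ) ≤ N := by exact_mod_cast (by omega : i ≤ N)
    have hp : 0 ≤ ε ^ (k + 2) := by positivity
    have h2 : b - a ≤ 2 := by nlinarith
    refine ⟨_, _, fun l => hM.netStep_mem h hab k hε hε1 l, ?_, ?_⟩
    · have : 0 ≤ 4 * ε ^ (k + 2) * (b - a) := mul_nonneg (by positivity) (by linarith)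
      linarith
    · push_cast
      nlinarith

end MarkovGame

end CTMG
end

noncomputable section

set_option linter.unusedSectionVars false

namespace CTMG

namespace MarkovGame

variable {L A : Type} [Fintype L] [Fintype A] [DecidableEq L] {M : MarkovGame L A}

/-! ### The quality of the strategies of the net -/

/-- The increase of the mean of `sg` times the values of the net in one interval, when the actions
of the chain are good for the player who minimizes this quantity. -/
theorem IsNormed.net_drift (hM : M.IsNormed) {σ τ : M.Strategy} {μ : L → ℝ} (hμ : IsDist μ)
    {x : L → ℝ} {a b : ℝ} (hx : ∀ l, x l ∈ Set.Icc a b) (hab : a ≤ b) {k : ℕ} {ε z sg : ℝ}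
    (hε : 0 ≤ ε) (hz : ε ≤ z) (hsg : |sg| = 1)
    (hs : ∀ t ∈ Set.Ioo (z - ε) z, ∀ l,
      sg * M.quality (M.netStep x k (z - t)) l (M.joint σ τ l t) ≤
      sg * M.optQuality (M.netStep x k (z - t)) l) :
    ∑ l, M.transient (M.joint σ τ) μ z l * (sg * x l) ≤
      ∑ l, M.transient (M.joint σ τ) μ (z - ε) l * (sg * M.netStep x (k + 1) ε l) +
        2 * (ε ^ (k + 1) * (b - a)) * ε := by
  have hd : ∀ t l, HasDerivAt (fun t => sg * M.netStep x (k + 1) (z - t) l)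
      (sg * -M.optQuality (M.netStep x k (z - t)) l) t := by
    intro t l
    have h1 : HasDerivAt (fun t => z - t) (-1) t := by
      simpa using (hasDerivAt_id t).const_sub z
    have h2 := (netStep_hasDerivAt (M := M) x k l (z - t)).comp t h1
    refine (h2.const_mul sg).congr_deriv ?_
    ring
  have hc : ∀ l, Continuous fun t => sg * -M.optQuality (M.netStep x k (z - t)) l := by
    intro l
    have h1 : Continuous fun t => M.netStep x k (z - t) :=
      (netStep_continuous x k).comp (continuous_const.sub continuous_id)
    exact continuous_const.mul ((optQuality_continuous l).comp h1).neg
  have key := totalFlow_drift (hM.isKernel σ τ) hμ hd hc (a := z - ε) (b := z)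
    (K := 2 * (ε ^ (k + 1) * (b - a))) (by linarith) (by linarith) ?_
  · simp only [sub_self, netStep_zero, sub_sub_cancel] at key
    simpa only [transient_eq] using key
  · intro t ht l
    have hu : 0 ≤ z - t := by linarith [ht.2]
    set u := z - t with hu'
    set c := M.joint σ τ l t with hc'
    have hen : c ∈ M.enabled l := joint_mem σ τ l t
    -- The drift along the chain compares the quality of the played action for level `k + 1` with
    -- the optimal quality for level `k`. The mismatch of levels is the defect of the net.
    have e1 : sg * -M.optQuality (M.netStep x k u) l +
        ∑ l', M.kernel (M.joint σ τ) l l' t * (sg * M.netStep x (k + 1) u l') -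
        sg * M.netStep x (k + 1) u l =
        sg * M.quality (M.netStep x (k + 1) u) l c - sg * M.optQuality (M.netStep x k u) l := by
      rw [hM.quality_eq hen]
      have : ∑ l', M.kernel (M.joint σ τ) l l' t * (sg * M.netStep x (k + 1) u l') =
          sg * ∑ l', (M.rate l c l' : ℝ) * M.netStep x (k + 1) u l' := by
        rw [Finset.mul_sum]
        exact Finset.sum_congr rfl fun l' _ => by simp only [kernel, hc']; ring
      rw [this]
      ring
    rw [e1]
    have hδ : ∀ l, |M.netStep x (k + 1) u l - M.netStep x k u l| ≤ ε ^ (k + 1) * (b - a) := by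
      intro l
      refine (hM.abs_netStep_sub_le hx k hu l).trans ?_
      exact mul_le_mul_of_nonneg_right (pow_le_pow_left₀ hu (by linarith [ht.1]) _) (by linarith)
    have hδ' : ∀ l, |M.netStep x k u l - M.netStep x (k + 1) u l| ≤ ε ^ (k + 1) * (b - a) := by
      intro l
      rw [abs_sub_comm]
      exact hδ l
    have h1 := hM.quality_le hδ hen
    have h2 := hM.quality_le hδ' hen
    have h3 := hs t ht l
    -- For either sign, replacing level `k + 1` by level `k` in the quality costs twice the distance
    -- of the levels; what remains is nonpositive by `hs`.
    rcases eq_or_eq_neg_of_abs_eq hsg with rfl | rfl <;> linarith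

/-- The error in all intervals. -/
theorem IsNormed.net_error (hM : M.IsNormed) {σ τ : M.Strategy} {μ : L → ℝ} (hμ : IsDist μ)
    {G : Finset L} {k N : ℕ} {T sg : ℝ} (hT : 0 ≤ T) (hN : 0 < N) (hε1 : T / N ≤ 1)
    (hε : 16 * (T * (T / N) ^ (k + 1)) ≤ 1) (hsg : |sg| = 1)
    (hs : ∀ i < N, ∀ t ∈ Set.Ioo (T - (i + 1) * (T / N)) (T - i * (T / N)), ∀ l,
      sg * M.quality (M.netStep (M.netGrid G (k + 1) (T / N) i) k (T - i * (T / N) - t)) l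
        (M.joint σ τ l t) ≤
      sg * M.optQuality (M.netStep (M.netGrid G (k + 1) (T / N) i) k (T - i * (T / N) - t)) l) :
    sg * M.goalProb G T μ σ τ ≤ sg * ∑ l, μ l * M.netGrid G (k + 1) (T / N) N l +
      4 * (T * (T / N) ^ (k + 1)) := by
  have hN' : (0 : ℝ) < N := by exact_mod_cast hN
  have hTN : N * (T / N) = T := by field_simp
  set ε := T / N with hεdef
  have hε0 : 0 ≤ ε := div_nonneg hT hN'.le
  have hbound : 16 * (N * ε ^ (k + 2)) ≤ 1 := by
    calc 16 * (N * ε ^ (k + 2)) = 16 * (N * ε * ε ^ (k + 1)) := by ring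
      _ ≤ 1 := by rw [hTN]; exact hε
  have hp : 0 ≤ ε ^ (k + 2) := by positivity
  -- Telescoping backwards from `T`: at the grid points the values of the net serve as both the end
  -- of one interval and the start of the next. The range bound `2` turns each defect into `4
  -- ε^(k+2)`.
  have main : ∀ i ≤ N, ∑ l, M.transient (M.joint σ τ) μ T l * (sg * M.netGrid G (k + 1) ε 0 l) ≤
      ∑ l, M.transient (M.joint σ τ) μ (T - i * ε) l * (sg * M.netGrid G (k + 1) ε i l) +
        i * (4 * ε ^ (k + 2)) := by
    intro i
    induction i with
    | zero => intro _; simp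
    | succ i ih =>
      intro hi
      refine (ih (by omega)).trans ?_
      obtain ⟨a, b, h, hab, ho⟩ := hM.netGrid_mem G k hε0 hε1 hbound (i := i) (by omega)
      have hiN : (i : ℝ) + 1 ≤ N := by exact_mod_cast hi
      have ho2 : b - a ≤ 2 := by nlinarith
      have hz : ε ≤ T - i * ε := by nlinarith
      have e : T - ((i + 1 : ℕ) : ℝ) * ε = T - i * ε - ε := by push_cast; ring
      have hstep := hM.net_drift (σ := σ) (τ := τ) hμ h hab (k := k) hε0 hz hsg (by
        intro t ht l
        exact hs i (by omega) t ⟨by linarith [ht.1], ht.2⟩ l)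
      rw [e]
      refine (add_le_add_left hstep _).trans ?_
      show _ ≤ ∑ l, M.transient (M.joint σ τ) μ (T - i * ε - ε) l *
        (sg * M.netStep (M.netGrid G (k + 1) ε i) (k + 1) ε l) + _
      have : 2 * (ε ^ (k + 1) * (b - a)) * ε ≤ 4 * ε ^ (k + 2) := by
        calc 2 * (ε ^ (k + 1) * (b - a)) * ε = 2 * ε ^ (k + 2) * (b - a) := by ring
          _ ≤ 2 * ε ^ (k + 2) * 2 := mul_le_mul_of_nonneg_left ho2 (by positivity)
          _ = _ := by ring
      push_cast
      linarith
  have h := main N le_rfl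
  have e0 : ∑ l, M.transient (M.joint σ τ) μ T l * (sg * M.netGrid G (k + 1) ε 0 l) =
      sg * M.goalProb G T μ σ τ := by
    simp only [netGrid, goalProb, Finset.mul_sum]
    rw [← Finset.sum_subset (Finset.subset_univ G)]
    · exact Finset.sum_congr rfl fun l hl => by rw [if_pos hl]; ring
    · intro l _ hl
      rw [if_neg hl]
      ring
  have e1 : ∑ l, M.transient (M.joint σ τ) μ (T - N * ε) l * (sg * M.netGrid G (k + 1) ε N l) =
      sg * ∑ l, μ l * M.netGrid G (k + 1) ε N l := by
    rw [hTN, sub_self, Finset.mul_sum]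
    refine Finset.sum_congr rfl fun l _ => ?_
    have : M.transient (M.joint σ τ) μ 0 l = μ l := by
      rw [transient_eq, totalFlow_eq (hM.isKernel σ τ) hμ le_rfl]
      simp
    rw [this]
    ring
  rw [e0, e1] at h
  calc _ ≤ _ := h
    _ = _ := by
      congr 1
      rw [← hTN]
      ring

/-- Against an arbitrary opponent the drift has the favourable sign in all locations: with equality
in the own ones, by optimality in those of the opponent. The sign `-1` gives the lower bound, `+1`
the upper one. The chain through the value uses only that a sup-inf lies between what one strategy
guarantees and what one opponent concedes. -/
theorem FollowsNet.quality_bounds {σ : M.Strategy} (hM : M.IsNormed) {μ : L → ℝ} (hμ : IsDist μ)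
    {G : Finset L} {k N : ℕ} {T e : ℝ} (hT : 0 ≤ T) (hN : 0 < N) (hε1 : T / N ≤ 1)
    (hε : 16 * (T * (T / N) ^ (k + 1)) ≤ 1) (he : 4 * (T * (T / N) ^ (k + 1)) ≤ e)
    (h : M.FollowsNet G T (k + 1) N σ) :
    ∑ l, μ l * M.netGrid G (k + 1) (T / N) N l - e ≤ M.reachQuality G T μ σ ∧
    M.reachQuality G T μ σ ≤ M.value G T μ ∧ M.value G T μ ≤ M.safeQuality G T μ σ ∧
    M.safeQuality G T μ σ ≤ ∑ l, μ l * M.netGrid G (k + 1) (T / N) N l + e := by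
  have hne : Nonempty M.Strategy := ⟨σ⟩
  have hg := fun σ τ => hM.goalProb_mem G hT hμ σ τ
  have hbb : ∀ σ, BddBelow (Set.range fun τ => M.goalProb G T μ σ τ) := fun σ =>
    ⟨0, by rintro _ ⟨τ, rfl⟩; exact (hg σ τ).1⟩
  have hba : ∀ τ, BddAbove (Set.range fun σ => M.goalProb G T μ σ τ) := fun τ =>
    ⟨1, by rintro _ ⟨σ, rfl⟩; exact (hg σ τ).2⟩
  have hbv : BddAbove (Set.range fun σ => ⨅ τ, M.goalProb G T μ σ τ) :=
    ⟨1, by rintro _ ⟨σ', rfl⟩; exact (ciInf_le (hbb σ') σ).trans (hg σ' σ).2⟩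
  refine ⟨?_, le_ciSup hbv σ, ?_, ?_⟩
  · refine le_ciInf fun τ => ?_
    have := hM.net_error (σ := σ) (τ := τ) hμ (G := G) (k := k) (sg := -1) hT hN hε1 hε (by simp) ?_
    · linarith
    · intro i hi t ht l
      by_cases hl : l ∈ M.reach
      · have ho := h i hi t ⟨ht.1, ht.2.le⟩ l
        rw [joint, if_pos hl]
        exact (congrArg (fun y => -1 * y) ho.2).le
      · have := opt_le_quality (x := M.netStep (M.netGrid G (k + 1) (T / N) i) k
          (T - i * (T / N) - t)) hl (joint_mem σ τ l t)
        linarith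
  · exact ciSup_le fun σ' => (ciInf_le (hbb σ') σ).trans (le_ciSup (hba σ) σ')
  · refine ciSup_le fun σ' => ?_
    have := hM.net_error (σ := σ') (τ := σ) hμ (G := G) (k := k) (sg := 1) hT hN hε1 hε (by simp) ?_
    · linarith
    · intro i hi t ht l
      by_cases hl : l ∈ M.reach
      · have := quality_le_opt (x := M.netStep (M.netGrid G (k + 1) (T / N) i) k
          (T - i * (T / N) - t)) hl (joint_mem σ' σ l t)
        linarith
      · have ho := h i hi t ⟨ht.1, ht.2.le⟩ l
        rw [joint, if_neg hl]
        exact (congrArg (fun y => 1 * y) ho.2).le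

end MarkovGame

end CTMG
end

noncomputable section

namespace CTMG

/-! ### The theorem -/

/-- By minimality `N - 1` still violates the error bound; taking the root of degree `d + 1` bounds
it by `4 y`. So `N + 1 ≤ 2 + 4 y ≤ 6 max(1, y)`. -/
theorem IsNumber.cast_add_one_le {d N : ℕ} (hd : 1 ≤ d) {T π : ℝ} (hT : 0 ≤ T) (hπ : 0 < π)
    (hN : IsNumber d T π N) :
    (N : ℝ) + 1 ≤ 6 * max 1 ((T / π) ^ (1 / ((d : ℝ) + 1)) * T) := by
  set y := (T / π) ^ (1 / ((d : ℝ) + 1)) * T with hy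
  have hy0 : 0 ≤ y := mul_nonneg (Real.rpow_nonneg (div_nonneg hT hπ.le) _) hT
  have hyp : y ^ (d + 1) = T ^ (d + 2) / π := by
    rw [hy, mul_pow, ← Real.rpow_natCast ((T / π) ^ (1 / ((d : ℝ) + 1))),
      ← Real.rpow_mul (div_nonneg hT hπ.le)]
    have : 1 / ((d : ℝ) + 1) * ((d + 1 : ℕ) : ℝ) = 1 := by
      push_cast
      field_simp
    rw [this, Real.rpow_one]
    ring
  have hN' : (N : ℝ) ≤ 1 + 4 * y := by
    rcases Nat.eq_zero_or_pos N with rfl | h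
    · simp only [Nat.cast_zero]
      linarith
    · obtain ⟨i, rfl⟩ : ∃ i, N = i + 1 := ⟨N - 1, by omega⟩
      have h1 := hN.lt i (by omega)
      have h2 : (i : ℝ) ^ (d + 1) < (4 * y) ^ (d + 1) := by
        rw [mul_pow, hyp]
        -- The factor `2 ^ (d + 3)` in the choice of `N` is absorbed into the factor `4` under the
        -- root, since `d ≥ 1`.
        have h3 : (2 : ℝ) ^ (d + 3) ≤ 4 ^ (d + 1) := by
          rw [show (4 : ℝ) = 2 ^ 2 by norm_num, ← pow_mul]
          exact pow_le_pow_right₀ (by norm_num) (by omega)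
        rw [← mul_div_assoc, lt_div_iff₀ hπ]
        exact h1.trans_le (mul_le_mul_of_nonneg_right h3 (by positivity))
      have h4 := lt_of_pow_lt_pow_left₀ _ (by positivity) h2
      push_cast
      linarith
  have h1 : 1 ≤ max 1 y := le_max_left _ _
  have h2 : y ≤ max 1 y := le_max_right _ _
  linarith

theorem NetInv.solves {m n d N : ℕ} {M : MarkovGame (Fin m) (Fin n)} (hM : M.IsNormed)
    {G : Finset (Fin m)} {T π : ℝ} {s : Store} (hd : 2 ≤ d) (hT : 0 ≤ T) (hπ : 0 < π) (hπ1 : π ≤ 1)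
    (hN : IsNumber d T π N) (hN0 : N = 0 → T = 0) (h : NetInv M G (d + 1) N T N s)
    (hr : s.real 2 = ∑ l : Fin m, M.init l * s.realArr 3 l 0 0) : Solves (d + 1) M G T π s := by
  obtain ⟨σ, hσ, N', hN', hfol, hval, hor⟩ := h.strategy hT hN0
  refine ⟨σ, hσ, ⟨N', hN', hfol, hval⟩, hr, fun μ hμ => ?_⟩
  set X := T * (T / N') ^ (d + 1) with hX
  have hNpos : (0 : ℝ) < N' := by exact_mod_cast hN'
  -- Because `2 ^ (d + 3) ≥ 32` for `d ≥ 2`. This covers both needs: `16 X ≤ 1` for the range bound,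
  -- by `π ≤ 1`, and `4 X ≤ π / 2` for the error.
  have hX32 : 32 * X ≤ π := by
    rcases hor with rfl | rfl
    · have h1 := hN.le
      have h2 : (32 : ℝ) ≤ 2 ^ (d + 3) := by
        calc (32 : ℝ) = 2 ^ 5 := by norm_num
          _ ≤ 2 ^ (d + 3) := pow_le_pow_right₀ (by norm_num) (by omega)
      have h3 : X * (N' : ℝ) ^ (d + 1) = T ^ (d + 2) := by
        rw [hX, div_pow]
        field_simp
        ring
      have h4 : 0 ≤ X := by positivity
      refine le_of_mul_le_mul_right (a := (N' : ℝ) ^ (d + 1)) ?_ (by positivity)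
      calc 32 * X * (N' : ℝ) ^ (d + 1) = 32 * T ^ (d + 2) := by rw [mul_assoc, h3]
        _ ≤ 2 ^ (d + 3) * T ^ (d + 2) := mul_le_mul_of_nonneg_right h2 (by positivity)
        _ ≤ _ := by linarith
    · simp [hX, hπ.le]
  -- Intervals longer than `1` would force `T > 1` and so `X > 1`, contrary to `32 X ≤ π ≤ 1`.
  have hε1 : T / N' ≤ 1 := by
    by_contra hlt
    rw [not_le] at hlt
    have h1 : 1 ≤ (N' : ℝ) := by exact_mod_cast hN'
    have h2 : 1 < T := by
      rw [lt_div_iff₀ hNpos] at hlt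
      linarith
    have h3 : 1 ≤ (T / N') ^ (d + 1) := one_le_pow₀ hlt.le
    nlinarith
  obtain ⟨b1, b2, b3, b4⟩ := hfol.quality_bounds hM hμ hT hN' hε1 (by linarith)
    -- Half of `π` on either side of the net value, so that the qualities of the strategies are
    -- within `π` of the value.
    (show 4 * (T * (T / N') ^ (d + 1)) ≤ π / 2 by linarith)
  have hP : ∑ l : Fin m, μ l * s.realArr 3 l 0 0 =
      ∑ l, μ l * M.netGrid G (d + 1) (T / N') N' l :=
    Finset.sum_congr rfl fun l _ => by rw [hval l]
  rw [hP]
  refine ⟨by linarith, by linarith, ?_, ?_, ?_⟩ <;> rw [abs_le] <;> constructor <;> linarith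

theorem netProg_solves {d : ℕ} (hd : d = 2 ∨ d = 3) : ∃ C : ℝ, ∀ (m n : ℕ)
    (M : MarkovGame (Fin m) (Fin n)), M.IsNormed → ∀ (G : Finset (Fin m)) (T π : ℝ), 0 ≤ T →
    0 < π → π ≤ 1 → ∃ (steps : ℕ) (s : Store),
      Exec (netProg d) (inputStore M G T π) steps s ∧ Solves (d + 1) M G T π s ∧
      (steps : ℝ) ≤ C * ((m : ℝ) ^ d * max 1 ((T / π) ^ (1 / ((d : ℝ) + 1)) * T) *
        ((n : ℝ) ^ (2 * d) * Real.log (n + 1))) := by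
  obtain ⟨K, hK⟩ := netProg_runs hd
  refine ⟨12 * K, fun m n M hM G T π hT hπ hπ1 => ?_⟩
  -- A game without locations has no initial distribution, so the powers of `m` in the bound are at
  -- least `1`.
  have hm : 0 < m := by
    rcases Nat.eq_zero_or_pos m with rfl | h
    · simpa using M.init_sum
    · exact h
  have hn : 0 < n := Fin.pos (M.exists_enabled ⟨0, hm⟩).choose
  obtain ⟨N, hN⟩ := exists_isNumber d (T := T) hπ
  have hTN : T = 0 → N = 0 := by
    rintro rfl
    by_contra h
    have := hN.lt 0 (by omega)
    simp at this
  have hNT : N = 0 → T = 0 := by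
    rintro rfl
    by_contra h
    have h1 := hN.le
    have h2 : 0 < T := lt_of_le_of_ne hT (Ne.symm h)
    have h3 : (0 : ℝ) < 2 ^ (d + 3) * T ^ (d + 2) := by positivity
    simp at h1
    linarith
  obtain ⟨steps, s, hex, hle, hinv, hr⟩ := hK m n M G T π N hM hm hn hT hN hTN
  refine ⟨steps, s, hex, hinv.solves hM (by omega) hT hπ hπ1 hN hNT hr, ?_⟩
  have h1 := hN.cast_add_one_le (by omega) hT hπ
  set Y := max 1 ((T / π) ^ (1 / ((d : ℝ) + 1)) * T) with hY
  have hY1 : 1 ≤ Y := le_max_left _ _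
  -- The logarithm is only needed not to be small: `n ≥ 1`, and `2 log 2 > 1`.
  have hlog : 1 ≤ 2 * Real.log (n + 1) := by
    have h2 : Real.log 2 ≤ Real.log (n + 1) := by
      refine Real.log_le_log (by norm_num) ?_
      have : (1 : ℝ) ≤ n := by exact_mod_cast hn
      linarith
    linarith [Real.log_two_gt_d9]
  have hP : (0 : ℝ) ≤ (m : ℝ) ^ d * (n : ℝ) ^ (2 * d) := by positivity
  calc (steps : ℝ) ≤ ((K * (m ^ d * n ^ (2 * d) * (N + 1)) : ℕ) : ℝ) := by exact_mod_cast hle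
    _ = K * ((m : ℝ) ^ d * (n : ℝ) ^ (2 * d) * ((N : ℝ) + 1)) := by push_cast; ring
    _ ≤ K * ((m : ℝ) ^ d * (n : ℝ) ^ (2 * d) * (6 * Y * (2 * Real.log (n + 1)))) := by
        refine mul_le_mul_of_nonneg_left (mul_le_mul_of_nonneg_left ?_ hP) (Nat.cast_nonneg K)
        exact h1.trans (le_mul_of_one_le_right (by linarith) hlog)
    _ = _ := by ring

end CTMG
end

theorem mainTheorem2 :
    (∃ (p : CTMG.Prog 2) (C : ℝ), ∀ (m n : ℕ) (M : CTMG.MarkovGame (Fin m) (Fin n)),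
      M.IsNormed → ∀ (G : Finset (Fin m)) (T π : ℝ), 0 ≤ T → 0 < π → π ≤ 1 →
        ∃ (steps : ℕ) (s : CTMG.Store),
          CTMG.Exec p (CTMG.inputStore M G T π) steps s ∧
          CTMG.Solves 3 M G T π s ∧
          (steps : ℝ) ≤ C * ((m : ℝ) ^ 2 * max 1 ((T / π) ^ (1 / 3 : ℝ) * T) *
            ((n : ℝ) ^ 4 * Real.log (n + 1)))) ∧
    (∃ (p : CTMG.Prog 3) (C : ℝ), ∀ (m n : ℕ) (M : CTMG.MarkovGame (Fin m) (Fin n)),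
      M.IsNormed → ∀ (G : Finset (Fin m)) (T π : ℝ), 0 ≤ T → 0 < π → π ≤ 1 →
        ∃ (steps : ℕ) (s : CTMG.Store),
          CTMG.Exec p (CTMG.inputStore M G T π) steps s ∧
          CTMG.Solves 4 M G T π s ∧
          (steps : ℝ) ≤ C * ((m : ℝ) ^ 3 * max 1 ((T / π) ^ (1 / 4 : ℝ) * T) *
            ((n : ℝ) ^ 6 * Real.log (n + 1)))) := by
  obtain ⟨C2, h2⟩ := CTMG.netProg_solves (d := 2) (Or.inl rfl)
  obtain ⟨C3, h3⟩ := CTMG.netProg_solves (d := 3) (Or.inr rfl)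
  refine ⟨⟨CTMG.netProg 2, C2, fun m n M hM G T π hT hπ hπ1 => ?_⟩,
    ⟨CTMG.netProg 3, C3, fun m n M hM G T π hT hπ hπ1 => ?_⟩⟩
  · obtain ⟨steps, s, e1, e2, e3⟩ := h2 m n M hM G T π hT hπ hπ1
    refine ⟨steps, s, e1, e2, ?_⟩
    rwa [show 1 / (((2 : ℕ) : ℝ) + 1) = 1 / 3 by norm_num] at e3
  · obtain ⟨steps, s, e1, e2, e3⟩ := h3 m n M hM G T π hT hπ hπ1
    refine ⟨steps, s, e1, e2, ?_⟩
    rwa [show 1 / (((3 : ℕ) : ℝ) + 1) = 1 / 4 by norm_num] at e3
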